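/- Let $(M,g)$ be a connected smooth $4$-dimensional Lorentzian manifold, with Levi-Civita connection $\nabla$ and Riemann tensor $R_{\alpha\beta\lambda\mu}$. Its Bel tensor is $$B_{\alpha\beta\lambda\mu}=R_{\alpha\rho\lambda\sigma}R_{\beta}{}^{\rho}{}_{\mu}{}^{\sigma}+R_{\alpha\rho\mu\sigma}R_{\beta}{}^{\rho}{}_{\lambda}{}^{\sigma}-\tfrac12 g_{\alpha\beta}R_{\rho\tau\lambda\sigma}R^{\rho\tau}{}_{\mu}{}^{\sigma}-\tfrac12 g_{\lambda\mu}R_{\alpha\rho\sigma\tau}R_{\beta}{}^{\rho\sigma\tau}+\tfrac18 g_{\alpha\beta}g_{\lambda\mu}R_{\rho\tau\sigma\nu}R^{\rho\tau\sigma\nu},$$ and the Bel current of vector fields $\xi_1,\xi_2,\xi_3$ is the vector field $j(\xi_1,\xi_2,\xi_3)$ with $j_\mu=B_{(\alpha\beta\lambda)\mu}\,\xi_1^\alpha\xi_2^\beta\xi_3^\lambda$. A vector field $v$ is called non-null if $g(v,v)\neq 0$ at every point; vector fields and the $1$-forms that $g$ associates with them are denoted by the same letter. No condition is imposed on the Ricci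 tensor. (1) Let $\xi$ be a smooth non-null Killing vector field that is integrable (hypersurface orthogonal), i.e. $\xi\wedge d\xi=0$. Then its Bel current is divergence-free: $\nabla_\mu j^\mu(\xi,\xi,\xi)=0$. (2) Let $\xi_1=\xi$ and $\xi_2=\eta$ be smooth non-null Killing vector fields, linearly independent over $\mathbb R$, with $[\xi,\eta]=0$, such that the group they generate acts orthogonally transitively, i.e. $\xi\wedge\eta\wedge d\xi=\xi\wedge\eta\wedge d\eta=0$. Then all the associated Bel currents are divergence-free: $\nabla_\mu j^\mu(\xi_L,\xi_M,\xi_N)=0$ for all $L,M,N\in\{1,2\}$ (four distinct currents, by symmetry). -/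

import Mathlib

open scoped Manifold ContDiff Topology

noncomputable section

/-! ## Tensor calculus in a coordinate domain of `ℝ⁴`

`G u` is the matrix of the components `g_{ij}` of a metric at the coordinate point `u`. All formulas
use the index conventions of classical tensor calculus, every repeated index being summed from
`0` to `3`. -/

namespace Coord

/-- Coordinate space. -/
abbrev R4 : Type := EuclideanSpace ℝ (Fin 4)

/-- The partial derivative `∂ᵢ f`. -/
def pd (i : Fin 4) (f : R4 → ℝ) (u : R4) : ℝ :=
  fderiv ℝ f u (EuclideanSpace.single i 1)

/-- The Christoffel symbols `Γᵏᵢⱼ = ½ gᵏˡ (∂ᵢ gⱼₗ + ∂ⱼ gᵢₗ - ∂ₗ gᵢⱼ)`. -/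
def christoffel (G : R4 → Matrix (Fin 4) (Fin 4) ℝ) (k i j : Fin 4) (u : R4) : ℝ :=
  (1 / 2) * ∑ l, (G u)⁻¹ k l *
    (pd i (fun v => G v j l) u + pd j (fun v => G v i l) u - pd l (fun v => G v i j) u)

/-- The curvature tensor
`Rᵃ_{bcd} = ∂_c Γᵃ_{db} - ∂_d Γᵃ_{cb} + Γᵃ_{ce} Γᵉ_{db} - Γᵃ_{de} Γᵉ_{cb}`. -/
def riemannUp (G : R4 → Matrix (Fin 4) (Fin 4) ℝ) (a b c d : Fin 4) (u : R4) : ℝ :=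
  pd c (christoffel G a d b) u - pd d (christoffel G a c b) u
    + ∑ e, (christoffel G a c e u * christoffel G e d b u
        - christoffel G a d e u * christoffel G e c b u)

/-- The Riemann tensor with all its indices lowered, `R_{abcd} = g_{ae} Rᵉ_{bcd}`. -/
def riemann (G : R4 → Matrix (Fin 4) (Fin 4) ℝ) (a b c d : Fin 4) (u : R4) : ℝ :=
  ∑ e, G u a e * riemannUp G e b c d u

/-- `R_a^r_b^s`: second and fourth index raised. -/
def riemann24 (G : R4 → Matrix (Fin 4) (Fin 4) ℝ) (a r b s : Fin 4) (u : R4) : ℝ :=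
  ∑ r', ∑ s', (G u)⁻¹ r r' * (G u)⁻¹ s s' * riemann G a r' b s' u

/-- `R^{rt}_b^s`: first, second and fourth index raised. -/
def riemann124 (G : R4 → Matrix (Fin 4) (Fin 4) ℝ) (r t b s : Fin 4) (u : R4) : ℝ :=
  ∑ r', (G u)⁻¹ r r' * riemann24 G r' t b s u

/-- `R_a^{rst}`: last three indices raised. -/
def riemann234 (G : R4 → Matrix (Fin 4) (Fin 4) ℝ) (a r s t : Fin 4) (u : R4) : ℝ :=
  ∑ s', (G u)⁻¹ s s' * riemann24 G a r s' t u

/-- `R^{rtsn}`: all indices raised. -/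
def riemann1234 (G : R4 → Matrix (Fin 4) (Fin 4) ℝ) (r t s n : Fin 4) (u : R4) : ℝ :=
  ∑ r', (G u)⁻¹ r r' * riemann234 G r' t s n u

/-- The Bel tensor
`B_{ablm} = R_{arls} R_b^r_m^s + R_{arms} R_b^r_l^s - ½ g_{ab} R_{rtls} R^{rt}_m^s
  - ½ g_{lm} R_{arst} R_b^{rst} + ⅛ g_{ab} g_{lm} R_{rtsn} R^{rtsn}`. -/
def bel (G : R4 → Matrix (Fin 4) (Fin 4) ℝ) (a b l m : Fin 4) (u : R4) : ℝ :=
  (∑ r, ∑ s, riemann G a r l s u * riemann24 G b r m s u)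
  + (∑ r, ∑ s, riemann G a r m s u * riemann24 G b r l s u)
  - (1 / 2) * G u a b * (∑ r, ∑ t, ∑ s, riemann G r t l s u * riemann124 G r t m s u)
  - (1 / 2) * G u l m * (∑ r, ∑ s, ∑ t, riemann G a r s t u * riemann234 G b r s t u)
  + (1 / 8) * G u a b * G u l m *
      (∑ r, ∑ t, ∑ s, ∑ n, riemann G r t s n u * riemann1234 G r t s n u)

/-- `B_{(abl)m}`: the Bel tensor symmetrized in its first three indices. -/
def belSymm (G : R4 → Matrix (Fin 4) (Fin 4) ℝ) (a b l m : Fin 4) (u : R4) : ℝ :=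
  (1 / 6) * (bel G a b l m u + bel G a l b m u + bel G b a l m u
    + bel G b l a m u + bel G l a b m u + bel G l b a m u)

/-- The Bel current (contravariant components)
`jᵏ = g^{km} B_{(abl)m} Xᵃ Yᵇ Zˡ` of three vector fields. -/
def belCurrent (G : R4 → Matrix (Fin 4) (Fin 4) ℝ) (X Y Z : Fin 4 → R4 → ℝ)
    (k : Fin 4) (u : R4) : ℝ :=
  ∑ m, (G u)⁻¹ k m * ∑ a, ∑ b, ∑ l, belSymm G a b l m u * X a u * Y b u * Z l u

/-- The covariant divergence `∇ₖ Vᵏ = ∂ₖ Vᵏ + Γᵏₖₗ Vˡ`. -/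
def divergence (G : R4 → Matrix (Fin 4) (Fin 4) ℝ) (V : Fin 4 → R4 → ℝ) (u : R4) : ℝ :=
  ∑ k, (pd k (V k) u + ∑ l, christoffel G k k l u * V l u)

/-- The 1-form associated with a vector field, `Xₐ = g_{ab} Xᵇ`. -/
def lower (G : R4 → Matrix (Fin 4) (Fin 4) ℝ) (X : Fin 4 → R4 → ℝ) (a : Fin 4) (u : R4) : ℝ :=
  ∑ b, G u a b * X b u

/-- The covariant derivative of a 1-form, `∇_b α_a = α_{a;b} = ∂_b α_a - Γᶜ_{ba} α_c`. -/
def covDeriv (G : R4 → Matrix (Fin 4) (Fin 4) ℝ) (α : Fin 4 → R4 → ℝ) (b a : Fin 4)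
    (u : R4) : ℝ :=
  pd b (α a) u - ∑ c, christoffel G c b a u * α c u

/-- The exterior derivative of a 1-form, `(dα)_{ab} = ∂_a α_b - ∂_b α_a`. -/
def extDer (α : Fin 4 → R4 → ℝ) (a b : Fin 4) (u : R4) : ℝ :=
  pd a (α b) u - pd b (α a) u

/-- `α ∧ dα = 0` at `u`: the full antisymmetrization of `α_a (dα)_{bc}` vanishes. -/
def WedgeExtDerZero (α : Fin 4 → R4 → ℝ) (u : R4) : Prop :=
  ∀ i : Fin 3 → Fin 4, ∑ σ : Equiv.Perm (Fin 3),
    ((Equiv.Perm.sign σ : ℤ) : ℝ) * (α (i (σ 0)) u * extDer α (i (σ 1)) (i (σ 2)) u) = 0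

/-- `α ∧ β ∧ dγ = 0` at `u`: the full antisymmetrization of `α_a β_b (dγ)_{cd}` vanishes. -/
def WedgeWedgeExtDerZero (α β γ : Fin 4 → R4 → ℝ) (u : R4) : Prop :=
  ∀ i : Fin 4 → Fin 4, ∑ σ : Equiv.Perm (Fin 4),
    ((Equiv.Perm.sign σ : ℤ) : ℝ) *
      (α (i (σ 0)) u * β (i (σ 1)) u * extDer γ (i (σ 2)) (i (σ 3)) u) = 0

end Coord

section Spacetime

variable (M : Type*) [TopologicalSpace M] [ChartedSpace (EuclideanSpace ℝ (Fin 4)) M]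
  [IsManifold (𝓡 4) ∞ M]

/-- A smooth Lorentzian metric, of signature `(-,+,+,+)`, on a smooth `4`-manifold. -/
structure LorentzMetric where
  /-- the scalar product on each tangent space -/
  val : ∀ p : M, TangentSpace (𝓡 4) p →L[ℝ] TangentSpace (𝓡 4) p →L[ℝ] ℝ
  symm : ∀ (p : M) (v w : TangentSpace (𝓡 4) p), val p v w = val p w v
  lorentzian : ∀ p : M, ∃ b : Module.Basis (Fin 4) ℝ (TangentSpace (𝓡 4) p), ∀ i j,
    val p (b i) (b j) = if i = j then (if i = 0 then -1 else 1) else 0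
  contMDiff : ContMDiff (𝓡 4)
    ((𝓡 4).prod 𝓘(ℝ, EuclideanSpace ℝ (Fin 4) →L[ℝ] EuclideanSpace ℝ (Fin 4) →L[ℝ] ℝ)) ∞
    (fun p => Bundle.TotalSpace.mk'
      (EuclideanSpace ℝ (Fin 4) →L[ℝ] EuclideanSpace ℝ (Fin 4) →L[ℝ] ℝ)
      (E := fun p : M => TangentSpace (𝓡 4) p →L[ℝ] TangentSpace (𝓡 4) p →L[ℝ] ℝ) p (val p))

end Spacetime

section Fields

variable {M : Type*} [TopologicalSpace M] [ChartedSpace (EuclideanSpace ℝ (Fin 4)) M]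

/-- The coordinate vector `∂ᵢ` of the chart `e`, at the point with coordinates `u`. -/
def coordVec (e : OpenPartialHomeomorph M (EuclideanSpace ℝ (Fin 4)))
    (i : Fin 4) (u : EuclideanSpace ℝ (Fin 4)) : TangentSpace (𝓡 4) (e.symm u) :=
  mfderiv (𝓡 4) (𝓡 4) e.symm u (EuclideanSpace.single i (1 : ℝ) : EuclideanSpace ℝ (Fin 4))

/-- The components `Xⁱ` of a vector field in the chart `e`, as functions of the coordinates. -/
def vecComp (e : OpenPartialHomeomorph M (EuclideanSpace ℝ (Fin 4)))
    (X : ∀ p : M, TangentSpace (𝓡 4) p) (i : Fin 4) (u : EuclideanSpace ℝ (Fin 4)) : ℝ :=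
  let v : EuclideanSpace ℝ (Fin 4) := mfderiv (𝓡 4) (𝓡 4) e (e.symm u) (X (e.symm u))
  v i

variable [IsManifold (𝓡 4) ∞ M]

/-- Smoothness of a vector field. -/
def IsSmoothField (X : ∀ p : M, TangentSpace (𝓡 4) p) : Prop :=
  ContMDiff (𝓡 4) (𝓡 4).tangent ∞ (fun p => (⟨p, X p⟩ : TangentBundle (𝓡 4) M))

namespace LorentzMetric

variable (g : LorentzMetric M)

/-- The matrix `g_{ij}` of the metric in the chart `e`, as a function of the coordinates. -/
def comp (e : OpenPartialHomeomorph M (EuclideanSpace ℝ (Fin 4)))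
    (u : EuclideanSpace ℝ (Fin 4)) : Matrix (Fin 4) (Fin 4) ℝ :=
  Matrix.of fun i j => g.val (e.symm u) (coordVec e i u) (coordVec e j u)

/-- The 1-form associated with `X`, in components in the chart `e`. -/
def flat (e : OpenPartialHomeomorph M (EuclideanSpace ℝ (Fin 4)))
    (X : ∀ p : M, TangentSpace (𝓡 4) p) : Fin 4 → EuclideanSpace ℝ (Fin 4) → ℝ :=
  Coord.lower (g.comp e) (vecComp e X)

/-- Smooth Killing vector fields: `∇_b X_a + ∇_a X_b = 0` in every smooth chart. -/
def IsKilling (X : ∀ p : M, TangentSpace (𝓡 4) p) : Prop :=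
  IsSmoothField X ∧
    ∀ e ∈ IsManifold.maximalAtlas (𝓡 4) ∞ M, ∀ u ∈ e.target, ∀ a b : Fin 4,
      Coord.covDeriv (g.comp e) (g.flat e X) b a u
        + Coord.covDeriv (g.comp e) (g.flat e X) a b u = 0

/-- `X` is nowhere null (in particular nowhere zero). -/
def NonNull (X : ∀ p : M, TangentSpace (𝓡 4) p) : Prop :=
  ∀ p : M, g.val p (X p) (X p) ≠ 0

/-- `X` is integrable (hypersurface orthogonal): `X ∧ dX = 0` for its associated 1-form. -/
def IsIntegrable (X : ∀ p : M, TangentSpace (𝓡 4) p) : Prop :=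
  ∀ e ∈ IsManifold.maximalAtlas (𝓡 4) ∞ M, ∀ u ∈ e.target,
    Coord.WedgeExtDerZero (g.flat e X) u

/-- The group generated by the Killing fields `X` and `Y` acts orthogonally transitively:
`X ∧ Y ∧ dX = X ∧ Y ∧ dY = 0` for the associated 1-forms. -/
def OrthogonallyTransitive (X Y : ∀ p : M, TangentSpace (𝓡 4) p) : Prop :=
  ∀ e ∈ IsManifold.maximalAtlas (𝓡 4) ∞ M, ∀ u ∈ e.target,
    Coord.WedgeWedgeExtDerZero (g.flat e X) (g.flat e Y) (g.flat e X) u ∧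
    Coord.WedgeWedgeExtDerZero (g.flat e X) (g.flat e Y) (g.flat e Y) u

/-- The Bel current `j(X, Y, Z)` is divergence-free: `∇ₖ jᵏ = 0` at every point, in every smooth
chart. -/
def BelCurrentDivergenceFree (X Y Z : ∀ p : M, TangentSpace (𝓡 4) p) : Prop :=
  ∀ e ∈ IsManifold.maximalAtlas (𝓡 4) ∞ M, ∀ u ∈ e.target,
    Coord.divergence (g.comp e)
      (Coord.belCurrent (g.comp e) (vecComp e X) (vecComp e Y) (vecComp e Z)) u = 0

end LorentzMetric

end Fields

end

/-!
The argument is local. In a coordinate domain the Bel current `J` of the Killing fields `X i` is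
computed pointwise from the metric, the curvature and the fields, in a way that is natural under
changes of frame (`belVec_pull`). Killing fields preserve the metric, the connection and the
curvature, so a Killing field that commutes with the `X i` preserves `J` (`lie_belVec`). If moreover
`J` is tangent to the orbits, then `J = ∑ aⁱ X i` with coefficients that are constant on the orbits,
and, Killing fields being divergence-free, `div J = ∑ X i (aⁱ) = 0`
(`divergence_eq_zero_of_mem_span`). It remains to see that the Bel tensor vanishes on three tangent
vectors and a normal one.

The integrability conditions say that `∇(X i)` maps normal vectors to tangent ones
(`ip_nab_eq_zero_of_wedge`, `ip_nab_eq_zero_of_wedge_wedge`). Differentiating this relation and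
`∇_{X j} X i = ∇_{X i} X j`, and using Kostant's formula `∇_z ∇X = R(z, X)` (`kostant`), one
expresses the curvature components with tangent arguments through the endomorphisms `∇(X i)`
(`orbitData`).

* If the tangent plane of the orbit is non-degenerate, it follows that the curvature vanishes
  whenever the number of normal arguments is odd, that is, the reflection in the normal space
  preserves it. The Bel tensor with three tangent arguments and a normal one changes sign under this
  reflection, so it vanishes (`OrbitData.belSymmForm_eq_zero`). For a single non-null field this is
  the only case.
* Two non-null fields may span a null plane on an open set. Let `l` be the combination of them, with
  constant coefficients, that is null and orthogonal to `ξ` at a given point. The vanishing of the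
  Gram determinant near the point implies `∇_l l = 0` there, and enough curvature components in a
  null frame vanish to make the Bel tensor vanish as required (`OrbitData.belForm_eq_zero_of_null`).

The divergence of `J` is continuous, so it suffices to treat a dense set of points
(`IsOrbitFamily.divergence_eq_zero`). The points where the two fields are independent are dense: if
`ξ` and `η` were dependent on an open set, a constant combination of them would vanish to first
order at a point (`exists_nab_eq_zero`), and a Killing field that does so vanishes on the connected
manifold (`IsKillingOn.eq_zero`, `LorentzMetric.eq_zero_of_killing`), against the independence
over `ℝ`.
-/

noncomputable section

namespace Coord

open Matrix

/-! ### The Bel tensor of an algebraic curvature tensor -/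

/-- Components of a covariant tensor of rank four. -/
abbrev Tensor4 : Type := Fin 4 → Fin 4 → Fin 4 → Fin 4 → ℝ

/-- Components of a vector, or of a covector, at a point. -/
abbrev Vec : Type := Fin 4 → ℝ

/-- Square matrices of size four. -/
abbrev Mat : Type := Matrix (Fin 4) (Fin 4) ℝ

/-- The bilinear form `(r, s) ↦ T(x, r, z, s)`, as a bilinear function of `x` and `z`. -/
def slice (T : Tensor4) : Vec →ₗ[ℝ] Vec →ₗ[ℝ] Mat :=
  LinearMap.mk₂ ℝ (fun x z => Matrix.of fun r s => ∑ a, ∑ c, x a * z c * T a r c s)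
    (fun x x' z => by ext; simp [add_mul, Finset.sum_add_distrib])
    (fun k x z => by
      ext; simp only [Matrix.of_apply, Pi.smul_apply, smul_eq_mul, Matrix.smul_apply,
        Finset.mul_sum, mul_assoc])
    (fun x z z' => by ext; simp [mul_add, add_mul, Finset.sum_add_distrib])
    (fun k x z => by
      ext; simp only [Matrix.of_apply, Pi.smul_apply, smul_eq_mul, Matrix.smul_apply,
        Finset.mul_sum, mul_assoc, mul_left_comm])

lemma slice_apply (T : Tensor4) (x z : Vec) (r s : Fin 4) :
    slice T x z r s = ∑ a, ∑ c, x a * z c * T a r c s := rfl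

/-- The value of a covariant tensor of rank four on four vectors. -/
def ev (T : Tensor4) (x y z w : Vec) : ℝ := y ⬝ᵥ (slice T x z *ᵥ w)

/-- The components of `T` in the frame formed by the columns of `E`. -/
def pull (E : Mat) (T : Tensor4) : Tensor4 :=
  fun a b c d => ev T (E.col a) (E.col b) (E.col c) (E.col d)

lemma ev_add₁ (T : Tensor4) (x x' y z w : Vec) :
    ev T (x + x') y z w = ev T x y z w + ev T x' y z w := by
  simp [ev, add_mulVec]

lemma ev_add₂ (T : Tensor4) (x y y' z w : Vec) :
    ev T x (y + y') z w = ev T x y z w + ev T x y' z w := by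
  simp [ev]

lemma ev_add₃ (T : Tensor4) (x y z z' w : Vec) :
    ev T x y (z + z') w = ev T x y z w + ev T x y z' w := by
  simp [ev, add_mulVec]

lemma ev_add₄ (T : Tensor4) (x y z w w' : Vec) :
    ev T x y z (w + w') = ev T x y z w + ev T x y z w' := by
  simp [ev, mulVec_add]

lemma ev_smul₁ (T : Tensor4) (r : ℝ) (x y z w : Vec) :
    ev T (r • x) y z w = r * ev T x y z w := by
  simp [ev, smul_mulVec]

lemma ev_smul₂ (T : Tensor4) (r : ℝ) (x y z w : Vec) :
    ev T x (r • y) z w = r * ev T x y z w := by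
  simp [ev]

lemma ev_smul₃ (T : Tensor4) (r : ℝ) (x y z w : Vec) :
    ev T x y (r • z) w = r * ev T x y z w := by
  simp [ev, smul_mulVec]

lemma ev_smul₄ (T : Tensor4) (r : ℝ) (x y z w : Vec) :
    ev T x y z (r • w) = r * ev T x y z w := by
  simp [ev, mulVec_smul]

lemma ev_single (T : Tensor4) (a b c d : Fin 4) :
    ev T (Pi.single a 1) (Pi.single b 1) (Pi.single c 1) (Pi.single d 1) = T a b c d := by
  simp [ev, slice_apply, Pi.single_apply, single_dotProduct]

lemma mulVec_eq_sum_col (E : Mat) (x : Vec) : E *ᵥ x = ∑ a, x a • E.col a := by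
  ext i; simp [mulVec, dotProduct, mul_comm]

lemma slice_pull (E : Mat) (T : Tensor4) (x z : Vec) :
    slice (pull E T) x z = Eᵀ * slice T (E *ᵥ x) (E *ᵥ z) * E := by
  ext r s
  have h : ∀ M : Mat, (Eᵀ * M * E) r s = E.col r ⬝ᵥ (M *ᵥ E.col s) := by
    intro M
    rw [Matrix.mul_assoc, Matrix.mul_apply]
    simp [dotProduct, mulVec, Matrix.mul_apply]
  rw [h, mulVec_eq_sum_col E x, mulVec_eq_sum_col E z]
  simp only [map_sum, map_smul, LinearMap.sum_apply, LinearMap.smul_apply, slice_apply, pull, ev,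
    sum_mulVec, smul_mulVec, dotProduct_sum, dotProduct_smul, smul_eq_mul, Finset.mul_sum,
    mul_assoc]
  rw [Finset.sum_comm]
  refine Finset.sum_congr rfl fun _ _ => Finset.sum_congr rfl fun _ _ => by ring

/-- Evaluating the components of `T` in the frame `E` on coordinate vectors is evaluating `T` on
the vectors with these coordinates. -/
lemma ev_pull (E : Mat) (T : Tensor4) (x y z w : Vec) :
    ev (pull E T) x y z w = ev T (E *ᵥ x) (E *ᵥ y) (E *ᵥ z) (E *ᵥ w) := by
  simp only [ev, slice_pull]
  rw [← mulVec_mulVec, ← mulVec_mulVec, dotProduct_mulVec, vecMul_transpose]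

/-- `Q_{ablm} = R_{arls} R_b^r_m^s`, with indices raised by `h`. -/
def quadr (h : Mat) (R : Tensor4) (x y z w : Vec) : ℝ :=
  ((slice R x z)ᵀ * h * slice R y w * hᵀ).trace

/-- Naturality of the quadratic expression under a change of frame: `k` is the inverse metric in
the frame `E`, `h` the inverse metric itself. -/
lemma quadr_pull {E h k : Mat} (hk : E * k * Eᵀ = h) (R : Tensor4) (x y z w : Vec) :
    quadr k (pull E R) x y z w = quadr h R (E *ᵥ x) (E *ᵥ y) (E *ᵥ z) (E *ᵥ w) := by
  have hk' : E * kᵀ * Eᵀ = hᵀ := by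
    rw [← hk]; simp [Matrix.transpose_mul, Matrix.mul_assoc]
  simp only [quadr, slice_pull, transpose_mul, transpose_transpose]
  rw [← hk', ← hk]
  simp only [Matrix.mul_assoc]
  rw [Matrix.trace_mul_comm]
  simp only [Matrix.mul_assoc]

lemma isLinearMap_quadr₁ (h : Mat) (R : Tensor4) (y z w : Vec) :
    IsLinearMap ℝ fun x => quadr h R x y z w :=
  ⟨fun _ _ => by simp [quadr, Matrix.add_mul],
    fun _ _ => by simp [quadr]⟩

lemma isLinearMap_quadr₂ (h : Mat) (R : Tensor4) (x z w : Vec) :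
    IsLinearMap ℝ fun y => quadr h R x y z w :=
  ⟨fun _ _ => by simp [quadr, Matrix.add_mul, Matrix.mul_add],
    fun _ _ => by simp [quadr]⟩

lemma isLinearMap_quadr₃ (h : Mat) (R : Tensor4) (x y w : Vec) :
    IsLinearMap ℝ fun z => quadr h R x y z w :=
  ⟨fun _ _ => by simp [quadr, Matrix.add_mul],
    fun _ _ => by simp [quadr]⟩

lemma isLinearMap_quadr₄ (h : Mat) (R : Tensor4) (x y z : Vec) :
    IsLinearMap ℝ fun w => quadr h R x y z w :=
  ⟨fun _ _ => by simp [quadr, Matrix.add_mul, Matrix.mul_add],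
    fun _ _ => by simp [quadr]⟩

/-- The index expression of `quadr`, with the second and fourth indices of the second factor
raised. -/
lemma quadr_single (h : Mat) (R : Tensor4) (a b l m : Fin 4) :
    quadr h R (Pi.single a 1) (Pi.single b 1) (Pi.single l 1) (Pi.single m 1) =
      ∑ r, ∑ s, R a r l s * ∑ r', ∑ s', h r r' * h s s' * R b r' m s' := by
  have hs : ∀ a l : Fin 4, slice R (Pi.single a 1) (Pi.single l 1) =
      Matrix.of fun r s => R a r l s := by
    intro a l; ext r s; simp [slice_apply, Pi.single_apply]
  rw [quadr, hs, hs, Matrix.mul_assoc, Matrix.mul_assoc, Matrix.trace_mul_comm, Matrix.trace]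
  simp only [diag_apply, Matrix.mul_apply, Matrix.transpose_apply, Matrix.of_apply,
    Finset.sum_mul, Finset.mul_sum]
  refine Finset.sum_congr rfl fun r _ => Finset.sum_congr rfl fun s _ =>
    Finset.sum_congr rfl fun r' _ => Finset.sum_congr rfl fun s' _ => by ring

lemma IsLinearMap.eq_sum {f : Vec → ℝ} (hf : IsLinearMap ℝ f) (x : Vec) :
    f x = ∑ a, x a * f (Pi.single a 1) := by
  conv_lhs => rw [← Matrix.one_mulVec x, mulVec_eq_sum_col]
  have := map_sum (hf.mk' f) (fun a => x a • (1 : Mat).col a) Finset.univ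
  simp only [IsLinearMap.mk'_apply, hf.map_smul, smul_eq_mul] at this
  rw [this]
  refine Finset.sum_congr rfl fun a _ => ?_
  rw [← Matrix.mulVec_single_one, Matrix.one_mulVec]

/-- The contraction `h^{rs} φ_{rs}`. -/
def contr (h : Mat) (φ : Vec → Vec → ℝ) : ℝ :=
  ∑ r, ∑ s, h r s * φ (Pi.single r 1) (Pi.single s 1)

/-- Contraction with the inverse metric does not depend on the frame. -/
lemma contr_pull {E h k : Mat} (hk : E * k * Eᵀ = h) {φ : Vec → Vec → ℝ}
    (h₁ : ∀ y, IsLinearMap ℝ fun x => φ x y) (h₂ : ∀ x, IsLinearMap ℝ (φ x)) :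
    contr k (fun x y => φ (E *ᵥ x) (E *ᵥ y)) = contr h φ := by
  -- both sides are traces of products of matrices, with `Φ` the Gram matrix of `φ`: `tr (h Φᵀ)`
  -- and `tr (k (Eᵀ Φ E)ᵀ)`
  have key : ∀ x y, φ x y = ∑ a, ∑ b, x a * y b * φ (Pi.single a 1) (Pi.single b 1) := by
    intro x y
    rw [IsLinearMap.eq_sum (h₁ y) x]
    refine Finset.sum_congr rfl fun a _ => ?_
    rw [IsLinearMap.eq_sum (h₂ _) y, Finset.mul_sum]
    simp only [mul_assoc]
  have e : ∀ (X : Mat), ∑ r, ∑ s, X r s * (Matrix.of fun a b =>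
      φ (Pi.single a 1) (Pi.single b 1)) r s =
      (X * (Matrix.of fun a b => φ (Pi.single a 1) (Pi.single b 1) : Mat)ᵀ).trace := by
    intro X; simp [Matrix.trace, Matrix.mul_apply]
  have e' : ∀ r s, φ (E *ᵥ Pi.single r 1) (E *ᵥ Pi.single s 1) =
      (Eᵀ * (Matrix.of fun a b => φ (Pi.single a 1) (Pi.single b 1) : Mat) * E) r s := by
    intro r s
    rw [key, Finset.sum_comm]
    simp only [mulVec_single_one, col_apply, Matrix.mul_apply, transpose_apply, of_apply,
      Finset.sum_mul]
    refine Finset.sum_congr rfl fun _ _ => Finset.sum_congr rfl fun _ _ => by ring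
  have e'' := e h
  simp only [of_apply] at e''
  unfold contr
  rw [e'', ← hk]
  simp only [e']
  set Φ : Mat := Matrix.of fun a b => φ (Pi.single a 1) (Pi.single b 1)
  have : ∑ r, ∑ s, k r s * (Eᵀ * Φ * E) r s = (k * (Eᵀ * Φ * E)ᵀ).trace := by
    rw [Matrix.trace]; simp only [diag_apply, Matrix.mul_apply (M := k), transpose_apply]
  rw [this, Matrix.transpose_mul, Matrix.transpose_mul, transpose_transpose]
  simp only [Matrix.mul_assoc]
  rw [Matrix.trace_mul_comm E]
  simp only [Matrix.mul_assoc]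

lemma contr_add (h : Mat) (φ ψ : Vec → Vec → ℝ) :
    contr h (fun r s => φ r s + ψ r s) = contr h φ + contr h ψ := by
  simp [contr, mul_add, Finset.sum_add_distrib]

lemma contr_mul (h : Mat) (c : ℝ) (φ : Vec → Vec → ℝ) :
    contr h (fun r s => c * φ r s) = c * contr h φ := by
  simp only [contr, Finset.mul_sum, mul_left_comm]

/-- The Bel tensor of the algebraic curvature tensor `R` for the metric `g`, evaluated on four
vectors; `h` is the inverse of `g`. -/
def belForm (g h : Mat) (R : Tensor4) (x y z w : Vec) : ℝ :=
  quadr h R x y z w + quadr h R x y w z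
  - (1 / 2) * (x ⬝ᵥ g *ᵥ y) * contr h (fun r s => quadr h R r s z w)
  - (1 / 2) * (z ⬝ᵥ g *ᵥ w) * contr h (fun r s => quadr h R x y r s)
  + (1 / 8) * (x ⬝ᵥ g *ᵥ y) * (z ⬝ᵥ g *ᵥ w) *
    contr h (fun r s => contr h (fun r' s' => quadr h R r s r' s'))

lemma isLinearMap_contr {h : Mat} {φ : Vec → Vec → Vec → ℝ}
    (hφ : ∀ x y, IsLinearMap ℝ fun z => φ x y z) :
    IsLinearMap ℝ fun z => contr h fun x y => φ x y z :=
  ⟨fun z z' => by simp [contr, (hφ _ _).map_add, mul_add, Finset.sum_add_distrib],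
    fun c z => by
      simp only [contr, (hφ _ _).map_smul, smul_eq_mul, Finset.mul_sum]
      refine Finset.sum_congr rfl fun _ _ => Finset.sum_congr rfl fun _ _ => by ring⟩

lemma dot_pull (E g : Mat) (x y : Vec) :
    x ⬝ᵥ (Eᵀ * g * E) *ᵥ y = (E *ᵥ x) ⬝ᵥ g *ᵥ (E *ᵥ y) := by
  rw [← mulVec_mulVec, ← mulVec_mulVec, dotProduct_mulVec, vecMul_transpose]

/-- The Bel tensor is natural under changes of frame; `k` is the inverse metric in the frame `E`.
-/
lemma belForm_pull {E g h k : Mat} (hk : E * k * Eᵀ = h) (R : Tensor4) (x y z w : Vec) :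
    belForm (Eᵀ * g * E) k (pull E R) x y z w =
      belForm g h R (E *ᵥ x) (E *ᵥ y) (E *ᵥ z) (E *ᵥ w) := by
  simp only [belForm, quadr_pull hk, dot_pull]
  rw [contr_pull hk (φ := fun r s => quadr h R r s (E *ᵥ z) (E *ᵥ w))
      (fun _ => isLinearMap_quadr₁ ..) (fun _ => isLinearMap_quadr₂ ..),
    contr_pull hk (φ := fun r s => quadr h R (E *ᵥ x) (E *ᵥ y) r s)
      (fun _ => isLinearMap_quadr₃ ..) (fun _ => isLinearMap_quadr₄ ..)]
  congr 2
  rw [← contr_pull hk (φ := fun r s => contr h fun r' s' => quadr h R r s r' s')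
    (fun _ => isLinearMap_contr fun _ _ => isLinearMap_quadr₁ ..)
    (fun _ => isLinearMap_contr fun _ _ => isLinearMap_quadr₂ ..)]
  congr 1
  funext r s
  exact contr_pull hk (φ := fun r' s' => quadr h R (E *ᵥ r) (E *ᵥ s) r' s')
      (fun _ => isLinearMap_quadr₃ ..) (fun _ => isLinearMap_quadr₄ ..)

lemma isLinearMap_belForm₁ (g h : Mat) (R : Tensor4) (y z w : Vec) :
    IsLinearMap ℝ fun x => belForm g h R x y z w := by
  constructor
  · intro x x'
    simp only [belForm, (isLinearMap_quadr₁ h R _ _ _).map_add, contr_add, add_dotProduct]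
    ring
  · intro c x
    simp only [belForm, (isLinearMap_quadr₁ h R _ _ _).map_smul, contr_mul,
      smul_dotProduct, smul_eq_mul]
    ring

lemma isLinearMap_belForm₂ (g h : Mat) (R : Tensor4) (x z w : Vec) :
    IsLinearMap ℝ fun y => belForm g h R x y z w := by
  constructor
  · intro x x'
    simp only [belForm, (isLinearMap_quadr₂ h R _ _ _).map_add, contr_add, mulVec_add,
      dotProduct_add]
    ring
  · intro c x
    simp only [belForm, (isLinearMap_quadr₂ h R _ _ _).map_smul, contr_mul, mulVec_smul,
      dotProduct_smul, smul_eq_mul]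
    ring

lemma isLinearMap_belForm₃ (g h : Mat) (R : Tensor4) (x y w : Vec) :
    IsLinearMap ℝ fun z => belForm g h R x y z w := by
  constructor
  · intro x x'
    simp only [belForm, (isLinearMap_quadr₃ h R _ _ _).map_add,
      (isLinearMap_quadr₄ h R _ _ _).map_add, contr_add, add_dotProduct]
    ring
  · intro c x
    simp only [belForm, (isLinearMap_quadr₃ h R _ _ _).map_smul,
      (isLinearMap_quadr₄ h R _ _ _).map_smul, contr_mul, smul_dotProduct, smul_eq_mul]
    ring

lemma isLinearMap_belForm₄ (g h : Mat) (R : Tensor4) (x y z : Vec) :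
    IsLinearMap ℝ fun w => belForm g h R x y z w := by
  constructor
  · intro x x'
    simp only [belForm, (isLinearMap_quadr₃ h R _ _ _).map_add,
      (isLinearMap_quadr₄ h R _ _ _).map_add, contr_add, mulVec_add, dotProduct_add]
    ring
  · intro c x
    simp only [belForm, (isLinearMap_quadr₃ h R _ _ _).map_smul,
      (isLinearMap_quadr₄ h R _ _ _).map_smul, contr_mul, smul_eq_mul, mulVec_smul, dotProduct_smul]
    ring

/-- The Bel tensor symmetrized in its first three arguments. -/
def belSymmForm (g h : Mat) (R : Tensor4) (x y z w : Vec) : ℝ :=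
  (1 / 6) * (belForm g h R x y z w + belForm g h R x z y w + belForm g h R y x z w
    + belForm g h R y z x w + belForm g h R z x y w + belForm g h R z y x w)

lemma isLinearMap_belSymmForm₁ (g h : Mat) (R : Tensor4) (y z w : Vec) :
    IsLinearMap ℝ fun x => belSymmForm g h R x y z w := by
  constructor <;> intros <;>
  simp only [belSymmForm, (isLinearMap_belForm₁ g h R _ _ _).map_add,
    (isLinearMap_belForm₂ g h R _ _ _).map_add, (isLinearMap_belForm₃ g h R _ _ _).map_add,
    (isLinearMap_belForm₁ g h R _ _ _).map_smul, (isLinearMap_belForm₂ g h R _ _ _).map_smul,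
    (isLinearMap_belForm₃ g h R _ _ _).map_smul, smul_eq_mul] <;> ring

lemma isLinearMap_belSymmForm₂ (g h : Mat) (R : Tensor4) (x z w : Vec) :
    IsLinearMap ℝ fun y => belSymmForm g h R x y z w := by
  constructor <;> intros <;>
  simp only [belSymmForm, (isLinearMap_belForm₁ g h R _ _ _).map_add,
    (isLinearMap_belForm₂ g h R _ _ _).map_add, (isLinearMap_belForm₃ g h R _ _ _).map_add,
    (isLinearMap_belForm₁ g h R _ _ _).map_smul, (isLinearMap_belForm₂ g h R _ _ _).map_smul,
    (isLinearMap_belForm₃ g h R _ _ _).map_smul, smul_eq_mul] <;> ring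

lemma isLinearMap_belSymmForm₃ (g h : Mat) (R : Tensor4) (x y w : Vec) :
    IsLinearMap ℝ fun z => belSymmForm g h R x y z w := by
  constructor <;> intros <;>
  simp only [belSymmForm, (isLinearMap_belForm₁ g h R _ _ _).map_add,
    (isLinearMap_belForm₂ g h R _ _ _).map_add, (isLinearMap_belForm₃ g h R _ _ _).map_add,
    (isLinearMap_belForm₁ g h R _ _ _).map_smul, (isLinearMap_belForm₂ g h R _ _ _).map_smul,
    (isLinearMap_belForm₃ g h R _ _ _).map_smul, smul_eq_mul] <;> ring

lemma isLinearMap_belSymmForm₄ (g h : Mat) (R : Tensor4) (x y z : Vec) :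
    IsLinearMap ℝ fun w => belSymmForm g h R x y z w := by
  constructor <;> intros <;>
  simp only [belSymmForm, (isLinearMap_belForm₄ g h R _ _ _).map_add,
    (isLinearMap_belForm₄ g h R _ _ _).map_smul, smul_eq_mul] <;> ring

lemma belSymmForm_pull {E g h k : Mat} (hk : E * k * Eᵀ = h) (R : Tensor4) (x y z w : Vec) :
    belSymmForm (Eᵀ * g * E) k (pull E R) x y z w =
      belSymmForm g h R (E *ᵥ x) (E *ᵥ y) (E *ᵥ z) (E *ᵥ w) := by
  simp only [belSymmForm, belForm_pull hk]

/-- The Bel current of three vectors for the algebraic curvature tensor `R` and the metric `g`. -/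
def belVec (g : Mat) (R : Tensor4) (x y z : Vec) : Vec :=
  g⁻¹ *ᵥ fun m => belSymmForm g g⁻¹ R x y z (Pi.single m 1)

/-- The Bel current is characterized by its scalar products. -/
lemma dot_belVec {g : Mat} (hg : IsUnit g.det) (R : Tensor4) (x y z w : Vec) :
    w ⬝ᵥ g *ᵥ belVec g R x y z = belSymmForm g g⁻¹ R x y z w := by
  rw [belVec, mulVec_mulVec, Matrix.mul_nonsing_inv _ hg, one_mulVec,
    IsLinearMap.eq_sum (isLinearMap_belSymmForm₄ g g⁻¹ R x y z) w]
  rfl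

/-- The inverse of the metric in the frame `E`, transported back, is the inverse metric. -/
lemma inv_pull {E g : Mat} (hE : IsUnit E.det) :
    E * (Eᵀ * g * E)⁻¹ * Eᵀ = g⁻¹ := by
  have hE' : IsUnit Eᵀ.det := by rwa [det_transpose]
  rw [Matrix.mul_inv_rev, Matrix.mul_inv_rev, ← Matrix.mul_assoc, Matrix.mul_nonsing_inv _ hE,
    Matrix.one_mul, Matrix.mul_assoc, Matrix.nonsing_inv_mul _ hE', Matrix.mul_one]

/-- The Bel current is equivariant under changes of frame. -/
lemma belVec_pull {E g : Mat} (hE : IsUnit E.det) (hg : IsUnit g.det) (R : Tensor4)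
    (x y z : Vec) :
    E *ᵥ belVec (Eᵀ * g * E) (pull E R) x y z =
      belVec g R (E *ᵥ x) (E *ᵥ y) (E *ᵥ z) := by
  have hg' : IsUnit (Eᵀ * g * E).det := by
    rw [det_mul, det_mul, det_transpose]; exact (hE.mul hg).mul hE
  -- the two sides have the same scalar product with every vector
  have h1 : ∀ w, w ⬝ᵥ g *ᵥ (E *ᵥ belVec (Eᵀ * g * E) (pull E R) x y z) =
      w ⬝ᵥ g *ᵥ belVec g R (E *ᵥ x) (E *ᵥ y) (E *ᵥ z) := by
    intro w
    have hw : w = E *ᵥ (E⁻¹ *ᵥ w) := by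
      rw [mulVec_mulVec, Matrix.mul_nonsing_inv _ hE, one_mulVec]
    rw [hw, ← dot_pull, dot_belVec hg', belSymmForm_pull (inv_pull hE), dot_belVec hg]
  have h2 : g *ᵥ (E *ᵥ belVec (Eᵀ * g * E) (pull E R) x y z) =
      g *ᵥ belVec g R (E *ᵥ x) (E *ᵥ y) (E *ᵥ z) := by
    refine dotProduct_eq _ _ fun w => ?_
    rw [dotProduct_comm, h1 w, dotProduct_comm]
  have h3 := congrArg (fun v => g⁻¹ *ᵥ v) h2
  simpa only [mulVec_mulVec, ← Matrix.mul_assoc, Matrix.nonsing_inv_mul _ hg, Matrix.one_mul,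
    one_mulVec] using h3

/-! ### The Bel current in index-free form -/

/-- The Riemann tensor at a point, with all its indices lowered. -/
def riem (G : R4 → Mat) (u : R4) : Tensor4 := fun a b c d => riemann G a b c d u

lemma quadr_single_riem (G : R4 → Mat) (u : R4) (a b l m : Fin 4) :
    quadr (G u)⁻¹ (riem G u) (Pi.single a 1) (Pi.single b 1) (Pi.single l 1) (Pi.single m 1) =
      ∑ r, ∑ s, riemann G a r l s u * riemann24 G b r m s u :=
  quadr_single ..

lemma dot_single (g : Mat) (a b : Fin 4) :
    (Pi.single a 1 : Vec) ⬝ᵥ g *ᵥ (Pi.single b 1) = g a b := by simp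

/-- The components of the Bel tensor are the values of `belForm` on the coordinate vectors. -/
lemma bel_eq_belForm (G : R4 → Mat) (u : R4) (a b l m : Fin 4) :
    bel G a b l m u = belForm (G u) (G u)⁻¹ (riem G u) (Pi.single a 1) (Pi.single b 1)
      (Pi.single l 1) (Pi.single m 1) := by
  unfold bel belForm
  -- the three traces that occur in the Bel tensor
  have h3 : ∑ r, ∑ t, ∑ s, riemann G r t l s u * riemann124 G r t m s u =
      contr (G u)⁻¹ fun r s => quadr (G u)⁻¹ (riem G u) r s (Pi.single l 1) (Pi.single m 1) := by
    simp only [contr, quadr_single_riem, riemann124, Finset.mul_sum]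
    refine Finset.sum_congr rfl fun r _ => ?_
    conv_rhs => rw [Finset.sum_comm]
    refine Finset.sum_congr rfl fun t _ => ?_
    conv_rhs => rw [Finset.sum_comm]
    refine Finset.sum_congr rfl fun s _ => Finset.sum_congr rfl fun r' _ => by ring
  have h4 : ∑ r, ∑ s, ∑ t, riemann G a r s t u * riemann234 G b r s t u =
      contr (G u)⁻¹ fun r s => quadr (G u)⁻¹ (riem G u) (Pi.single a 1) (Pi.single b 1) r s := by
    simp only [contr, quadr_single_riem, riemann234, Finset.mul_sum]
    rw [Finset.sum_comm]
    refine Finset.sum_congr rfl fun s _ => ?_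
    conv_rhs => rw [Finset.sum_comm]
    refine Finset.sum_congr rfl fun r _ => ?_
    conv_rhs => rw [Finset.sum_comm]
    refine Finset.sum_congr rfl fun t _ => Finset.sum_congr rfl fun s' _ => by ring
  have h5 : ∑ r, ∑ t, ∑ s, ∑ n, riemann G r t s n u * riemann1234 G r t s n u =
      contr (G u)⁻¹ fun r s => contr (G u)⁻¹ fun r' s' =>
        quadr (G u)⁻¹ (riem G u) r s r' s' := by
    have h4' : ∀ r r' : Fin 4, (contr (G u)⁻¹ fun r₁ s₁ => quadr (G u)⁻¹ (riem G u)
        (Pi.single r 1) (Pi.single r' 1) r₁ s₁) =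
        ∑ t, ∑ s, ∑ n, riemann G r t s n u * riemann234 G r' t s n u := by
      intro a b
      simp only [contr, quadr_single_riem, riemann234, Finset.mul_sum]
      conv_rhs => rw [Finset.sum_comm]
      refine Finset.sum_congr rfl fun s _ => ?_
      rw [Finset.sum_comm]
      refine Finset.sum_congr rfl fun r _ => ?_
      rw [Finset.sum_comm]
      refine Finset.sum_congr rfl fun t _ => Finset.sum_congr rfl fun s' _ => by ring
    rw [contr]
    simp only [h4', riemann1234, Finset.mul_sum]
    refine Finset.sum_congr rfl fun r _ => ?_
    conv_rhs => rw [Finset.sum_comm]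
    refine Finset.sum_congr rfl fun t _ => ?_
    conv_rhs => rw [Finset.sum_comm]
    refine Finset.sum_congr rfl fun s _ => ?_
    conv_rhs => rw [Finset.sum_comm]
    refine Finset.sum_congr rfl fun n _ => Finset.sum_congr rfl fun r' _ => by ring
  rw [h3, h4, h5, quadr_single_riem, quadr_single_riem, dot_single, dot_single]

/-- The values at a point of the components of a vector field. -/
def vec (X : Fin 4 → R4 → ℝ) (u : R4) : Vec := fun a => X a u

/-- The Bel current of three vector fields is computed pointwise by `belVec`. -/
lemma belCurrent_eq_belVec (G : R4 → Mat) (X Y Z : Fin 4 → R4 → ℝ) (k : Fin 4) (u : R4) :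
    belCurrent G X Y Z k u = belVec (G u) (riem G u) (vec X u) (vec Y u) (vec Z u) k := by
  unfold belCurrent belVec mulVec dotProduct
  refine Finset.sum_congr rfl fun m _ => ?_
  congr 1
  beta_reduce
  rw [IsLinearMap.eq_sum (isLinearMap_belSymmForm₁ ..) (vec X u)]
  refine Finset.sum_congr rfl fun a _ => ?_
  rw [IsLinearMap.eq_sum (isLinearMap_belSymmForm₂ ..) (vec Y u), Finset.mul_sum]
  refine Finset.sum_congr rfl fun b _ => ?_
  rw [IsLinearMap.eq_sum (isLinearMap_belSymmForm₃ ..) (vec Z u), Finset.mul_sum, Finset.mul_sum]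
  refine Finset.sum_congr rfl fun l _ => ?_
  simp only [belSymm, bel_eq_belForm, belSymmForm, vec]
  ring

/-! ### Partial derivatives of functions, vectors and matrices -/

section Calculus

variable {U : Set R4} {u : R4}

/-- Smoothness of a function on `U`. -/
abbrev Sm (U : Set R4) (f : R4 → ℝ) : Prop := ContDiffOn ℝ ∞ f U

lemma Sm.differentiableAt {f : R4 → ℝ} (hf : Sm U f) (hU : IsOpen U) (hu : u ∈ U) :
    DifferentiableAt ℝ f u :=
  (hf.contDiffAt (hU.mem_nhds hu)).differentiableAt (by simp)

lemma Sm.pd {f : R4 → ℝ} (hf : Sm U f) (hU : IsOpen U) (i : Fin 4) : Sm U (pd i f) := by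
  have h : ContDiffOn ℝ ∞ (fderiv ℝ f) U := hf.fderiv_of_isOpen hU (by simp)
  exact h.clm_apply contDiffOn_const

lemma Sm.sum {ι : Type*} {s : Finset ι} {f : ι → R4 → ℝ} (hf : ∀ i ∈ s, Sm U (f i)) :
    Sm U fun u => ∑ i ∈ s, f i u := ContDiffOn.sum hf

lemma pd_congr {f g : R4 → ℝ} (hU : IsOpen U) (hu : u ∈ U) (h : ∀ v ∈ U, f v = g v) (i : Fin 4) :
    pd i f u = pd i g u := by
  have : f =ᶠ[𝓝 u] g := Filter.eventually_of_mem (hU.mem_nhds hu) h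
  simp only [pd, this.fderiv_eq]

lemma pd_add {f g : R4 → ℝ} (hf : DifferentiableAt ℝ f u) (hg : DifferentiableAt ℝ g u)
    (i : Fin 4) : pd i (fun v => f v + g v) u = pd i f u + pd i g u := by
  simp [pd, fderiv_fun_add hf hg]

lemma pd_sub {f g : R4 → ℝ} (hf : DifferentiableAt ℝ f u) (hg : DifferentiableAt ℝ g u)
    (i : Fin 4) : pd i (fun v => f v - g v) u = pd i f u - pd i g u := by
  simp [pd, fderiv_fun_sub hf hg]

lemma pd_mul {f g : R4 → ℝ} (hf : DifferentiableAt ℝ f u) (hg : DifferentiableAt ℝ g u)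
    (i : Fin 4) : pd i (fun v => f v * g v) u = pd i f u * g u + f u * pd i g u := by
  simp [pd, fderiv_fun_mul hf hg]; ring

lemma pd_sum {ι : Type*} {s : Finset ι} {f : ι → R4 → ℝ}
    (hf : ∀ i ∈ s, DifferentiableAt ℝ (f i) u) (i : Fin 4) :
    pd i (fun v => ∑ j ∈ s, f j v) u = ∑ j ∈ s, pd i (f j) u := by
  simp [pd, fderiv_fun_sum hf]

@[simp] lemma pd_const (c : ℝ) (i : Fin 4) : pd i (fun _ => c) u = 0 := by
  simp [pd]

/-- Symmetry of second derivatives. -/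
lemma pd_comm {f : R4 → ℝ} (hf : Sm U f) (hU : IsOpen U) (hu : u ∈ U) (i j : Fin 4) :
    pd i (pd j f) u = pd j (pd i f) u := by
  have hf' := hf.contDiffAt (hU.mem_nhds hu)
  have hd : DifferentiableAt ℝ (fderiv ℝ f) u :=
    (hf'.fderiv_right (m := ∞) (by simp)).differentiableAt (by simp)
  have hs : IsSymmSndFDerivAt ℝ f u := hf'.isSymmSndFDerivAt (by
    rw [minSmoothness_of_isRCLikeNormedField]
    exact WithTop.coe_le_coe.2 (le_top : (2 : ℕ∞) ≤ ⊤))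
  have key : ∀ a b : Fin 4, pd a (pd b f) u =
      fderiv ℝ (fderiv ℝ f) u (EuclideanSpace.single a 1) (EuclideanSpace.single b 1) := by
    intro a b
    have h1 : pd b f = fun v => fderiv ℝ f v (EuclideanSpace.single b 1) := rfl
    rw [h1, pd, fderiv_clm_apply hd (differentiableAt_const _)]
    simp
  rw [key, key]
  exact hs _ _

/-- Smoothness of a vector field on `U`, given by its components. -/
abbrev SmV (U : Set R4) (X : R4 → Vec) : Prop := ∀ a, Sm U fun v => X v a

/-- Smoothness of a matrix-valued function on `U`. -/
abbrev SmM (U : Set R4) (M : R4 → Mat) : Prop := ∀ a b, Sm U fun v => M v a b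

/-- The partial derivative of a vector-valued function. -/
def pdV (i : Fin 4) (X : R4 → Vec) (u : R4) : Vec := fun a => pd i (fun v => X v a) u

/-- The partial derivative of a matrix-valued function. -/
def pdM (i : Fin 4) (M : R4 → Mat) (u : R4) : Mat := Matrix.of fun a b => pd i (fun v => M v a b) u

lemma SmM.mul {M N : R4 → Mat} (hM : SmM U M) (hN : SmM U N) : SmM U fun v => M v * N v := by
  intro a b
  simp only [Matrix.mul_apply]
  exact Sm.sum fun e _ => (hM a e).mul (hN e b)

lemma SmM.add {M N : R4 → Mat} (hM : SmM U M) (hN : SmM U N) : SmM U fun v => M v + N v :=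
  fun a b => (hM a b).add (hN a b)

lemma SmM.sub {M N : R4 → Mat} (hM : SmM U M) (hN : SmM U N) : SmM U fun v => M v - N v :=
  fun a b => (hM a b).sub (hN a b)

lemma SmM.transpose {M : R4 → Mat} (hM : SmM U M) : SmM U fun v => (M v)ᵀ :=
  fun a b => hM b a

lemma SmM.mulVec {M : R4 → Mat} {X : R4 → Vec} (hM : SmM U M) (hX : SmV U X) :
    SmV U fun v => M v *ᵥ X v := by
  intro a
  simp only [Matrix.mulVec, dotProduct]
  exact Sm.sum fun e _ => (hM a e).mul (hX e)

lemma SmV.dot {X Y : R4 → Vec} (hX : SmV U X) (hY : SmV U Y) : Sm U fun v => X v ⬝ᵥ Y v := by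
  simp only [dotProduct]
  exact Sm.sum fun e _ => (hX e).mul (hY e)

lemma SmM.pdM {M : R4 → Mat} (hM : SmM U M) (hU : IsOpen U) (i : Fin 4) : SmM U (pdM i M) :=
  fun a b => (hM a b).pd hU i

lemma SmV.pdV {X : R4 → Vec} (hX : SmV U X) (hU : IsOpen U) (i : Fin 4) : SmV U (pdV i X) :=
  fun a => (hX a).pd hU i

lemma SmM.det {n : Type*} [Fintype n] [DecidableEq n] {M : R4 → Matrix n n ℝ}
    (hM : ∀ a b, Sm U fun v => M v a b) :
    Sm U fun v => (M v).det := by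
  simp only [Matrix.det_apply']
  exact Sm.sum fun σ _ => contDiffOn_const.mul (contDiffOn_prod fun i _ => hM _ _)

lemma SmM.inv {n : Type*} [Fintype n] [DecidableEq n] {M : R4 → Matrix n n ℝ}
    (hM : ∀ a b, Sm U fun v => M v a b) (hd : ∀ v ∈ U, IsUnit (M v).det) (a b : n) :
    Sm U fun v => (M v)⁻¹ a b := by
  have h1 : ∀ v ∈ U, (M v)⁻¹ a b = (M v).det⁻¹ * ((M v).updateRow b (Pi.single a 1)).det := by
    intro v _
    rw [Matrix.inv_def, Matrix.smul_apply, Matrix.adjugate_apply, Ring.inverse_eq_inv',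
      smul_eq_mul]
  refine ContDiffOn.congr ?_ h1
  refine ((SmM.det hM).inv fun v hv => (hd v hv).ne_zero).mul (SmM.det fun i j => ?_)
  by_cases hi : i = b
  · subst hi; simpa using contDiffOn_const
  · simpa [Matrix.updateRow_ne hi] using hM i j

lemma pdM_mul {M N : R4 → Mat} (hU : IsOpen U) (hu : u ∈ U) (hM : SmM U M) (hN : SmM U N)
    (i : Fin 4) : pdM i (fun v => M v * N v) u = pdM i M u * N u + M u * pdM i N u := by
  ext a b
  have h1 := fun a b => (hM a b).differentiableAt hU hu
  have h2 := fun a b => (hN a b).differentiableAt hU hu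
  simp only [pdM, Matrix.of_apply, Matrix.mul_apply, Matrix.add_apply]
  rw [pd_sum fun e _ => (h1 a e).fun_mul (h2 e b), ← Finset.sum_add_distrib]
  exact Finset.sum_congr rfl fun e _ => pd_mul (h1 a e) (h2 e b) i

lemma pdM_add {M N : R4 → Mat} (hU : IsOpen U) (hu : u ∈ U) (hM : SmM U M) (hN : SmM U N)
    (i : Fin 4) : pdM i (fun v => M v + N v) u = pdM i M u + pdM i N u := by
  ext a b
  exact pd_add ((hM a b).differentiableAt hU hu) ((hN a b).differentiableAt hU hu) i

lemma pdM_sub {M N : R4 → Mat} (hU : IsOpen U) (hu : u ∈ U) (hM : SmM U M) (hN : SmM U N)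
    (i : Fin 4) : pdM i (fun v => M v - N v) u = pdM i M u - pdM i N u := by
  ext a b
  exact pd_sub ((hM a b).differentiableAt hU hu) ((hN a b).differentiableAt hU hu) i

lemma pdM_transpose (M : R4 → Mat) (i : Fin 4) : pdM i (fun v => (M v)ᵀ) u = (pdM i M u)ᵀ := rfl

lemma pdM_comm {M : R4 → Mat} (hU : IsOpen U) (hu : u ∈ U) (hM : SmM U M) (i j : Fin 4) :
    pdM i (pdM j M) u = pdM j (pdM i M) u := by
  ext a b
  exact pd_comm (hM a b) hU hu i j

lemma pdM_congr {M N : R4 → Mat} (hU : IsOpen U) (hu : u ∈ U) (h : ∀ v ∈ U, M v = N v)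
    (i : Fin 4) : pdM i M u = pdM i N u := by
  ext a b
  exact pd_congr hU hu (fun v hv => by rw [h v hv]) i

lemma pdV_add {X Y : R4 → Vec} (hU : IsOpen U) (hu : u ∈ U) (hX : SmV U X) (hY : SmV U Y)
    (i : Fin 4) : pdV i (fun v => X v + Y v) u = pdV i X u + pdV i Y u := by
  ext a
  exact pd_add ((hX a).differentiableAt hU hu) ((hY a).differentiableAt hU hu) i

lemma pdV_comm {X : R4 → Vec} (hU : IsOpen U) (hu : u ∈ U) (hX : SmV U X) (i j : Fin 4) :
    pdV i (pdV j X) u = pdV j (pdV i X) u := by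
  ext a
  exact pd_comm (hX a) hU hu i j

lemma pdV_congr {X Y : R4 → Vec} (hU : IsOpen U) (hu : u ∈ U) (h : ∀ v ∈ U, X v = Y v)
    (i : Fin 4) : pdV i X u = pdV i Y u := by
  ext a
  exact pd_congr hU hu (fun v hv => by rw [h v hv]) i

lemma pdV_mulVec {M : R4 → Mat} {X : R4 → Vec} (hU : IsOpen U) (hu : u ∈ U) (hM : SmM U M)
    (hX : SmV U X) (i : Fin 4) :
    pdV i (fun v => M v *ᵥ X v) u = pdM i M u *ᵥ X u + M u *ᵥ pdV i X u := by
  ext a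
  have h1 := fun a b => (hM a b).differentiableAt hU hu
  have h2 := fun a => (hX a).differentiableAt hU hu
  simp only [pdV, pdM, Matrix.mulVec, dotProduct, Matrix.of_apply, Pi.add_apply]
  rw [pd_sum fun e _ => (h1 a e).fun_mul (h2 e), ← Finset.sum_add_distrib]
  exact Finset.sum_congr rfl fun e _ => pd_mul (h1 a e) (h2 e) i

lemma pd_dot {X Y : R4 → Vec} (hU : IsOpen U) (hu : u ∈ U) (hX : SmV U X) (hY : SmV U Y)
    (i : Fin 4) : pd i (fun v => X v ⬝ᵥ Y v) u = pdV i X u ⬝ᵥ Y u + X u ⬝ᵥ pdV i Y u := by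
  have h1 := fun a => (hX a).differentiableAt hU hu
  have h2 := fun a => (hY a).differentiableAt hU hu
  simp only [pdV, dotProduct]
  rw [pd_sum fun e _ => (h1 e).fun_mul (h2 e), ← Finset.sum_add_distrib]
  exact Finset.sum_congr rfl fun e _ => pd_mul (h1 e) (h2 e) i

end Calculus

/-! ### The Levi-Civita connection and its curvature -/

/-- `G` is the matrix of the components of a smooth pseudo-Riemannian metric on the open set
`U`. -/
structure IsMetricOn (U : Set R4) (G : R4 → Mat) : Prop where
  isOpen : IsOpen U
  smooth : SmM U G
  symm : ∀ v ∈ U, (G v)ᵀ = G v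
  isUnit_det : ∀ v ∈ U, IsUnit (G v).det

/-- The matrix `(Γ_c)ᵃ_b = Γᵃ_{cb}`. -/
def Gam (G : R4 → Mat) (c : Fin 4) (u : R4) : Mat := Matrix.of fun a b => christoffel G a c b u

/-- The matrix `(R_{cd})ᵃ_b = Rᵃ_{bcd}`. -/
def curv (G : R4 → Mat) (c d : Fin 4) (u : R4) : Mat := Matrix.of fun a b => riemannUp G a b c d u

/-- The matrix `∇_b Xᵃ`. -/
def nab (G : R4 → Mat) (X : R4 → Vec) (u : R4) : Mat :=
  Matrix.of fun a b => pd b (fun v => X v a) u + (Gam G b u *ᵥ X u) a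

/-- The matrix `G u * curv G c d u` carries the first two indices of the Riemann tensor. -/
lemma riem_eq (G : R4 → Mat) (u : R4) (a b c d : Fin 4) :
    riem G u a b c d = (G u * curv G c d u) a b := rfl

/-- The curvature in matrix form, `∂_c Γ_d - ∂_d Γ_c + [Γ_c, Γ_d]`. -/
lemma curv_eq (G : R4 → Mat) (c d : Fin 4) (u : R4) :
    curv G c d u = pdM c (Gam G d) u - pdM d (Gam G c) u
      + Gam G c u * Gam G d u - Gam G d u * Gam G c u := by
  ext a b
  simp only [curv, riemannUp, pdM, Gam, Matrix.of_apply, Matrix.add_apply, Matrix.sub_apply,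
    Matrix.mul_apply, Finset.sum_sub_distrib]
  ring

lemma curv_swap (G : R4 → Mat) (c d : Fin 4) (u : R4) : curv G c d u = - curv G d c u := by
  rw [curv_eq, curv_eq]; abel

lemma nab_col (G : R4 → Mat) (X : R4 → Vec) (u : R4) (b : Fin 4) :
    (nab G X u).col b = pdV b X u + Gam G b u *ᵥ X u := rfl

namespace IsMetricOn

variable {U : Set R4} {G : R4 → Mat} (hG : IsMetricOn U G) {u : R4} (hu : u ∈ U)

include hG

lemma apply_symm (hu : u ∈ U) (i j : Fin 4) : G u i j = G u j i := by
  conv_lhs => rw [← hG.symm u hu]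
  rfl

lemma smooth_inv : SmM U fun v => (G v)⁻¹ := SmM.inv hG.smooth hG.isUnit_det

lemma smooth_christoffel (k i j : Fin 4) : Sm U (christoffel G k i j) := by
  unfold christoffel
  exact contDiffOn_const.mul (Sm.sum fun l _ => (hG.smooth_inv k l).mul
    ((((hG.smooth j l).pd hG.isOpen i).add ((hG.smooth i l).pd hG.isOpen j)).sub
      ((hG.smooth i j).pd hG.isOpen l)))

lemma smooth_Gam (c : Fin 4) : SmM U (Gam G c) := fun a b => hG.smooth_christoffel a c b

lemma smooth_curv (c d : Fin 4) : SmM U (curv G c d) := by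
  have : curv G c d = fun u => pdM c (Gam G d) u - pdM d (Gam G c) u
      + Gam G c u * Gam G d u - Gam G d u * Gam G c u := funext fun u => curv_eq G c d u
  rw [this]
  exact ((((hG.smooth_Gam d).pdM hG.isOpen c).sub ((hG.smooth_Gam c).pdM hG.isOpen d)).add
    ((hG.smooth_Gam c).mul (hG.smooth_Gam d))).sub ((hG.smooth_Gam d).mul (hG.smooth_Gam c))

lemma smooth_nab {X : R4 → Vec} (hX : SmV U X) : SmM U (nab G X) := fun a b =>
  ((hX a).pd hG.isOpen b).add ((hG.smooth_Gam b).mulVec hX a)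

lemma christoffel_symm (hu : u ∈ U) (k i j : Fin 4) :
    christoffel G k i j u = christoffel G k j i u := by
  unfold christoffel
  congr 1
  refine Finset.sum_congr rfl fun l _ => ?_
  rw [pd_congr hG.isOpen hu (fun v hv => hG.apply_symm hv i j) l]
  ring

lemma Gam_symm (hu : u ∈ U) (a b c : Fin 4) : Gam G c u a b = Gam G b u a c :=
  hG.christoffel_symm hu a c b

/-- The Christoffel symbols of the first kind. -/
lemma lower_christoffel (hu : u ∈ U) (a c b : Fin 4) :
    ∑ e, G u a e * christoffel G e c b u = (1 / 2) * (pd c (fun v => G v b a) u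
      + pd b (fun v => G v c a) u - pd a (fun v => G v c b) u) := by
  set t : Vec := fun l => pd c (fun v => G v b l) u
      + pd b (fun v => G v c l) u - pd l (fun v => G v c b) u with ht
  have h1 : ∀ e, christoffel G e c b u = ((1 / 2 : ℝ) • ((G u)⁻¹ *ᵥ t)) e := fun e => rfl
  have h2 : ∑ e, G u a e * christoffel G e c b u = (G u *ᵥ ((1 / 2 : ℝ) • ((G u)⁻¹ *ᵥ t))) a := by
    simp only [h1]; rfl
  rw [h2, mulVec_smul, mulVec_mulVec, Matrix.mul_nonsing_inv _ (hG.isUnit_det u hu), one_mulVec]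
  rfl

/-- The metric is parallel. -/
lemma pdM_eq (hu : u ∈ U) (c : Fin 4) :
    pdM c G u = G u * Gam G c u + (Gam G c u)ᵀ * G u := by
  ext a b
  have h1 : (G u * Gam G c u) a b = ∑ e, G u a e * christoffel G e c b u := rfl
  have h2 : ((Gam G c u)ᵀ * G u) a b = ∑ e, G u b e * christoffel G e c a u := by
    rw [Matrix.mul_apply]
    refine Finset.sum_congr rfl fun e _ => ?_
    rw [hG.apply_symm hu b e, mul_comm]; rfl
  rw [Matrix.add_apply, h1, h2, hG.lower_christoffel hu, hG.lower_christoffel hu,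
    pd_congr hG.isOpen hu (fun v hv => hG.apply_symm hv b a) c]
  simp only [pdM, of_apply]
  ring

/-- The curvature is skew-symmetric for the metric. -/
lemma curv_skew (hu : u ∈ U) (c d : Fin 4) :
    G u * curv G c d u + (curv G c d u)ᵀ * G u = 0 := by
  -- differentiate `∂_d g = g Γ_d + Γ_dᵀ g` once more; the second derivatives commute
  have key : ∀ c d, pdM c (pdM d G) u =
      (G u * Gam G c u + (Gam G c u)ᵀ * G u) * Gam G d u + G u * pdM c (Gam G d) u
      + ((pdM c (Gam G d) u)ᵀ * G u + (Gam G d u)ᵀ * (G u * Gam G c u + (Gam G c u)ᵀ * G u)) := by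
    intro c d
    rw [pdM_congr hG.isOpen hu (fun v hv => hG.pdM_eq hv d) c,
      pdM_add hG.isOpen hu (hG.smooth.mul (hG.smooth_Gam d))
        ((hG.smooth_Gam d).transpose.mul hG.smooth),
      pdM_mul hG.isOpen hu hG.smooth (hG.smooth_Gam d),
      pdM_mul hG.isOpen hu (hG.smooth_Gam d).transpose hG.smooth, hG.pdM_eq hu]
    rfl
  have h := pdM_comm hG.isOpen hu hG.smooth c d
  rw [key, key, ← sub_eq_zero] at h
  rw [← h, curv_eq]
  simp only [transpose_add, transpose_sub, transpose_mul]
  noncomm_ring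

/-- The first Bianchi identity. -/
lemma curv_bianchi (hu : u ∈ U) (a b c d : Fin 4) :
    curv G c d u a b + curv G d b u a c + curv G b c u a d = 0 := by
  have hs : ∀ i a b c, pd i (christoffel G a b c) u = pd i (christoffel G a c b) u :=
    fun i a b c => pd_congr hG.isOpen hu (fun v hv => hG.christoffel_symm hv a b c) i
  simp only [curv, riemannUp, of_apply, Finset.sum_sub_distrib]
  rw [hs c a d b, hs d a c b, hs b a c d]
  simp only [hG.christoffel_symm hu _ d b, hG.christoffel_symm hu _ c b,
    hG.christoffel_symm hu _ d c]
  ring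

lemma riem_swap₁₂ (hu : u ∈ U) (a b c d : Fin 4) : riem G u a b c d = - riem G u b a c d := by
  have h := congrFun (congrFun (hG.curv_skew hu c d) a) b
  have h2 : ((curv G c d u)ᵀ * G u) a b = (G u * curv G c d u) b a := by
    conv_lhs => rw [← hG.symm u hu]
    rw [← transpose_mul]; rfl
  rw [Matrix.add_apply, h2, ← riem_eq, ← riem_eq] at h
  exact eq_neg_of_add_eq_zero_left h

omit hG in
lemma _root_.Coord.riem_swap₃₄ (G : R4 → Mat) (u : R4) (a b c d : Fin 4) :
    riem G u a b c d = - riem G u a b d c := by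
  rw [riem_eq, riem_eq, curv_swap]; simp

lemma riem_bianchi (hu : u ∈ U) (a b c d : Fin 4) :
    riem G u a b c d + riem G u a c d b + riem G u a d b c = 0 := by
  simp only [riem_eq, Matrix.mul_apply]
  rw [← Finset.sum_add_distrib, ← Finset.sum_add_distrib]
  refine Finset.sum_eq_zero fun e _ => ?_
  rw [← mul_add, ← mul_add, hG.curv_bianchi hu, mul_zero]

/-- The pair symmetry follows from the skew symmetries and four instances of the Bianchi identity.
-/
lemma riem_pair (hu : u ∈ U) (a b c d : Fin 4) : riem G u a b c d = riem G u c d a b := by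
  have s1 := hG.riem_swap₁₂ hu
  have s3 := riem_swap₃₄ G u
  linarith [hG.riem_bianchi hu a b c d, hG.riem_bianchi hu b c d a, hG.riem_bianchi hu c d a b,
    hG.riem_bianchi hu d a b c, s1 a b c d, s1 a c d b, s1 a d b c, s1 b c d a, s1 b d a c,
    s1 c d a b, s3 a b c d, s3 a c d b, s3 a d b c, s3 b c d a, s3 b d a c, s3 c d a b,
    s3 b a c d, s3 c a d b, s3 d a b c, s3 c b d a, s3 d b a c, s3 d c a b, s1 b a c d,
    s1 b a d c, s1 c a d b, s1 c a b d, s1 d a b c, s1 d a c b, s1 c b d a, s1 d b a c, s1 d c a b]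

end IsMetricOn

/-! ### Killing vector fields -/

/-- `X` is a smooth Killing vector field of the metric `G` on `U`: `∇_b X_a` is skew-symmetric. -/
structure IsKillingOn (U : Set R4) (G : R4 → Mat) (X : R4 → Vec) : Prop where
  smooth : SmV U X
  skew : ∀ v ∈ U, G v * nab G X v + (nab G X v)ᵀ * G v = 0

/-- The covariant derivative of a matrix, as a field of endomorphisms. -/
def covM (G : R4 → Mat) (c : Fin 4) (M : R4 → Mat) (u : R4) : Mat :=
  pdM c M u + Gam G c u * M u - M u * Gam G c u

lemma col_mul (M N : Mat) (b : Fin 4) : (M * N).col b = M *ᵥ N.col b := by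
  ext; simp [Matrix.mul_apply, mulVec, dotProduct]

lemma col_add (M N : Mat) (b : Fin 4) : (M + N).col b = M.col b + N.col b := rfl

lemma col_sub (M N : Mat) (b : Fin 4) : (M - N).col b = M.col b - N.col b := rfl

/-- The matrix `∂_b Xᵃ`. -/
def jac (X : R4 → Vec) (u : R4) : Mat := Matrix.of fun a b => pd b (fun v => X v a) u

section

variable {U : Set R4} {G : R4 → Mat} {X : R4 → Vec} (hG : IsMetricOn U G) {u : R4}

include hG

/-- Lowering an index commutes with covariant differentiation: `∇_b X_a` is the matrix `G * nab G
X`. -/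
lemma covDeriv_lower (hX : SmV U X) (hu : u ∈ U) (a b : Fin 4) :
    covDeriv G (lower G fun i v => X v i) b a u = (G u * nab G X u) a b := by
  have h1 : ∀ a, lower G (fun i v => X v i) a = fun v => (G v *ᵥ X v) a := fun _ => rfl
  have h2 : pd b (lower G (fun i v => X v i) a) u =
      (pdM b G u *ᵥ X u + G u *ᵥ pdV b X u) a := by
    rw [h1, ← pdV_mulVec hG.isOpen hu hG.smooth hX]; rfl
  have h3 : ∑ c, christoffel G c b a u * lower G (fun i v => X v i) c u =
      ((Gam G b u)ᵀ *ᵥ (G u *ᵥ X u)) a := rfl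
  have h4 : (G u * nab G X u) a b = (G u *ᵥ (pdV b X u + Gam G b u *ᵥ X u)) a := by
    rw [← nab_col, ← col_mul]; rfl
  rw [covDeriv, h2, h3, h4, hG.pdM_eq hu]
  simp only [add_mulVec, mulVec_add, mulVec_mulVec, Pi.add_apply]
  ring

/-- The Ricci identity for a vector field. -/
lemma ricci_identity (hX : SmV U X) (hu : u ∈ U) (b c : Fin 4) :
    (covM G c (nab G X) u).col b - (covM G b (nab G X) u).col c = curv G c b u *ᵥ X u := by
  have h1 : ∀ c b, (pdM c (nab G X) u).col b =
      pdV c (pdV b X) u + (pdM c (Gam G b) u *ᵥ X u + Gam G b u *ᵥ pdV c X u) := by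
    intro c b
    rw [← pdV_mulVec hG.isOpen hu (hG.smooth_Gam b) hX,
      ← pdV_add hG.isOpen hu (hX.pdV hG.isOpen b) ((hG.smooth_Gam b).mulVec hX)]
    rfl
  have h2 : (Gam G c u).col b = (Gam G b u).col c := by
    ext a; exact hG.Gam_symm hu a b c
  simp only [covM, col_add, col_sub, h1, col_mul, h2, nab_col, curv_eq,
    pdV_comm hG.isOpen hu hX b c]
  simp only [add_mulVec, sub_mulVec, mulVec_add, mulVec_mulVec]
  abel

/-- The derivative of a field of skew endomorphisms `∇X` is skew, since the metric is parallel. -/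
lemma covM_skew (hX : IsKillingOn U G X) (hu : u ∈ U) (c : Fin 4) :
    G u * covM G c (nab G X) u + (covM G c (nab G X) u)ᵀ * G u = 0 := by
  have sA := hG.smooth_nab hX.smooth
  have h := pdM_congr hG.isOpen hu (M := fun v => G v * nab G X v + (nab G X v)ᵀ * G v)
    (N := fun _ => 0) hX.skew c
  rw [pdM_add hG.isOpen hu (hG.smooth.mul sA) (sA.transpose.mul hG.smooth),
    pdM_mul hG.isOpen hu hG.smooth sA, pdM_mul hG.isOpen hu sA.transpose hG.smooth,
    pdM_transpose, hG.pdM_eq hu] at h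
  have h0 : pdM c (fun _ => (0 : Mat)) u = 0 := by ext a b; simp [pdM]
  rw [h0] at h
  have hs := hX.skew u hu
  set A := nab G X u
  set S := Gam G c u
  calc _ = ((G u * S + Sᵀ * G u) * A + G u * pdM c (nab G X) u +
        ((pdM c (nab G X) u)ᵀ * G u + Aᵀ * (G u * S + Sᵀ * G u)))
        - Sᵀ * (G u * A + Aᵀ * G u) - (G u * A + Aᵀ * G u) * S := by
        simp only [covM, transpose_add, transpose_sub, transpose_mul]
        noncomm_ring
    _ = 0 := by rw [h, hs]; simp

/-- The second derivative of a Killing vector field is given by the curvature: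
`∇_c ∇_b Xᵃ = Rᵃ_{bce} Xᵉ`. -/
lemma kostant (hX : IsKillingOn U G X) (hu : u ∈ U) (c : Fin 4) :
    covM G c (nab G X) u = ∑ e, X u e • curv G c e u := by
  set k : Fin 4 → Fin 4 → Fin 4 → ℝ := fun a b c => (G u * covM G c (nab G X) u) a b with hk
  -- `k a b c` is `∇_c ∇_b X_a`; it is skew-symmetric in `a`, `b`, and the Ricci identity gives its
  -- part that is skew-symmetric in `b`, `c`
  have k1 : ∀ a b c, k a b c = - k b a c := by
    intro a b c
    have h := congrFun (congrFun (covM_skew hG hX hu c) a) b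
    have h2 : ((covM G c (nab G X) u)ᵀ * G u) a b = (G u * covM G c (nab G X) u) b a := by
      conv_lhs => rw [← hG.symm u hu]
      rw [← transpose_mul]; rfl
    rw [Matrix.add_apply, h2] at h
    exact eq_neg_of_add_eq_zero_left h
  have k2 : ∀ a b c, k a b c - k a c b = ∑ e, riem G u a e c b * X u e := by
    intro a b c
    have h := congrFun (congrArg (fun v => G u *ᵥ v) (ricci_identity hG hX.smooth hu b c)) a
    simp only [mulVec_sub, mulVec_mulVec, ← col_mul] at h
    exact h
  -- cyclic combination, as in the derivation of the Christoffel symbols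
  have k3 : ∀ a b c, k a b c = ∑ e, riem G u a b c e * X u e := by
    intro a b c
    have e1 : 2 * k a b c = (k a b c - k a c b) + (k b c a - k b a c) - (k c a b - k c b a) := by
      rw [k1 a c b, k1 b a c, k1 c b a]; ring
    have e2 : ∑ e, riem G u a e c b * X u e + ∑ e, riem G u b e a c * X u e
        - ∑ e, riem G u c e b a * X u e = 2 * ∑ e, riem G u a b c e * X u e := by
      rw [← Finset.sum_add_distrib, ← Finset.sum_sub_distrib, Finset.mul_sum]
      refine Finset.sum_congr rfl fun e _ => ?_
      have s1 := hG.riem_swap₁₂ hu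
      have s3 := riem_swap₃₄ G u
      have := hG.riem_bianchi hu e a b c
      have r : riem G u a e c b + riem G u b e a c - riem G u c e b a = 2 * riem G u a b c e := by
        linarith [s1 a e c b, s3 e a c b, s1 b e a c, s3 e b a c, s1 c e b a, s3 e c b a,
          hG.riem_pair hu a b c e, s1 c e a b, s3 e b c a, s3 e c a b, s3 e a b c]
      linear_combination X u e * r
    rw [k2, k2, k2] at e1
    linarith
  have h3 : G u * covM G c (nab G X) u = G u * ∑ e, X u e • curv G c e u := by
    ext a b
    refine (k3 a b c).trans ?_
    rw [Finset.mul_sum, Matrix.sum_apply]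
    refine Finset.sum_congr rfl fun e _ => ?_
    rw [mul_smul_comm, Matrix.smul_apply, smul_eq_mul, mul_comm, riem_eq]
  have h4 := congrArg (fun M => (G u)⁻¹ * M) h3
  simpa only [← Matrix.mul_assoc, Matrix.nonsing_inv_mul _ (hG.isUnit_det u hu), Matrix.one_mul]
    using h4

/-- By the symmetry of the Christoffel symbols, `∇X = ∂X + Xᵉ Γ_e`. -/
lemma nab_eq (hu : u ∈ U) : nab G X u = jac X u + ∑ e, X u e • Gam G e u := by
  ext a b
  simp only [nab, jac, of_apply, Matrix.add_apply, Matrix.sum_apply, Matrix.smul_apply, mulVec,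
    dotProduct, smul_eq_mul]
  congr 1
  refine Finset.sum_congr rfl fun e _ => ?_
  rw [hG.Gam_symm hu a e b, mul_comm]

/-- A Killing vector field preserves the metric: `L_X g = 0`. -/
lemma lie_metric (hX : IsKillingOn U G X) (hu : u ∈ U) :
    ∑ e, X u e • pdM e G u = -((jac X u)ᵀ * G u) - G u * jac X u := by
  have h := hX.skew u hu
  rw [nab_eq hG hu] at h
  simp only [Fin.sum_univ_four, hG.pdM_eq hu, transpose_add, transpose_smul, mul_add, add_mul,
    mul_smul_comm, smul_mul_assoc] at h ⊢
  rw [← sub_eq_zero, ← h]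
  module

lemma smooth_jac (hX : SmV U X) : SmM U (jac X) := fun a b => (hX a).pd hG.isOpen b

omit hG in
lemma SmM.smul {f : R4 → ℝ} {M : R4 → Mat} (hf : Sm U f) (hM : SmM U M) :
    SmM U fun v => f v • M v := fun a b => hf.mul (hM a b)

omit hG in
lemma SmM.sum {ι : Type*} {s : Finset ι} {M : ι → R4 → Mat} (hM : ∀ i ∈ s, SmM U (M i)) :
    SmM U fun v => ∑ i ∈ s, M i v := by
  intro a b
  simp only [Matrix.sum_apply]
  exact Sm.sum fun i hi => hM i hi a b

omit hG in
lemma pdM_smul {f : R4 → ℝ} {M : R4 → Mat} (hU : IsOpen U) (hu : u ∈ U) (hf : Sm U f)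
    (hM : SmM U M) (i : Fin 4) :
    pdM i (fun v => f v • M v) u = pd i f u • M u + f u • pdM i M u := by
  ext a b
  exact pd_mul (hf.differentiableAt hU hu) ((hM a b).differentiableAt hU hu) i

omit hG in
lemma pdM_sum {ι : Type*} {s : Finset ι} {M : ι → R4 → Mat} (hU : IsOpen U) (hu : u ∈ U)
    (hM : ∀ i ∈ s, SmM U (M i)) (i : Fin 4) :
    pdM i (fun v => ∑ j ∈ s, M j v) u = ∑ j ∈ s, pdM i (M j) u := by
  ext a b
  simp only [pdM, Matrix.sum_apply, of_apply]
  exact pd_sum (fun j hj => (hM j hj a b).differentiableAt hU hu) i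

/-- A Killing vector field preserves the connection: `L_X Γ = 0`. -/
lemma lie_Gam (hX : IsKillingOn U G X) (hu : u ∈ U) (c : Fin 4) :
    ∑ e, X u e • pdM e (Gam G c) u = jac X u * Gam G c u - Gam G c u * jac X u
      - ∑ e, jac X u e c • Gam G e u - pdM c (jac X) u := by
  have h := kostant hG hX hu c
  -- substitute `∇X = ∂X + Xᵉ Γ_e` into Kostant's formula
  have h1 : pdM c (nab G X) u = pdM c (jac X) u + ∑ e, (jac X u e c • Gam G e u
      + X u e • pdM c (Gam G e) u) := by
    rw [pdM_congr hG.isOpen hu (fun v hv => nab_eq hG hv) c,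
      pdM_add hG.isOpen hu (smooth_jac hG hX.smooth)
        (SmM.sum fun e _ => SmM.smul (hX.smooth e) (hG.smooth_Gam e)),
      pdM_sum hG.isOpen hu (fun e _ => SmM.smul (hX.smooth e) (hG.smooth_Gam e))]
    congr 1
    refine Finset.sum_congr rfl fun e _ => ?_
    rw [pdM_smul hG.isOpen hu (hX.smooth e) (hG.smooth_Gam e)]
    rfl
  rw [covM, h1, nab_eq hG hu] at h
  simp only [Fin.sum_univ_four, curv_eq, mul_add, add_mul, mul_smul_comm, smul_mul_assoc,
    smul_add, smul_sub] at h ⊢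
  rw [← sub_eq_zero] at h ⊢
  rw [← h]
  module

/-- A Killing vector field preserves the curvature: `L_X R = 0`. -/
lemma lie_curv (hX : IsKillingOn U G X) (hu : u ∈ U) (c d : Fin 4) :
    ∑ e, X u e • pdM e (curv G c d) u = jac X u * curv G c d u - curv G c d u * jac X u
      - ∑ e, jac X u e c • curv G e d u - ∑ e, jac X u e d • curv G c e u := by
  have sD := smooth_jac hG hX.smooth
  have sΓ := hG.smooth_Gam
  have dΓ := fun c d => (sΓ d).pdM hG.isOpen c
  -- the derivative of `∂_c Γ_d` along `X`, from the derivative of `L_X Γ_d = 0`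
  have h1 : ∀ c d, ∑ e, X u e • pdM e (pdM c (Gam G d)) u =
      pdM c (jac X) u * Gam G d u + jac X u * pdM c (Gam G d) u
      - (pdM c (Gam G d) u * jac X u + Gam G d u * pdM c (jac X) u)
      - ∑ e, (pdM c (jac X) u e d • Gam G e u + jac X u e d • pdM c (Gam G e) u)
      - pdM c (pdM d (jac X)) u - ∑ e, jac X u e c • pdM e (Gam G d) u := by
    intro c d
    have h2 : ∑ e, X u e • pdM e (pdM c (Gam G d)) u =
        pdM c (fun v => ∑ e, X v e • pdM e (Gam G d) v) u
        - ∑ e, jac X u e c • pdM e (Gam G d) u := by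
      rw [pdM_sum hG.isOpen hu fun e _ => SmM.smul (hX.smooth e) (dΓ e d),
        ← Finset.sum_sub_distrib]
      refine Finset.sum_congr rfl fun e _ => ?_
      rw [pdM_smul hG.isOpen hu (hX.smooth e) (dΓ e d), pdM_comm hG.isOpen hu (sΓ d) e c]
      simp only [jac, of_apply, add_sub_cancel_left]
    rw [h2, pdM_congr hG.isOpen hu (fun v hv => lie_Gam hG hX hv d) c,
      pdM_sub hG.isOpen hu (((sD.mul (sΓ d)).sub ((sΓ d).mul sD)).sub
        (SmM.sum fun e _ => SmM.smul (sD e d) (sΓ e))) (sD.pdM hG.isOpen d),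
      pdM_sub hG.isOpen hu ((sD.mul (sΓ d)).sub ((sΓ d).mul sD))
        (SmM.sum fun e _ => SmM.smul (sD e d) (sΓ e)),
      pdM_sub hG.isOpen hu (sD.mul (sΓ d)) ((sΓ d).mul sD),
      pdM_mul hG.isOpen hu sD (sΓ d), pdM_mul hG.isOpen hu (sΓ d) sD,
      pdM_sum hG.isOpen hu fun e _ => SmM.smul (sD e d) (sΓ e)]
    congr 3
    refine Finset.sum_congr rfl fun e _ => ?_
    rw [pdM_smul hG.isOpen hu (sD e d) (sΓ e)]
    rfl
  have h3 : ∀ e, pdM e (curv G c d) u = pdM e (pdM c (Gam G d)) u - pdM e (pdM d (Gam G c)) u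
      + (pdM e (Gam G c) u * Gam G d u + Gam G c u * pdM e (Gam G d) u)
      - (pdM e (Gam G d) u * Gam G c u + Gam G d u * pdM e (Gam G c) u) := by
    intro e
    rw [pdM_congr hG.isOpen hu (fun v _ => curv_eq G c d v) e,
      pdM_sub hG.isOpen hu (((dΓ c d).sub (dΓ d c)).add ((sΓ c).mul (sΓ d))) ((sΓ d).mul (sΓ c)),
      pdM_add hG.isOpen hu ((dΓ c d).sub (dΓ d c)) ((sΓ c).mul (sΓ d)),
      pdM_sub hG.isOpen hu (dΓ c d) (dΓ d c), pdM_mul hG.isOpen hu (sΓ c) (sΓ d),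
      pdM_mul hG.isOpen hu (sΓ d) (sΓ c)]
  -- the Leibniz rule for `R_{cd} = ∂_c Γ_d - ∂_d Γ_c + [Γ_c, Γ_d]` along `X`
  have h4 : ∑ e, X u e • pdM e (curv G c d) u =
      ∑ e, X u e • pdM e (pdM c (Gam G d)) u - ∑ e, X u e • pdM e (pdM d (Gam G c)) u
      + ((∑ e, X u e • pdM e (Gam G c) u) * Gam G d u
        + Gam G c u * ∑ e, X u e • pdM e (Gam G d) u)
      - ((∑ e, X u e • pdM e (Gam G d) u) * Gam G c u
        + Gam G d u * ∑ e, X u e • pdM e (Gam G c) u) := by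
    simp only [h3, Fin.sum_univ_four, mul_add, add_mul, mul_smul_comm, smul_mul_assoc,
      smul_add, smul_sub]
    abel
  -- the second derivatives of `X` and of `∂X` cancel by symmetry
  have h5 : ∀ e, pdM c (jac X) u e d = pdM d (jac X) u e c := fun e =>
    pd_comm (hX.smooth e) hG.isOpen hu c d
  have h6 : pdM c (pdM d (jac X)) u = pdM d (pdM c (jac X)) u := pdM_comm hG.isOpen hu sD c d
  rw [h4, h1 c d, h1 d c, lie_Gam hG hX hu, lie_Gam hG hX hu, h6]
  simp only [h5, Fin.sum_univ_four, curv_eq, mul_add, add_mul, mul_sub, sub_mul, mul_smul_comm,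
    smul_mul_assoc, smul_add, smul_sub, ← mul_assoc]
  module

end

/-! ### Killing vector fields preserve the Bel current -/

section Subalgebra

variable {α : Type*} (A : Subalgebra ℝ (α → ℝ))

lemma fun_add_mem {f g : α → ℝ} (hf : f ∈ A) (hg : g ∈ A) : (fun t => f t + g t) ∈ A :=
  A.add_mem hf hg

lemma fun_sub_mem {f g : α → ℝ} (hf : f ∈ A) (hg : g ∈ A) : (fun t => f t - g t) ∈ A :=
  A.sub_mem hf hg

lemma fun_mul_mem {f g : α → ℝ} (hf : f ∈ A) (hg : g ∈ A) : (fun t => f t * g t) ∈ A :=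
  A.mul_mem hf hg

lemma fun_const_mem (c : ℝ) : (fun _ : α => c) ∈ A := A.algebraMap_mem c

lemma fun_sum_mem {ι : Type*} {s : Finset ι} {f : ι → α → ℝ} (hf : ∀ i ∈ s, f i ∈ A) :
    (fun t => ∑ i ∈ s, f i t) ∈ A := by
  have := A.sum_mem hf
  rwa [Finset.sum_fn] at this

lemma det_mem {M : α → Mat} (hM : ∀ i j, (fun t => M t i j) ∈ A) : (fun t => (M t).det) ∈ A := by
  simp only [Matrix.det_apply']
  refine fun_sum_mem A fun σ _ => fun_mul_mem A (fun_const_mem A _) ?_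
  have := A.prod_mem (t := Finset.univ) (f := fun i t => M t (σ i) i) fun i _ => hM _ _
  rwa [Finset.prod_fn] at this

variable {g h : α → Mat} {R : α → Tensor4} {x y z w : α → Vec}
  (hg : ∀ i j, (fun t => g t i j) ∈ A) (hh : ∀ i j, (fun t => h t i j) ∈ A)
  (hR : ∀ i j k l, (fun t => R t i j k l) ∈ A) (hx : ∀ i, (fun t => x t i) ∈ A)
  (hy : ∀ i, (fun t => y t i) ∈ A) (hz : ∀ i, (fun t => z t i) ∈ A)
  (hw : ∀ i, (fun t => w t i) ∈ A)

lemma mulMat_mem (hg : ∀ i j, (fun t => g t i j) ∈ A) (hh : ∀ i j, (fun t => h t i j) ∈ A)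
    (i j : Fin 4) : (fun t => (g t * h t) i j) ∈ A := by
  simp only [Matrix.mul_apply]
  exact fun_sum_mem A fun e _ => fun_mul_mem A (hg _ _) (hh _ _)

include hR hh hx hy hz hw

lemma quadr_mem : (fun t => quadr (h t) (R t) (x t) (y t) (z t) (w t)) ∈ A := by
  have hs : ∀ {x z : α → Vec}, (∀ i, (fun t => x t i) ∈ A) → (∀ i, (fun t => z t i) ∈ A) →
      ∀ r s, (fun t => slice (R t) (x t) (z t) r s) ∈ A := by
    intro x z hx hz r s
    simp only [slice_apply]
    exact fun_sum_mem A fun a _ => fun_sum_mem A fun c _ =>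
      fun_mul_mem A (fun_mul_mem A (hx _) (hz _)) (hR _ _ _ _)
  unfold quadr Matrix.trace
  simp only [diag_apply]
  refine fun_sum_mem A fun i _ => ?_
  exact mulMat_mem A (mulMat_mem A (mulMat_mem A (fun i j => hs hx hz j i) hh) (hs hy hw))
    (fun i j => hh j i) i i

omit hR hx hy hz hw in
lemma contr_mem {φ : α → Vec → Vec → ℝ} (hφ : ∀ r s, (fun t => φ t r s) ∈ A) :
    (fun t => contr (h t) (φ t)) ∈ A :=
  fun_sum_mem A fun _ _ => fun_sum_mem A fun _ _ => fun_mul_mem A (hh _ _) (hφ _ _)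

include hg

lemma belForm_mem : (fun t => belForm (g t) (h t) (R t) (x t) (y t) (z t) (w t)) ∈ A := by
  have hd : ∀ {x z : α → Vec}, (∀ i, (fun t => x t i) ∈ A) → (∀ i, (fun t => z t i) ∈ A) →
      (fun t => x t ⬝ᵥ g t *ᵥ z t) ∈ A := by
    intro x z hx hz
    simp only [dotProduct, mulVec]
    exact fun_sum_mem A fun a _ => fun_mul_mem A (hx a) <| fun_sum_mem A fun c _ =>
      fun_mul_mem A (hg _ _) (hz _)
  have hc : ∀ v : Vec, ∀ i, (fun _ : α => v i) ∈ A := fun v i => fun_const_mem A _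
  unfold belForm
  refine fun_add_mem A (fun_sub_mem A (fun_sub_mem A (fun_add_mem A ?_ ?_) ?_) ?_) ?_
  · exact quadr_mem A hh hR hx hy hz hw
  · exact quadr_mem A hh hR hx hy hw hz
  · exact fun_mul_mem A (fun_mul_mem A (fun_const_mem A _) (hd hx hy))
      (contr_mem A hh fun r s => quadr_mem A hh hR (hc r) (hc s) hz hw)
  · exact fun_mul_mem A (fun_mul_mem A (fun_const_mem A _) (hd hz hw))
      (contr_mem A hh fun r s => quadr_mem A hh hR hx hy (hc r) (hc s))
  · exact fun_mul_mem A (fun_mul_mem A (fun_mul_mem A (fun_const_mem A _) (hd hx hy)) (hd hz hw))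
      (contr_mem A hh fun r s => contr_mem A hh fun r' s' =>
        quadr_mem A hh hR (hc r) (hc s) (hc r') (hc s'))

omit hh hw in
/-- The components of the Bel current belong to every algebra of functions that contains the
components of the data and of the inverse metric. -/
lemma belVec_mem (hi : ∀ i j, (fun t => (g t)⁻¹ i j) ∈ A) (k : Fin 4) :
    (fun t => belVec (g t) (R t) (x t) (y t) (z t) k) ∈ A := by
  have hc : ∀ v : Vec, ∀ i, (fun _ : α => v i) ∈ A := fun v i => fun_const_mem A _
  unfold belVec mulVec dotProduct
  refine fun_sum_mem A fun m _ => fun_mul_mem A (hi _ _) ?_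
  have hw := hc (Pi.single m 1)
  have := fun_mul_mem A (fun_const_mem A (1 / 6)) <|
    fun_add_mem A (fun_add_mem A (fun_add_mem A (fun_add_mem A (fun_add_mem A
      (belForm_mem A hg hi hR hx hy hz hw) (belForm_mem A hg hi hR hx hz hy hw))
      (belForm_mem A hg hi hR hy hx hz hw)) (belForm_mem A hg hi hR hy hz hx hw))
      (belForm_mem A hg hi hR hz hx hy hw)) (belForm_mem A hg hi hR hz hy hx hw)
  exact this

end Subalgebra

/-- The algebra of the smooth functions on `U`. -/
def smAlg (U : Set R4) : Subalgebra ℝ (R4 → ℝ) where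
  carrier := {f | Sm U f}
  mul_mem' := fun hf hg => ContDiffOn.mul hf hg
  add_mem' := fun hf hg => ContDiffOn.add hf hg
  algebraMap_mem' := fun _ => contDiffOn_const

/-- The algebra of the functions of one variable whose derivative at `0` vanishes. -/
def statAlg : Subalgebra ℝ (ℝ → ℝ) where
  carrier := {f | HasDerivAt f 0 0}
  mul_mem' := fun {f g} hf hg => by
    have := HasDerivAt.mul (c := f) (d := g) hf hg
    simpa using this
  add_mem' := fun {f g} hf hg => by
    have := HasDerivAt.add (f := f) (g := g) hf hg
    simpa using this
  algebraMap_mem' := fun c => hasDerivAt_const 0 c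

/-- Stationarity at `0` passes to the inverse of an invertible matrix, by Cramer's rule. -/
lemma inv_mem_statAlg {M : ℝ → Mat} (hM : ∀ i j, (fun t => M t i j) ∈ statAlg)
    (h0 : (M 0).det ≠ 0) (i j : Fin 4) : (fun t => (M t)⁻¹ i j) ∈ statAlg := by
  have h1 : ∀ t, (M t)⁻¹ i j = (M t).det⁻¹ * ((M t).updateRow j (Pi.single i 1)).det := by
    intro v
    rw [Matrix.inv_def, Matrix.smul_apply, Matrix.adjugate_apply, Ring.inverse_eq_inv',
      smul_eq_mul]
  simp only [h1]
  refine fun_mul_mem _ ?_ (det_mem _ fun a b => ?_)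
  · have : HasDerivAt (fun t => (M t).det) 0 0 := det_mem statAlg hM
    have h := this.fun_inv h0
    rw [neg_zero, zero_div] at h
    exact h
  · by_cases ha : a = j
    · subst ha; simpa using fun_const_mem statAlg _
    · simpa [Matrix.updateRow_ne ha] using hM a b

section Curve

variable {U : Set R4} {u : R4}

/-- The point with coordinates `u + t x`. -/
def lineTo (u : R4) (x : Vec) (t : ℝ) : R4 := u + t • WithLp.toLp 2 x

@[simp] lemma lineTo_zero (u : R4) (x : Vec) : lineTo u x 0 = u := by simp [lineTo]

lemma hasDerivAt_lineTo (u : R4) (x : Vec) (t : ℝ) :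
    HasDerivAt (lineTo u x) (WithLp.toLp 2 x) t := by
  have := ((hasDerivAt_id t).smul_const (WithLp.toLp 2 x : R4)).const_add u
  rw [one_smul] at this
  exact this

/-- A directional derivative in terms of the partial derivatives. -/
lemma fderiv_toLp (f : R4 → ℝ) (x : Vec) :
    fderiv ℝ f u (WithLp.toLp 2 x) = ∑ e, x e * pd e f u := by
  have h : (WithLp.toLp 2 x : R4) = ∑ e, x e • EuclideanSpace.single e (1 : ℝ) := by
    ext i
    simp [Pi.single_apply]
  rw [h, map_sum]
  simp [pd]

lemma hasDerivAt_comp_lineTo {f : R4 → ℝ} {x : Vec} {t : ℝ}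
    (hf : DifferentiableAt ℝ f (lineTo u x t)) :
    HasDerivAt (fun t => f (lineTo u x t)) (∑ e, x e * pd e f (lineTo u x t)) t := by
  have := hf.hasFDerivAt.comp_hasDerivAt t (hasDerivAt_lineTo u x t)
  rwa [fderiv_toLp] at this

/-- Entrywise derivative at `0` of a curve of matrices. -/
def MatDeriv (M : ℝ → Mat) (M' : Mat) : Prop := ∀ a b, HasDerivAt (fun t => M t a b) (M' a b) 0

lemma MatDeriv.mul {M N : ℝ → Mat} {M' N' : Mat} (hM : MatDeriv M M') (hN : MatDeriv N N') :
    MatDeriv (fun t => M t * N t) (M' * N 0 + M 0 * N') := by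
  intro a b
  simp only [Matrix.mul_apply, Matrix.add_apply, ← Finset.sum_add_distrib]
  exact HasDerivAt.fun_sum fun e _ => (hM a e).mul (hN e b)

lemma MatDeriv.transpose {M : ℝ → Mat} {M' : Mat} (hM : MatDeriv M M') :
    MatDeriv (fun t => (M t)ᵀ) M'ᵀ := fun a b => hM b a

lemma matDeriv_lineTo {M : R4 → Mat} (hU : IsOpen U) (hu : u ∈ U) (hM : SmM U M) (x : Vec) :
    MatDeriv (fun t => M (lineTo u x t)) (∑ e, x e • pdM e M u) := by
  intro a b
  have h : DifferentiableAt ℝ (fun v => M v a b) (lineTo u x 0) := by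
    rw [lineTo_zero]; exact (hM a b).differentiableAt hU hu
  have := hasDerivAt_comp_lineTo h
  simpa [Matrix.sum_apply, pdM] using this

/-- The curve of frames `1 + t D`. -/
def frameCurve (D : Mat) (t : ℝ) : Mat := 1 + t • D

@[simp] lemma frameCurve_zero (D : Mat) : frameCurve D 0 = 1 := by simp [frameCurve]

lemma matDeriv_frameCurve (D : Mat) : MatDeriv (frameCurve D) D := by
  intro a b
  have := ((hasDerivAt_id (0 : ℝ)).mul_const (D a b)).const_add ((1 : Mat) a b)
  simpa [frameCurve] using this

/-- The components of the Riemann tensor in a frame, in matrix form. -/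
lemma pull_apply (E : Mat) (G : R4 → Mat) (u : R4) (a b c d : Fin 4) :
    pull E (riem G u) a b c d =
      (Eᵀ * (∑ k, ∑ l, (E k c * E l d) • (G u * curv G k l u)) * E) a b := by
  simp only [pull, ev, slice_apply, riem_eq, mulVec, dotProduct, Fin.sum_univ_four, mul_apply,
    transpose_apply, col_apply, Matrix.add_apply, Matrix.smul_apply, smul_eq_mul]
  ring

lemma smooth_belVec {G : R4 → Mat} {Y₁ Y₂ Y₃ : R4 → Vec} (hG : IsMetricOn U G)
    (h₁ : SmV U Y₁) (h₂ : SmV U Y₂) (h₃ : SmV U Y₃) :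
    SmV U fun v => belVec (G v) (riem G v) (Y₁ v) (Y₂ v) (Y₃ v) := fun k =>
  belVec_mem (smAlg U) hG.smooth (fun i j k l => (hG.smooth.mul (hG.smooth_curv k l)) i j)
    h₁ h₂ h₃ hG.smooth_inv k

/-- A Killing vector field `X` preserves the Bel current of vector fields that commute with it.
In the frame `1 + t dX` along the line through `u` in the direction of `X`, the components of the
metric, of the curvature and of the three fields are stationary at `t = 0`; hence so are those of
their Bel current. -/
lemma lie_belVec {G : R4 → Mat} {X Y₁ Y₂ Y₃ : R4 → Vec} (hG : IsMetricOn U G) (hu : u ∈ U)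
    (hX : IsKillingOn U G X) (h₁ : SmV U Y₁) (h₂ : SmV U Y₂) (h₃ : SmV U Y₃)
    (c₁ : ∑ e, X u e • pdV e Y₁ u = jac X u *ᵥ Y₁ u)
    (c₂ : ∑ e, X u e • pdV e Y₂ u = jac X u *ᵥ Y₂ u)
    (c₃ : ∑ e, X u e • pdV e Y₃ u = jac X u *ᵥ Y₃ u) :
    ∑ e, X u e • pdV e (fun v => belVec (G v) (riem G v) (Y₁ v) (Y₂ v) (Y₃ v)) u =
      jac X u *ᵥ belVec (G u) (riem G u) (Y₁ u) (Y₂ u) (Y₃ u) := by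
  have hU := hG.isOpen
  set D := jac X u with hD
  set γ := lineTo u (X u) with hγ
  have γ0 : γ 0 = u := lineTo_zero _ _
  set E := frameCurve D with hE
  have E0 : E 0 = 1 := frameCurve_zero _
  have dE : MatDeriv E D := matDeriv_frameCurve D
  have hdet0 : (E 0).det ≠ 0 := by rw [E0, det_one]; exact one_ne_zero
  -- the components of the metric in the moving frame
  have mG : ∀ i j, (fun t => ((E t)ᵀ * G (γ t) * E t) i j) ∈ statAlg := by
    have h := (dE.transpose.mul (matDeriv_lineTo hU hu hG.smooth (X u))).mul dE
    -- the derivative is the Lie derivative of the metric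
    have h0 : (Dᵀ * G (γ 0) + (E 0)ᵀ * ∑ e, X u e • pdM e G u) * E 0 + (E 0)ᵀ * G (γ 0) * D
        = 0 := by
      rw [lie_metric hG hX hu, E0, γ0]
      simp only [transpose_one, Matrix.one_mul, Matrix.mul_one]
      abel
    intro i j
    have := h i j
    rw [h0] at this
    exact this
  have iG := inv_mem_statAlg mG (by
    rw [E0, γ0]; simpa using (hG.isUnit_det u hu).ne_zero)
  -- the components of the curvature in the moving frame
  have mR : ∀ i j k l, (fun t => pull (E t) (riem G (γ t)) i j k l) ∈ statAlg := by
    intro a b c d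
    have dR := fun k l => matDeriv_lineTo hU hu (hG.smooth.mul (hG.smooth_curv k l)) (X u)
    have dM : MatDeriv (fun t => ∑ k, ∑ l, (E t k c * E t l d) • (G (γ t) * curv G k l (γ t)))
        (∑ k, ∑ l, ((D k c * E 0 l d + E 0 k c * D l d) • (G (γ 0) * curv G k l (γ 0))
          + (E 0 k c * E 0 l d) • ∑ e, X u e • pdM e (fun v => G v * curv G k l v) u)) := by
      intro a b
      simp only [Matrix.sum_apply]
      exact HasDerivAt.fun_sum fun k _ => HasDerivAt.fun_sum fun l _ =>
        ((dE k c).mul (dE l d)).mul (dR k l a b)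
    have h := (dE.transpose.mul dM).mul dE
    have e1 : ∀ k l, ∑ e, X u e • pdM e (fun v => G v * curv G k l v) u =
        (∑ e, X u e • pdM e G u) * curv G k l u + G u * ∑ e, X u e • pdM e (curv G k l) u := by
      intro k l
      rw [Finset.sum_mul, Finset.mul_sum, ← Finset.sum_add_distrib]
      refine Finset.sum_congr rfl fun e _ => ?_
      rw [pdM_mul hU hu hG.smooth (hG.smooth_curv k l), smul_add, smul_mul_assoc, mul_smul_comm]
    have e2 : ∑ k, ∑ l, ((D k c * E 0 l d + E 0 k c * D l d) • (G (γ 0) * curv G k l (γ 0))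
          + (E 0 k c * E 0 l d) • ∑ e, X u e • pdM e (fun v => G v * curv G k l v) u)
        = -(Dᵀ * (G u * curv G c d u)) - (G u * curv G c d u) * D := by
      have e3 : ∀ (f g : Fin 4 → Fin 4 → Mat) (h : Fin 4 → Fin 4 → Mat),
          ∑ k, ∑ l, ((D k c * (1 : Mat) l d + (1 : Mat) k c * D l d) • f k l
            + ((1 : Mat) k c * (1 : Mat) l d) • h k l) =
          ∑ k, D k c • f k d + ∑ l, D l d • f c l + h c d := by
        intro f g h
        simp only [Matrix.one_apply, add_smul, Finset.sum_add_distrib, mul_ite, ite_mul, mul_one,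
          mul_zero, one_mul, zero_mul, ite_smul, zero_smul, one_smul, Finset.sum_ite_eq',
          Finset.mem_univ, if_true, Finset.sum_ite_irrel, Finset.sum_const_zero]
      rw [E0, γ0, e3 _ (fun _ _ => 0), e1, lie_metric hG hX hu, lie_curv hG hX hu, ← hD]
      simp only [Fin.sum_univ_four, mul_sub, mul_add, sub_mul, mul_smul_comm, neg_mul,
        Matrix.mul_assoc]
      abel
    have e4 : ∑ k, ∑ l, (E 0 k c * E 0 l d) • (G (γ 0) * curv G k l (γ 0)) =
        G u * curv G c d u := by
      rw [E0, γ0]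
      simp [Matrix.one_apply, ite_smul]
    have := h a b
    rw [e2, e4, E0] at this
    have e5 : (Dᵀ * (G u * curv G c d u)
        + (1 : Mat)ᵀ * (-(Dᵀ * (G u * curv G c d u)) - G u * curv G c d u * D)) * 1
        + (1 : Mat)ᵀ * (G u * curv G c d u) * D = 0 := by
      simp only [transpose_one, Matrix.one_mul, Matrix.mul_one]
      abel
    rw [e5] at this
    simp only [pull_apply]
    exact this
  -- the components of a commuting field in the moving frame
  have evE : ∀ᶠ t in 𝓝 (0 : ℝ), IsUnit (E t).det := by
    have hc : ContinuousAt (fun t => (E t).det) 0 := by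
      have : Continuous fun t => (E t).det := by
        rw [hE]; unfold frameCurve; fun_prop
      exact this.continuousAt
    filter_upwards [hc.eventually_ne hdet0] with t ht
    exact isUnit_iff_ne_zero.2 ht
  have dV : ∀ {Y : R4 → Vec}, SmV U Y → ∀ k,
      HasDerivAt (fun t => Y (γ t) k) ((∑ e, X u e • pdV e Y u) k) 0 := by
    intro Y hY k
    have h : DifferentiableAt ℝ (fun v => Y v k) (γ 0) := by
      rw [γ0]; exact (hY k).differentiableAt hU hu
    have := hasDerivAt_comp_lineTo h
    rw [← hγ, γ0] at this
    simpa [pdV] using this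
  have dfE : ∀ i j, DifferentiableAt ℝ (fun t => (E t)⁻¹ i j) 0 := by
    intro i j
    have h1 : ∀ t, (E t)⁻¹ i j = (E t).det⁻¹ * (E t).adjugate i j := by
      intro v
      rw [Matrix.inv_def, Matrix.smul_apply, Ring.inverse_eq_inv', smul_eq_mul]
    have hent : ∀ i j, Differentiable ℝ fun t => E t i j := by
      intro i j
      simp only [hE, frameCurve, Matrix.add_apply, Matrix.smul_apply, smul_eq_mul]
      fun_prop
    have hdet : ∀ M : ℝ → Mat, (∀ i j, Differentiable ℝ fun t => M t i j) →
        Differentiable ℝ fun t => (M t).det := by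
      intro M hM
      simp only [Matrix.det_apply']
      exact Differentiable.fun_sum fun σ _ => (differentiable_const _).mul
        (Differentiable.fun_finsetProd fun i _ => hM _ _)
    simp only [h1, Matrix.adjugate_apply]
    refine ((hdet E hent 0).inv hdet0).mul (hdet _ (fun a b => ?_) 0)
    by_cases ha : a = j
    · subst ha; simp
    · simpa [Matrix.updateRow_ne ha] using hent a b
  -- with `Y' = E⁻¹ Y`, differentiating `E Y' = Y` at `0` gives `D Y + dY' = ∂_X Y = D Y`
  have mY : ∀ {Y : R4 → Vec}, SmV U Y → ∑ e, X u e • pdV e Y u = D *ᵥ Y u →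
      ∀ k, (fun t => ((E t)⁻¹ *ᵥ Y (γ t)) k) ∈ statAlg := by
    intro Y hY hc k
    have hd : ∀ k, DifferentiableAt ℝ (fun t => ((E t)⁻¹ *ᵥ Y (γ t)) k) 0 := by
      intro k
      simp only [mulVec, dotProduct]
      exact DifferentiableAt.fun_sum fun e _ => (dfE _ _).mul (dV hY e).differentiableAt
    have h1 := HasDerivAt.fun_sum (u := Finset.univ) fun e _ =>
      (dE k e).mul (hd e).hasDerivAt
    have h2 : (fun t => ∑ e, E t k e * ((E t)⁻¹ *ᵥ Y (γ t)) e) =ᶠ[𝓝 0] fun t => Y (γ t) k := by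
      filter_upwards [evE] with t ht
      have : (E t *ᵥ ((E t)⁻¹ *ᵥ Y (γ t))) k = Y (γ t) k := by
        rw [mulVec_mulVec, Matrix.mul_nonsing_inv _ ht, one_mulVec]
      exact this
    have h3 := (h1.congr_of_eventuallyEq h2.symm).unique (dV hY k)
    rw [hc] at h3
    have h4 : deriv (fun t => ((E t)⁻¹ *ᵥ Y (γ t)) k) 0 = 0 := by
      simp only [E0, γ0, inv_one, one_mulVec, Finset.sum_add_distrib, Matrix.one_apply, ite_mul,
        one_mul, zero_mul, Finset.sum_ite_eq, Finset.mem_univ, if_true] at h3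
      have h5 : (D *ᵥ Y u) k = ∑ e, D k e * Y u e := rfl
      linarith
    have := (hd k).hasDerivAt
    rw [h4] at this
    exact this
  -- the components `J'` of the Bel current in the moving frame are stationary; differentiating `E
  -- J' = J` at `0` gives the claim
  have mJ := belVec_mem statAlg mG mR (mY h₁ c₁) (mY h₂ c₂) (mY h₃ c₃) iG
  have hJ := smooth_belVec hG h₁ h₂ h₃
  have evU : ∀ᶠ t in 𝓝 (0 : ℝ), γ t ∈ U := by
    have hc : ContinuousAt γ 0 := (hasDerivAt_lineTo u (X u) 0).continuousAt
    exact hc (hU.mem_nhds (by rw [γ0]; exact hu))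
  ext k
  set J' : ℝ → Vec := fun t => belVec ((E t)ᵀ * G (γ t) * E t) (pull (E t) (riem G (γ t)))
    ((E t)⁻¹ *ᵥ Y₁ (γ t)) ((E t)⁻¹ *ᵥ Y₂ (γ t)) ((E t)⁻¹ *ᵥ Y₃ (γ t)) with hJ'
  have hEJ : ∀ t, IsUnit (E t).det → γ t ∈ U → E t *ᵥ J' t =
      belVec (G (γ t)) (riem G (γ t)) (Y₁ (γ t)) (Y₂ (γ t)) (Y₃ (γ t)) := by
    intro t ht hγt
    rw [hJ', belVec_pull ht (hG.isUnit_det _ hγt)]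
    simp only [mulVec_mulVec, Matrix.mul_nonsing_inv _ ht, one_mulVec]
  have hJ0 : J' 0 = belVec (G u) (riem G u) (Y₁ u) (Y₂ u) (Y₃ u) := by
    have := hEJ 0 (isUnit_iff_ne_zero.2 hdet0) (by rw [γ0]; exact hu)
    rwa [E0, γ0, one_mulVec] at this
  have dJ := HasDerivAt.fun_sum (u := Finset.univ) fun e _ =>
    (dE k e).mul (show HasDerivAt (fun t => J' t e) 0 0 from mJ e)
  have h2 : (fun t => ∑ e, E t k e * J' t e) =ᶠ[𝓝 0] fun t =>
      belVec (G (γ t)) (riem G (γ t)) (Y₁ (γ t)) (Y₂ (γ t)) (Y₃ (γ t)) k := by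
    filter_upwards [evE, evU] with t ht ht'
    rw [← hEJ t ht ht']
    rfl
  have h3 := (dJ.congr_of_eventuallyEq h2.symm).unique (dV hJ k)
  rw [← h3]
  simp only [mul_zero, add_zero, hJ0]
  rfl

end Curve

/-! ### Divergence of a current that is tangent to the orbits -/

section

variable {U : Set R4} {G : R4 → Mat} (hG : IsMetricOn U G) {u : R4}

include hG

/-- Killing vector fields are divergence-free. -/
lemma trace_nab_eq_zero {X : R4 → Vec} (hX : IsKillingOn U G X) (hu : u ∈ U) :
    (nab G X u).trace = 0 := by
  -- `∇X` is the product of a symmetric and a skew-symmetric matrix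
  set S := G u * nab G X u with hS
  have h1 : nab G X u = (G u)⁻¹ * S := by
    rw [hS, ← Matrix.mul_assoc, Matrix.nonsing_inv_mul _ (hG.isUnit_det u hu), Matrix.one_mul]
  have h2 : Sᵀ = -S := by
    rw [hS, transpose_mul, hG.symm u hu]
    exact eq_neg_of_add_eq_zero_right (hX.skew u hu)
  have h3 : ((G u)⁻¹)ᵀ = (G u)⁻¹ := by rw [transpose_nonsing_inv, hG.symm u hu]
  have h4 : ((G u)⁻¹ * S).trace = -((G u)⁻¹ * S).trace := by
    conv_lhs => rw [← trace_transpose, transpose_mul, h2, h3, Matrix.neg_mul, trace_neg,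
      trace_mul_comm]
  rw [h1]
  linarith

omit hG in
lemma jac_mulVec (X : R4 → Vec) (z : Vec) : jac X u *ᵥ z = ∑ e, z e • pdV e X u := by
  rw [mulVec_eq_sum_col]; rfl

omit hG in
/-- The matrix whose columns are independent vectors has a left inverse. -/
lemma exists_left_inverse {ι : Type*} [Fintype ι] [DecidableEq ι] {X : ι → Vec}
    (li : LinearIndependent ℝ X) :
    ∃ L : Matrix ι (Fin 4) ℝ, L * (Matrix.of fun k i => X i k : Matrix (Fin 4) ι ℝ) = 1 := by
  set B : Matrix (Fin 4) ι ℝ := Matrix.of fun k i => X i k with hB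
  have hinj : LinearMap.ker B.mulVecLin = ⊥ := by
    rw [LinearMap.ker_eq_bot']
    intro c hc
    refine funext (Fintype.linearIndependent_iff.1 li c ?_)
    rw [← hc]
    ext k
    simp [hB, mulVec, dotProduct, mul_comm]
  obtain ⟨l, hl⟩ := LinearMap.exists_leftInverse_of_injective _ hinj
  refine ⟨LinearMap.toMatrix' l, ?_⟩
  have h := congrArg LinearMap.toMatrix' hl
  rw [LinearMap.toMatrix'_comp, LinearMap.toMatrix'_id] at h
  rw [← h]
  congr 1
  exact (LinearMap.toMatrix'_toLin' B).symm

/-- A current with values in the span of commuting Killing vector fields, and invariant under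
them, is divergence-free wherever these fields are independent: its components along the Killing
fields are constant on the orbits. -/
lemma divergence_eq_zero_of_mem_span {ι : Type*} [Fintype ι] [DecidableEq ι] {X : ι → R4 → Vec}
    {J : R4 → Vec} (hu : u ∈ U) (hX : ∀ i, IsKillingOn U G (X i))
    (comm : ∀ i j, ∑ e, X i u e • pdV e (X j) u = jac (X i) u *ᵥ X j u) (hJ : SmV U J)
    (lie : ∀ i, ∑ e, X i u e • pdV e J u = jac (X i) u *ᵥ J u)
    (span : ∀ v ∈ U, ∃ c : ι → ℝ, J v = ∑ i, c i • X i v)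
    (li : LinearIndependent ℝ fun i => X i u) : divergence G (fun k v => J v k) u = 0 := by
  have hU := hG.isOpen
  -- a constant left inverse `L` of the frame at `u` yields smooth components near `u`
  set B : R4 → Matrix (Fin 4) ι ℝ := fun v => Matrix.of fun k i => X i v k with hB
  have hBmul : ∀ v c, B v *ᵥ c = ∑ i, c i • X i v := by
    intro v c; ext k
    simp [hB, mulVec, dotProduct, mul_comm]
  obtain ⟨L, hL⟩ : ∃ L : Matrix ι (Fin 4) ℝ, L * B u = 1 := exists_left_inverse li
  have hLB : ∀ i j, Sm U fun v => (L * B v) i j := by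
    intro i j
    simp only [Matrix.mul_apply]
    exact Sm.sum fun e _ => contDiffOn_const.mul ((hX j).smooth e)
  set V := U ∩ {v | (L * B v).det ≠ 0} with hV
  have hVo : IsOpen V :=
    (SmM.det hLB).continuousOn.isOpen_inter_preimage hU isOpen_ne
  have huV : u ∈ V := ⟨hu, by simp [hL]⟩
  set a : ι → R4 → ℝ := fun i v => ((L * B v)⁻¹ *ᵥ (L *ᵥ J v)) i with ha
  have hLB' : ∀ i j, Sm V fun v => (L * B v) i j := fun i j => (hLB i j).mono Set.inter_subset_left
  have ha' : ∀ i, Sm V (a i) := by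
    intro i
    simp only [ha, mulVec, dotProduct]
    exact Sm.sum fun e _ => (SmM.inv hLB' (fun v hv => isUnit_iff_ne_zero.2 hv.2) i e).mul
      (Sm.sum fun k _ => contDiffOn_const.mul ((hJ k).mono Set.inter_subset_left))
  have hJa : ∀ v ∈ V, J v = ∑ i, a i v • X i v := by
    intro v hv
    obtain ⟨c, hc⟩ := span v hv.1
    have h1 : (fun i => a i v) = c := by
      have : L *ᵥ J v = (L * B v) *ᵥ c := by rw [hc, ← hBmul, mulVec_mulVec]
      change (L * B v)⁻¹ *ᵥ (L *ᵥ J v) = c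
      rw [this, mulVec_mulVec, Matrix.nonsing_inv_mul _ (isUnit_iff_ne_zero.2 hv.2), one_mulVec]
    rw [hc, ← h1]
  have da : ∀ i, DifferentiableAt ℝ (a i) u := fun i => (ha' i).differentiableAt hVo huV
  have dX : ∀ i k, DifferentiableAt ℝ (fun v => X i v k) u := fun i k =>
    ((hX i).smooth k).differentiableAt hU hu
  have dJ : ∀ e, pdV e J u = ∑ i, (pd e (a i) u • X i u + a i u • pdV e (X i) u) := by
    intro e
    rw [pdV_congr hVo huV hJa e]
    ext k
    simp only [pdV, Finset.sum_apply, Pi.smul_apply, Pi.add_apply, smul_eq_mul]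
    rw [pd_sum fun i _ => (da i).fun_mul (dX i k)]
    exact Finset.sum_congr rfl fun i _ => pd_mul (da i) (dX i k) e
  -- the components are constant along the Killing fields
  have hder : ∀ i j, ∑ e, X i u e * pd e (a j) u = 0 := by
    intro i
    have h := lie i
    have h1 : ∑ e, X i u e • pdV e J u = ∑ j, (∑ e, X i u e * pd e (a j) u) • X j u
        + jac (X i) u *ᵥ J u := by
      rw [hJa u huV, mulVec_sum]
      simp only [mulVec_smul, ← comm i, dJ, Finset.smul_sum, smul_add, Finset.sum_add_distrib,
        Finset.sum_smul, smul_smul]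
      rw [Finset.sum_comm (f := fun e j => (X i u e * pd e (a j) u) • X j u),
        Finset.sum_comm (f := fun e j => (X i u e * a j u) • pdV e (X j) u)]
      simp only [mul_comm]
    rw [h] at h1
    exact Fintype.linearIndependent_iff.1 li _ (by simpa using h1.symm)
  -- by the Leibniz rule, `div (aⁱ X_i) = X_i aⁱ + aⁱ div X_i`
  have htr : ∀ i, ∑ k, (pd k (fun v => X i v k) u + ∑ l, christoffel G k k l u * X i u l) = 0 :=
    fun i => trace_nab_eq_zero hG (hX i) hu
  have h2 : ∀ k, pd k (fun v => J v k) u + ∑ l, christoffel G k k l u * J u l =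
      ∑ i, (X i u k * pd k (a i) u + a i u *
        (pd k (fun v => X i v k) u + ∑ l, christoffel G k k l u * X i u l)) := by
    intro k
    have h3 : pd k (fun v => J v k) u = pdV k J u k := rfl
    have h4 : ∀ l, J u l = ∑ i, a i u * X i u l := by
      intro l; rw [hJa u huV]; simp
    simp only [h3, dJ, h4, Finset.sum_apply, Pi.add_apply, Pi.smul_apply, smul_eq_mul,
      Finset.mul_sum, mul_add, Finset.sum_add_distrib]
    rw [Finset.sum_comm (s := (Finset.univ : Finset (Fin 4)))]
    simp only [pdV, mul_comm (pd k (a _) u), mul_left_comm (a _ u)]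
    ring
  unfold divergence
  simp only [h2]
  rw [Finset.sum_comm]
  simp only [Finset.sum_add_distrib, ← Finset.mul_sum]
  have h5 : ∀ i, ∑ k, pd k (fun v => X i v k) u + ∑ k, ∑ l, christoffel G k k l u * X i u l = 0 :=
    fun i => by rw [← Finset.sum_add_distrib]; exact htr i
  simp only [hder, h5, mul_zero, Finset.sum_const_zero, add_zero]

end

/-! ### Pointwise algebra of the curvature along the orbits -/

/-- The scalar product of two vectors. -/
def ip (g : Mat) (x y : Vec) : ℝ := x ⬝ᵥ g *ᵥ y

lemma ip_add_left (g : Mat) (x x' y : Vec) : ip g (x + x') y = ip g x y + ip g x' y := by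
  simp [ip]

lemma ip_add_right (g : Mat) (x y y' : Vec) : ip g x (y + y') = ip g x y + ip g x y' := by
  simp [ip, mulVec_add]

lemma ip_sub_left (g : Mat) (x x' y : Vec) : ip g (x - x') y = ip g x y - ip g x' y := by
  simp [ip]

lemma ip_sub_right (g : Mat) (x y y' : Vec) : ip g x (y - y') = ip g x y - ip g x y' := by
  simp [ip, mulVec_sub]

lemma ip_smul_left (g : Mat) (c : ℝ) (x y : Vec) : ip g (c • x) y = c * ip g x y := by
  simp [ip]

lemma ip_smul_right (g : Mat) (c : ℝ) (x y : Vec) : ip g x (c • y) = c * ip g x y := by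
  simp [ip, mulVec_smul]

lemma ip_zero_right (g : Mat) (x : Vec) : ip g x 0 = 0 := by simp [ip]

lemma ip_zero_left (g : Mat) (x : Vec) : ip g 0 x = 0 := by simp [ip]

lemma ip_sum_left {ι : Type*} (s : Finset ι) (g : Mat) (x : ι → Vec) (y : Vec) :
    ip g (∑ i ∈ s, x i) y = ∑ i ∈ s, ip g (x i) y := by
  simp [ip, sum_dotProduct]

lemma ip_sum_right {ι : Type*} (s : Finset ι) (g : Mat) (x : Vec) (y : ι → Vec) :
    ip g x (∑ i ∈ s, y i) = ∑ i ∈ s, ip g x (y i) := by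
  simp [ip, mulVec_sum, dotProduct_sum]

lemma ip_comm {g : Mat} (hg : gᵀ = g) (x y : Vec) : ip g x y = ip g y x := by
  rw [ip, dotProduct_mulVec, dotProduct_comm, ← mulVec_transpose, hg]; rfl

/-- Non-degeneracy of the scalar product. -/
lemma eq_zero_of_ip {g : Mat} (hg : IsUnit g.det) {x : Vec} (h : ∀ y, ip g y x = 0) : x = 0 := by
  have h1 : g *ᵥ x = 0 := dotProduct_eq_zero _ fun y => by rw [dotProduct_comm]; exact h y
  have := congrArg (fun v => g⁻¹ *ᵥ v) h1
  simpa only [mulVec_mulVec, Matrix.nonsing_inv_mul _ hg, one_mulVec, mulVec_zero] using this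

/-- The double orthogonal complement: a vector orthogonal to everything that is orthogonal to
the `X i` is a linear combination of the `X i`. -/
lemma exists_eq_sum_of_perp {ι : Type*} [Fintype ι] {g : Mat} (hg : gᵀ = g)
    (hd : IsUnit g.det) (X : ι → Vec) {w : Vec}
    (h : ∀ n, (∀ i, ip g (X i) n = 0) → ip g n w = 0) : ∃ c : ι → ℝ, w = ∑ i, c i • X i := by
  obtain ⟨c, hc⟩ := (Submodule.mem_span_range_iff_exists_fun ℝ).1
    (mem_span_of_iInf_ker_le_ker (L := fun i => Matrix.toLinearMap₂' ℝ g (X i))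
      (K := Matrix.toLinearMap₂' ℝ g w) fun n hn => by
        have h1 : ∀ i, ip g (X i) n = 0 := by
          intro i
          have := (Submodule.mem_iInf _).1 hn i
          rwa [LinearMap.mem_ker, Matrix.toLinearMap₂'_apply'] at this
        rw [LinearMap.mem_ker, Matrix.toLinearMap₂'_apply']
        exact (ip_comm hg w n).trans (h n h1))
  refine ⟨c, sub_eq_zero.1 (eq_zero_of_ip hd fun y => ?_)⟩
  have h2 := LinearMap.congr_fun hc y
  simp only [LinearMap.sum_apply, LinearMap.smul_apply, Matrix.toLinearMap₂'_apply',
    smul_eq_mul] at h2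
  rw [ip_comm hg, ip_sub_left, ip_sum_left]
  simp only [ip_smul_left]
  exact sub_eq_zero.2 h2.symm

/-- The data carried by one point of an orbit of an orthogonally transitive abelian group: the
metric `g`, the curvature `R`, the Killing vectors `X i` and their covariant derivatives `A i`.
The last two fields express the curvature of planes tangent, respectively orthogonal, to the
orbit through the matrices `A i`. -/
structure OrbitData {ι : Type*} [Fintype ι] (g : Mat) (R : Tensor4) (X : ι → Vec)
    (A : ι → Mat) : Prop where
  symm : gᵀ = g
  isUnit_det : IsUnit g.det
  swap₁₂ : ∀ x y z w, ev R x y z w = - ev R y x z w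
  swap₃₄ : ∀ x y z w, ev R x y z w = - ev R x y w z
  pair : ∀ x y z w, ev R x y z w = ev R z w x y
  skew : ∀ i x y, ip g x (A i *ᵥ y) = - ip g (A i *ᵥ x) y
  comm : ∀ i j, A i *ᵥ X j = A j *ᵥ X i
  ortho : ∀ i n m, (∀ j, ip g (X j) n = 0) → (∀ j, ip g (X j) m = 0) → ip g n (A i *ᵥ m) = 0
  curvT : ∀ i j v w, ev R w v (X i) (X j) =
    ip g w (A i *ᵥ (A j *ᵥ v)) - ip g w (A j *ᵥ (A i *ᵥ v))
  curvN : ∀ i n m (c d : ι → ℝ), (∀ j, ip g (X j) n = 0) → (∀ j, ip g (X j) m = 0) →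
    A i *ᵥ n = ∑ k, c k • X k → A i *ᵥ m = ∑ k, d k • X k →
    ∀ v, ev R v (X i) n m = ip g v (∑ k, c k • (A k *ᵥ m) - ∑ k, d k • (A k *ᵥ n))

/-- A linear form that vanishes on the `X i` vanishes on their span. -/
lemma IsLinearMap.vanish {ι : Type*} [Fintype ι] {f : Vec → ℝ} (hf : IsLinearMap ℝ f)
    {X : ι → Vec} (h : ∀ i, f (X i) = 0) (c : ι → ℝ) : f (∑ i, c i • X i) = 0 := by
  have := map_sum (hf.mk' f) (fun i => c i • X i) Finset.univ
  simp only [IsLinearMap.mk'_apply, hf.map_smul, smul_eq_mul, h, mul_zero,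
    Finset.sum_const_zero] at this
  exact this

lemma isLinearMap_ev₂ (R : Tensor4) (x z w : Vec) : IsLinearMap ℝ fun y => ev R x y z w :=
  ⟨fun _ _ => ev_add₂ .., fun _ _ => ev_smul₂ ..⟩

lemma isLinearMap_ev₃ (R : Tensor4) (x y w : Vec) : IsLinearMap ℝ fun z => ev R x y z w :=
  ⟨fun _ _ => ev_add₃ .., fun _ _ => ev_smul₃ ..⟩

lemma isLinearMap_ev₄ (R : Tensor4) (x y z : Vec) : IsLinearMap ℝ fun w => ev R x y z w :=
  ⟨fun _ _ => ev_add₄ .., fun _ _ => ev_smul₄ ..⟩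

lemma eq_of_ev {R S : Tensor4} (h : ∀ x y z w, ev R x y z w = ev S x y z w) : R = S := by
  funext a b c d
  rw [← ev_single R, ← ev_single S, h]

namespace OrbitData

section

variable {ι : Type*} [Fintype ι] {g : Mat} {R : Tensor4} {X : ι → Vec} {A : ι → Mat}
  (h : OrbitData g R X A)

include h

/-- The vectors `∇_{X j} X i` are normal to the orbit: the scalar products are symmetric in `i`,
`j` and skew-symmetric in `j`, `k`. -/
lemma ip_X_A_X (i j k : ι) : ip g (X k) (A i *ᵥ X j) = 0 := by
  have e : ∀ i j k, ip g (X k) (A i *ᵥ X j) = - ip g (X j) (A i *ᵥ X k) := fun i j k => by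
    rw [h.skew, ip_comm h.symm]
  have s : ∀ i j k, ip g (X k) (A i *ᵥ X j) = ip g (X k) (A j *ᵥ X i) := fun i j k => by
    rw [h.comm]
  linarith [e i j k, s i k j, e k i j, s k j i, e j k i, s j i k]

/-- `∇X` maps the normal space of the orbit to its tangent space. -/
lemma exists_A_eq (i : ι) {n : Vec} (hn : ∀ j, ip g (X j) n = 0) :
    ∃ c : ι → ℝ, A i *ᵥ n = ∑ k, c k • X k :=
  exists_eq_sum_of_perp h.symm h.isUnit_det X fun m hm => h.ortho i m n hm hn

/-- The curvature vanishes on one normal and three tangent vectors. -/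
lemma ev_normal_tangent (i j k : ι) {n : Vec} (hn : ∀ j, ip g (X j) n = 0) :
    ev R n (X k) (X i) (X j) = 0 := by
  have key : ∀ i j k, ip g n (A i *ᵥ (A j *ᵥ X k)) = 0 := by
    intro i j k
    obtain ⟨c, hc⟩ := h.exists_A_eq i hn
    rw [h.skew, hc, ip_sum_left]
    simp [ip_smul_left, h.ip_X_A_X]
  rw [h.curvT, key, key, sub_zero]

/-- The curvature vanishes on one tangent and three normal vectors. -/
lemma ev_tangent_normal (i : ι) {p n m : Vec} (hp : ∀ j, ip g (X j) p = 0)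
    (hn : ∀ j, ip g (X j) n = 0) (hm : ∀ j, ip g (X j) m = 0) : ev R p (X i) n m = 0 := by
  obtain ⟨c, hc⟩ := h.exists_A_eq i hn
  obtain ⟨d, hd⟩ := h.exists_A_eq i hm
  rw [h.curvN i n m c d hn hm hc hd, ip_sub_right, ip_sum_right, ip_sum_right]
  simp [ip_smul_right, h.ortho _ _ _ hp hm, h.ortho _ _ _ hp hn]

/-- If the tangent plane of the orbit is not degenerate, the reflection in its normal space
preserves the metric and the curvature and changes the sign of the `X i`; hence the Bel current
of the `X i` is orthogonal to the normal space. -/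
lemma belSymmForm_eq_zero [DecidableEq ι]
    (hW : IsUnit (Matrix.of fun i j => ip g (X i) (X j)).det) (i j k : ι) {n : Vec}
    (hn : ∀ j, ip g (X j) n = 0) : belSymmForm g g⁻¹ R (X i) (X j) (X k) n = 0 := by
  -- `c x` are the coefficients of the tangential part of `x`
  set W : Matrix ι ι ℝ := Matrix.of fun i j => ip g (X i) (X j) with hWdef
  set c : Vec → ι → ℝ := fun x => W⁻¹ *ᵥ fun j => ip g (X j) x with hc
  have hperp : ∀ x j, ip g (X j) (x - ∑ i, c x i • X i) = 0 := by
    intro x j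
    have h1 : ip g (X j) (∑ i, c x i • X i) = (W *ᵥ c x) j := by
      rw [ip_sum_right]
      simp [mulVec, dotProduct, hWdef, ip_smul_right, mul_comm]
    rw [ip_sub_right, h1, hc, mulVec_mulVec, Matrix.mul_nonsing_inv _ hW, one_mulVec, sub_self]
  -- the reflection `P x = x - 2 xᵗ`, where `xᵗ` is the tangential part of `x`
  set P : Mat := Matrix.of fun a b => ((Pi.single b 1 : Vec) - (2 : ℝ) •
    ∑ i, c (Pi.single b 1) i • X i) a with hP
  have hPx : ∀ x, P *ᵥ x = x - (2 : ℝ) • ∑ i, c x i • X i := by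
    intro x
    have hlin : ∀ i, IsLinearMap ℝ fun x => c x i := by
      intro i
      constructor
      · intro x y
        simp only [hc, ip_add_right, ← Pi.add_apply, ← mulVec_add]
        rfl
      · intro r x
        simp only [hc, ip_smul_right]
        rw [← Pi.smul_apply, ← mulVec_smul]
        rfl
    ext a
    have hx : x a = ∑ b, x b * (Pi.single b 1 : Vec) a := by simp [Pi.single_apply]
    simp only [Pi.sub_apply, Pi.smul_apply, Finset.sum_apply, smul_eq_mul]
    rw [hx]
    simp only [fun i => IsLinearMap.eq_sum (hlin i) x, mulVec, dotProduct, hP, of_apply,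
      Pi.sub_apply, Pi.smul_apply, Finset.sum_apply, smul_eq_mul, Finset.sum_mul, Finset.mul_sum,
      sub_mul, Finset.sum_sub_distrib]
    congr 1
    · exact Finset.sum_congr rfl fun _ _ => mul_comm _ _
    · rw [Finset.sum_comm]
      exact Finset.sum_congr rfl fun _ _ => Finset.sum_congr rfl fun _ _ => by ring
  have hdec : ∀ x, ∃ t n, x = t + n ∧ P *ᵥ x = (-1 : ℝ) • t + n ∧
      (∃ d : ι → ℝ, t = ∑ i, d i • X i) ∧ ∀ j, ip g (X j) n = 0 := by
    intro x
    refine ⟨∑ i, c x i • X i, x - ∑ i, c x i • X i, by abel, ?_, ⟨c x, rfl⟩, hperp x⟩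
    rw [hPx]; module
  have hPX : ∀ i, P *ᵥ X i = (-1 : ℝ) • X i := by
    intro i
    have h1 : c (X i) = Pi.single i 1 := by
      have : (fun j => ip g (X j) (X i)) = W *ᵥ Pi.single i 1 := by
        rw [mulVec_single_one]; rfl
      rw [hc]; simp only
      rw [this, mulVec_mulVec, Matrix.nonsing_inv_mul _ hW, one_mulVec]
    rw [hPx, h1]
    have : ∑ j, (Pi.single i 1 : ι → ℝ) j • X j = X i := by
      simp [Pi.single_apply, ite_smul]
    rw [this]; module
  have hPn : ∀ n, (∀ j, ip g (X j) n = 0) → P *ᵥ n = n := by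
    intro n hn
    have h1 : c n = 0 := by
      have : (fun j => ip g (X j) n) = 0 := funext hn
      rw [hc]; simp only
      rw [this, mulVec_zero]
    rw [hPx, h1]; simp
  have htn : ∀ (d : ι → ℝ) n, (∀ j, ip g (X j) n = 0) → ip g (∑ i, d i • X i) n = 0 := by
    intro d n hn
    rw [ip_sum_left]; simp [ip_smul_left, hn]
  have hPg : Pᵀ * g * P = g := by
    have hip : ∀ x y, ip g (P *ᵥ x) (P *ᵥ y) = ip g x y := by
      intro x y
      obtain ⟨t, n, hx, hPx', ⟨d, hd⟩, hn⟩ := hdec x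
      obtain ⟨t', n', hy, hPy', ⟨d', hd'⟩, hn'⟩ := hdec y
      have z1 : ip g t n' = 0 := by rw [hd]; exact htn d n' hn'
      have z2 : ip g n t' = 0 := by rw [ip_comm h.symm, hd']; exact htn d' n hn
      rw [hPx', hPy', hx, hy]
      simp only [ip_add_left, ip_add_right, ip_smul_left, ip_smul_right, z1, z2]
      ring
    ext a b
    rw [← dot_single (Pᵀ * g * P) a b, ← dot_single g a b, dot_pull]
    exact hip _ _
  have hPdet : IsUnit P.det := by
    have h1 := congrArg Matrix.det hPg
    rw [det_mul, det_mul, det_transpose] at h1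
    refine isUnit_iff_ne_zero.2 fun h0 => h.isUnit_det.ne_zero ?_
    rw [← h1, h0, mul_zero]
  -- the curvature vanishes on vectors of which an odd number is normal
  have hT : ∀ (n : Vec) (c₁ c₂ c₃ : ι → ℝ), (∀ j, ip g (X j) n = 0) →
      ev R n (∑ i, c₁ i • X i) (∑ i, c₂ i • X i) (∑ i, c₃ i • X i) = 0 := by
    intro n c₁ c₂ c₃ hn
    exact IsLinearMap.vanish (isLinearMap_ev₂ ..) (fun _ => IsLinearMap.vanish
      (isLinearMap_ev₃ ..) (fun _ => IsLinearMap.vanish (isLinearMap_ev₄ ..)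
        (fun _ => h.ev_normal_tangent _ _ _ hn) _) _) _
  have hN : ∀ (p n m : Vec) (c₁ : ι → ℝ), (∀ j, ip g (X j) p = 0) → (∀ j, ip g (X j) n = 0) →
      (∀ j, ip g (X j) m = 0) → ev R p (∑ i, c₁ i • X i) n m = 0 := by
    intro p n m c₁ hp hn hm
    exact IsLinearMap.vanish (isLinearMap_ev₂ ..) (fun _ => h.ev_tangent_normal _ hp hn hm) _
  have hPR : pull P R = R := by
    refine eq_of_ev fun x y z w => ?_
    rw [ev_pull]
    obtain ⟨t₁, n₁, hx, hPx', ⟨d₁, hd₁⟩, hn₁⟩ := hdec x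
    obtain ⟨t₂, n₂, hy, hPy', ⟨d₂, hd₂⟩, hn₂⟩ := hdec y
    obtain ⟨t₃, n₃, hz, hPz', ⟨d₃, hd₃⟩, hn₃⟩ := hdec z
    obtain ⟨t₄, n₄, hw, hPw', ⟨d₄, hd₄⟩, hn₄⟩ := hdec w
    have a1 : ev R n₁ t₂ t₃ t₄ = 0 := by rw [hd₂, hd₃, hd₄]; exact hT _ _ _ _ hn₁
    have a2 : ev R t₁ n₂ t₃ t₄ = 0 := by
      rw [h.swap₁₂, hd₁, hd₃, hd₄, hT _ _ _ _ hn₂, neg_zero]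
    have a3 : ev R t₁ t₂ n₃ t₄ = 0 := by
      rw [h.pair, hd₁, hd₂, hd₄]; exact hT _ _ _ _ hn₃
    have a4 : ev R t₁ t₂ t₃ n₄ = 0 := by
      rw [h.swap₃₄, h.pair, hd₁, hd₂, hd₃, hT _ _ _ _ hn₄, neg_zero]
    have b2 : ev R n₁ t₂ n₃ n₄ = 0 := by rw [hd₂]; exact hN _ _ _ _ hn₁ hn₃ hn₄
    have b1 : ev R t₁ n₂ n₃ n₄ = 0 := by rw [h.swap₁₂, hd₁, hN _ _ _ _ hn₂ hn₃ hn₄, neg_zero]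
    have b4 : ev R n₁ n₂ n₃ t₄ = 0 := by rw [h.pair, hd₄]; exact hN _ _ _ _ hn₃ hn₁ hn₂
    have b3 : ev R n₁ n₂ t₃ n₄ = 0 := by
      rw [h.pair, h.swap₁₂, hd₃, hN _ _ _ _ hn₄ hn₁ hn₂, neg_zero]
    rw [hPx', hPy', hPz', hPw', hx, hy, hz, hw]
    simp only [ev_add₁, ev_add₂, ev_add₃, ev_add₄, ev_smul₁, ev_smul₂, ev_smul₃, ev_smul₄,
      a1, a2, a3, a4, b1, b2, b3, b4]
    ring
  -- the three tangent arguments change sign, the normal one does not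
  have key : belSymmForm (Pᵀ * g * P) (Pᵀ * g * P)⁻¹ (pull P R) (X i) (X j) (X k) n = _ :=
    belSymmForm_pull (inv_pull hPdet) R (X i) (X j) (X k) n
  rw [hPg, hPR, hPX, hPX, hPX, hPn n hn] at key
  rw [(isLinearMap_belSymmForm₁ g g⁻¹ R _ _ _).map_smul,
    (isLinearMap_belSymmForm₂ g g⁻¹ R _ _ _).map_smul,
    (isLinearMap_belSymmForm₃ g g⁻¹ R _ _ _).map_smul] at key
  simp only [smul_eq_mul] at key
  linarith

end

end OrbitData

/-! ### Orbits with a degenerate tangent plane -/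

/-- The inverse of the metric in a frame `l, ξ, w, k` in which `l` and `k` are null with
`⟨l, k⟩ = 1` and all other products of distinct vectors vanish; `a`, `b` are the inverses of
`⟨ξ, ξ⟩` and `⟨w, w⟩`. -/
def nullInv (a b : ℝ) : Mat := !![0, 0, 0, 1; 0, a, 0, 0; 0, 0, b, 0; 1, 0, 0, 0]

/-- Contraction with the inverse metric of a null frame. -/
lemma contr_nullInv (a b : ℝ) (φ : Vec → Vec → ℝ) :
    contr (nullInv a b) φ = φ (Pi.single 0 1) (Pi.single 3 1)
      + a * φ (Pi.single 1 1) (Pi.single 1 1)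
      + b * φ (Pi.single 2 1) (Pi.single 2 1) + φ (Pi.single 3 1) (Pi.single 0 1) := by
  simp [contr, Fin.sum_univ_four, nullInv]

lemma quadr_nullInv (a b : ℝ) (R : Tensor4) (i j k m : Fin 4) :
    quadr (nullInv a b) R (Pi.single i 1) (Pi.single j 1) (Pi.single k 1) (Pi.single m 1) =
      R i 0 k 0 * R j 3 m 3 + a * R i 0 k 1 * R j 3 m 1 + b * R i 0 k 2 * R j 3 m 2
        + R i 0 k 3 * R j 3 m 0
      + a * (R i 1 k 0 * R j 1 m 3 + a * R i 1 k 1 * R j 1 m 1 + b * R i 1 k 2 * R j 1 m 2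
        + R i 1 k 3 * R j 1 m 0)
      + b * (R i 2 k 0 * R j 2 m 3 + a * R i 2 k 1 * R j 2 m 1 + b * R i 2 k 2 * R j 2 m 2
        + R i 2 k 3 * R j 2 m 0)
      + (R i 3 k 0 * R j 0 m 3 + a * R i 3 k 1 * R j 0 m 1 + b * R i 3 k 2 * R j 0 m 2
        + R i 3 k 3 * R j 0 m 0) := by
  simp [quadr_single, Fin.sum_univ_four, nullInv]
  ring

/-- In a null frame `l, ξ, w, k`, let the endomorphisms `R(l, ξ)` and `R(l, w)` map `l` to `0` and
`ξ`, `w` to multiples of `l`, with `R(l, ξ) w = - R(l, w) ξ`. Then the Bel tensor vanishes on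
three vectors `l`, `ξ` followed by one of `l`, `w`. -/
lemma belForm_null_frame {a b : ℝ} {g : Mat} {R : Tensor4}
    (s₁ : ∀ i j k m, R i j k m = - R j i k m) (s₃ : ∀ i j k m, R i j k m = - R i j m k)
    (sp : ∀ i j k m, R i j k m = R k m i j)
    (z₁ : R 0 1 0 1 = 0) (z₂ : R 0 1 0 2 = 0) (z₃ : R 0 1 1 2 = 0) (z₄ : R 0 1 0 3 = 0)
    (z₅ : R 0 2 0 2 = 0) (z₆ : R 0 2 1 2 = 0) (z₇ : R 0 2 0 3 = 0)
    (zr : R 0 1 2 3 = - R 0 2 1 3) (g₀₀ : g 0 0 = 0) (g₁₀ : g 1 0 = 0) (g₀₂ : g 0 2 = 0)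
    (g₁₂ : g 1 2 = 0) {i j k m : Fin 4} (hi : i = 0 ∨ i = 1) (hj : j = 0 ∨ j = 1)
    (hk : k = 0 ∨ k = 1) (hm : m = 0 ∨ m = 2) :
    belForm g (nullInv a b) R (Pi.single i 1) (Pi.single j 1) (Pi.single k 1)
      (Pi.single m 1) = 0 := by
  -- the symmetries of `R` bring its components to a normal form in which the hypotheses apply
  have d : ∀ i k m, R i i k m = 0 := fun i k m => by linarith [s₁ i i k m]
  have d' : ∀ i k m, R k m i i = 0 := fun i k m => by linarith [s₃ k m i i]
  have r₁ := fun k m => s₁ 1 0 k m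
  have r₂ := fun k m => s₁ 2 0 k m
  have r₃ := fun k m => s₁ 3 0 k m
  have r₄ := fun k m => s₁ 2 1 k m
  have r₅ := fun k m => s₁ 3 1 k m
  have r₆ := fun k m => s₁ 3 2 k m
  have q₁ := fun k m => s₃ k m 1 0
  have q₂ := fun k m => s₃ k m 2 0
  have q₄ := fun k m => s₃ k m 2 1
  have p₁ := sp 0 2 0 1
  have p₂ := sp 0 3 0 1
  have p₃ := sp 1 2 0 1
  have p₄ := sp 2 3 0 1
  have p₅ := sp 0 3 0 2
  have p₆ := sp 1 2 0 2
  have p₇ := sp 1 3 0 2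
  have p₈ := sp 1 3 0 1
  have p₉ := sp 2 3 0 2
  rw [z₂] at p₁
  rw [z₄] at p₂
  rw [z₃] at p₃
  rw [zr] at p₄
  rw [z₇] at p₅
  rw [z₆] at p₆
  have hQ : quadr (nullInv a b) R (Pi.single i 1) (Pi.single j 1) (Pi.single k 1)
      (Pi.single m 1) = 0 := by
    rw [quadr_nullInv]
    rcases hi with rfl | rfl <;> rcases hj with rfl | rfl <;> rcases hk with rfl | rfl <;>
    rcases hm with rfl | rfl <;>
    simp only [d, d', r₁, q₁, q₂, q₄, p₁, p₂, p₃, p₅, p₆, p₇, p₈, z₁, z₂, z₃, z₄, z₅, z₆, z₇,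
      zr] <;> ring
  have hQ' : quadr (nullInv a b) R (Pi.single i 1) (Pi.single j 1) (Pi.single m 1)
      (Pi.single k 1) = 0 := by
    rw [quadr_nullInv]
    rcases hi with rfl | rfl <;> rcases hj with rfl | rfl <;> rcases hk with rfl | rfl <;>
    rcases hm with rfl | rfl <;>
    simp only [d, d', r₁, q₁, q₂, q₄, p₁, p₂, p₃, p₅, p₆, p₇, p₈, z₁, z₂, z₃, z₄, z₅, z₆, z₇,
      zr] <;> ring
  have hS : contr (nullInv a b) (fun r s => quadr (nullInv a b) R r s (Pi.single k 1)
      (Pi.single m 1)) = 0 := by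
    rw [contr_nullInv]
    simp only [quadr_nullInv]
    rcases hk with rfl | rfl <;> rcases hm with rfl | rfl <;>
    simp only [d, d', r₁, r₂, r₃, r₄, r₅, r₆, q₁, q₂, q₄, p₁, p₂, p₃, p₄, p₅, p₆, p₇, p₈, p₉,
      z₁, z₂, z₃, z₄, z₅, z₆, z₇, zr] <;> ring
  have hg : g k m = 0 := by
    rcases hk with rfl | rfl <;> rcases hm with rfl | rfl <;> assumption
  rw [belForm, hQ, hQ', hS, dot_single, dot_single, hg]
  ring

/-- A null frame adapted to a null vector `l` and a non-null vector `ξ` orthogonal to it. -/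
lemma exists_null_frame {g : Mat} (hs : gᵀ = g) (hd : IsUnit g.det) {l ξ : Vec} (hl : l ≠ 0)
    (hll : ip g l l = 0) (hlξ : ip g l ξ = 0) (hξ : ip g ξ ξ ≠ 0) :
    ∃ w k : Vec, ip g l k = 1 ∧ ip g k k = 0 ∧ ip g ξ k = 0 ∧ ip g l w = 0 ∧ ip g ξ w = 0 ∧
      ip g k w = 0 ∧ ip g w w ≠ 0 := by
  have hc := ip_comm hs
  obtain ⟨k₁, hk₁⟩ : ∃ k₁, ip g k₁ l ≠ 0 := by
    by_contra! hcon
    exact hl (eq_zero_of_ip hd hcon)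
  -- normalize, then correct the product with `ξ` and finally the norm, without affecting the
  -- previous conditions
  set k₂ : Vec := (ip g k₁ l)⁻¹ • k₁ with hk₂
  have e₂ : ip g l k₂ = 1 := by
    rw [hk₂, ip_smul_right, hc l k₁, inv_mul_cancel₀ hk₁]
  clear_value k₂
  set k₃ : Vec := k₂ - (ip g ξ k₂ / ip g ξ ξ) • ξ with hk₃
  have e₃ : ip g l k₃ = 1 := by
    rw [hk₃, ip_sub_right, ip_smul_right, e₂, hlξ]; ring
  have f₃ : ip g ξ k₃ = 0 := by
    rw [hk₃, ip_sub_right, ip_smul_right]; field_simp; ring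
  clear_value k₃
  set k : Vec := k₃ - (ip g k₃ k₃ / 2) • l with hk
  have e : ip g l k = 1 := by
    rw [hk, ip_sub_right, ip_smul_right, e₃, hll]; ring
  have f : ip g ξ k = 0 := by
    rw [hk, ip_sub_right, ip_smul_right, f₃, hc ξ l, hlξ]; ring
  have n : ip g k k = 0 := by
    rw [hk]
    simp only [ip_sub_right, ip_smul_right, ip_sub_left, ip_smul_left, hll, e₃, hc k₃ l]
    ring
  clear_value k
  -- the projection of a fourth independent vector to the orthogonal complement of `l`, `ξ`, `k`
  obtain ⟨w₀, hw₀⟩ : ∃ w₀ : Vec, w₀ ∉ Submodule.span ℝ (Set.range ![l, ξ, k]) := by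
    by_contra! hcon
    have htop : Submodule.span ℝ (Set.range ![l, ξ, k]) = ⊤ := Submodule.eq_top_iff'.2 hcon
    have h1 := finrank_range_le_card (R := ℝ) ![l, ξ, k]
    rw [Set.finrank, htop, finrank_top] at h1
    simp at h1
  set w : Vec := w₀ - ip g w₀ k • l - ip g w₀ l • k - (ip g w₀ ξ / ip g ξ ξ) • ξ with hw
  have w1 : ip g l w = 0 := by
    rw [hw]
    simp only [ip_sub_right, ip_smul_right, hll, e, hlξ, hc l w₀]; ring
  have w2 : ip g ξ w = 0 := by
    rw [hw]
    simp only [ip_sub_right, ip_smul_right, f, hc ξ l, hlξ, hc ξ w₀]; field_simp; ring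
  have w3 : ip g k w = 0 := by
    rw [hw]
    simp only [ip_sub_right, ip_smul_right, n, hc k l, e, hc k ξ, f, hc k w₀]; ring
  refine ⟨w, k, e, n, f, w1, w2, w3, fun hww => ?_⟩
  -- otherwise `w` would be orthogonal to the span of `l`, `ξ`, `k` and `w`, which is everything
  have hw0 : w ≠ 0 := by
    intro h0
    refine hw₀ ?_
    have : w₀ = ip g w₀ k • l + (ip g w₀ ξ / ip g ξ ξ) • ξ + ip g w₀ l • k := by
      rw [hw, sub_sub, sub_sub, sub_eq_zero] at h0
      exact h0.trans (by abel)
    rw [this]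
    refine Submodule.add_mem _ (Submodule.add_mem _ ?_ ?_) ?_ <;>
      refine Submodule.smul_mem _ _ (Submodule.subset_span ?_)
    · exact ⟨0, rfl⟩
    · exact ⟨1, rfl⟩
    · exact ⟨2, rfl⟩
  have hli : LinearIndependent ℝ ![l, ξ, w, k] := by
    rw [Fintype.linearIndependent_iff]
    intro c hc0
    simp only [Fin.sum_univ_four, Matrix.cons_val_zero, Matrix.cons_val_one, Matrix.cons_val] at hc0
    have p : ∀ y, ip g y (c 0 • l + c 1 • ξ + c 2 • w + c 3 • k) = 0 := fun y => by
      rw [hc0, ip_zero_right]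
    have p0 := p l
    have p1 := p ξ
    have p3 := p k
    simp only [ip_add_right, ip_smul_right, hll, hlξ, w1, e, hc ξ l, w2, f, hc k l, hc k ξ, w3,
      n] at p0 p1 p3
    have c3 : c 3 = 0 := by linarith
    have c1 : c 1 = 0 := by
      have : c 1 * ip g ξ ξ = 0 := by linarith
      exact (mul_eq_zero.1 this).resolve_right hξ
    have c0 : c 0 = 0 := by linarith
    rw [c0, c1, c3] at hc0
    have c2 : c 2 = 0 := by
      have : c 2 • w = 0 := by simpa using hc0
      exact (smul_eq_zero.1 this).resolve_right hw0
    intro i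
    fin_cases i <;> assumption
  have hspan : ⊤ ≤ Submodule.span ℝ (Set.range ![l, ξ, w, k]) :=
    (hli.span_eq_top_of_card_eq_finrank (by simp)).ge
  refine hw0 (eq_zero_of_ip hd fun y => ?_)
  obtain ⟨c, rfl⟩ := (Submodule.mem_span_range_iff_exists_fun ℝ).1
    (hspan (Submodule.mem_top (x := y)))
  rw [ip_sum_left, Fin.sum_univ_four]
  simp [ip_smul_left, w1, w2, w3, hww]

/-- At a point where the tangent plane of the orbit is degenerate, with null direction `l`, the
Bel tensor still vanishes on three tangent vectors followed by a normal one, provided that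
`∇l` annihilates `l`. -/
lemma OrbitData.belForm_eq_zero_of_null {g : Mat} {R : Tensor4} {l ξ : Vec} {A : Fin 2 → Mat}
    (h : OrbitData g R ![l, ξ] A) (hl : l ≠ 0) (hll : ip g l l = 0) (hlξ : ip g l ξ = 0)
    (hξ : ip g ξ ξ ≠ 0) (hA : A 0 *ᵥ l = 0) (i j k : Fin 2) {n : Vec} (hn₀ : ip g l n = 0)
    (hn₁ : ip g ξ n = 0) :
    belForm g g⁻¹ R (![l, ξ] i) (![l, ξ] j) (![l, ξ] k) n = 0 := by
  obtain ⟨w, κ, hlκ, hκκ, hξκ, hlw, hξw, hκw, hww⟩ :=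
    exists_null_frame h.symm h.isUnit_det hl hll hlξ hξ
  have hc := ip_comm h.symm
  have perp : ∀ {n}, ip g l n = 0 → ip g ξ n = 0 → ∀ j, ip g ((![l, ξ] : Fin 2 → Vec) j) n = 0 := by
    intro n h0 h1 j
    fin_cases j <;> assumption
  have hξl : ip g ξ l = 0 := by rw [hc, hlξ]
  -- `l` is an eigenvector of the covariant derivatives of both Killing fields
  have tang : ∀ i {m}, ip g l m = 0 → ip g ξ m = 0 → ∃ y x : ℝ, A i *ᵥ m = y • l + x • ξ := by
    intro i m h0 h1
    obtain ⟨c, hc'⟩ := h.exists_A_eq i (perp h0 h1)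
    exact ⟨c 0, c 1, by rw [hc', Fin.sum_univ_two]; rfl⟩
  have A01 : A 0 *ᵥ ξ = A 1 *ᵥ l := h.comm 0 1
  obtain ⟨c, hAl⟩ : ∃ c : ℝ, A 1 *ᵥ l = c • l := by
    obtain ⟨y, x, hyx⟩ := tang 1 hll hξl
    have h1 : ip g ξ (A 1 *ᵥ l) = 0 := h.ip_X_A_X 1 0 1
    rw [hyx, ip_add_right, ip_smul_right, ip_smul_right, hξl, mul_zero, zero_add] at h1
    have hx := (mul_eq_zero.1 h1).resolve_right hξ
    exact ⟨y, by rw [hyx, hx, zero_smul, add_zero]⟩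
  obtain ⟨τ, hAw⟩ : ∃ τ : ℝ, A 0 *ᵥ w = τ • l := by
    obtain ⟨y, x, hyx⟩ := tang 0 hlw hξw
    have h1 : ip g ξ (A 0 *ᵥ w) = 0 := by
      rw [h.skew, A01, hAl, ip_smul_left, hlw, mul_zero, neg_zero]
    rw [hyx, ip_add_right, ip_smul_right, ip_smul_right, hξl, mul_zero, zero_add] at h1
    have hx := (mul_eq_zero.1 h1).resolve_right hξ
    exact ⟨y, by rw [hyx, hx, zero_smul, add_zero]⟩
  obtain ⟨x, y, hBw⟩ := tang 1 hlw hξw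
  -- the curvature of the planes `l, ξ` and `l, w`
  have cT : ∀ v w', ev R w' v l ξ =
      - ip g (A 0 *ᵥ w') (A 1 *ᵥ v) + ip g (A 1 *ᵥ w') (A 0 *ᵥ v) := by
    intro v w'
    have := h.curvT 0 1 v w'
    rw [h.skew 0 w' (A 1 *ᵥ v), h.skew 1 w' (A 0 *ᵥ v), sub_neg_eq_add] at this
    exact this
  have cN₀ : ∀ v, ev R v l l w = 0 := by
    intro v
    have := h.curvN 0 l w ![0, 0] ![τ, 0] (perp hll hξl) (perp hlw hξw)
      (by simp [hA]) (by simp [hAw]) v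
    have e : (∑ k, (![0, 0] : Fin 2 → ℝ) k • (A k *ᵥ w) -
        ∑ k, (![τ, 0] : Fin 2 → ℝ) k • (A k *ᵥ l)) = 0 := by
      simp [Fin.sum_univ_two, hA]
    rw [e, ip_zero_right] at this
    exact this
  have cN₁ : ∀ v, ev R v ξ l w = (c * (τ - y)) * ip g v l := by
    intro v
    have := h.curvN 1 l w ![c, 0] ![x, y] (perp hll hξl) (perp hlw hξw)
      (by simp [hAl]) (by simp [hBw]) v
    have e : (∑ k, (![c, 0] : Fin 2 → ℝ) k • (A k *ᵥ w) -
        ∑ k, (![x, y] : Fin 2 → ℝ) k • (A k *ᵥ l)) = (c * (τ - y)) • l := by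
      simp only [Fin.sum_univ_two, Matrix.cons_val_zero, Matrix.cons_val_one, hA, hAl, hAw]
      module
    rw [e, ip_smul_right] at this
    exact this
  have hwl : ip g w l = 0 := by rw [hc, hlw]
  have hwξ : ip g w ξ = 0 := by rw [hc, hξw]
  have hκl : ip g κ l = 1 := by rw [hc, hlκ]
  -- the components of `R` that enter into the Bel tensor
  have z₁ : ev R l ξ l ξ = 0 := by
    rw [cT, hA, hAl, A01, hAl]; simp [ip_zero_left, ip_smul_left, ip_smul_right, hll]
  have z₂ : ev R l ξ l w = 0 := by rw [cN₁, hll, mul_zero]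
  have z₃ : ev R l ξ ξ w = 0 := by
    have e : ip g (A 1 *ᵥ ξ) l = 0 := by
      rw [← neg_eq_zero, ← h.skew, hAl, ip_smul_right, hξl, mul_zero]
    rw [h.pair, cT, hAw, A01, hAl, hBw]
    simp only [ip_smul_left, ip_smul_right, ip_add_right, hll, hlξ, e]
    ring
  have z₄ : ev R l ξ l κ = 0 := by
    rw [h.pair, cT, hA, hAl, ip_zero_left, ip_smul_left, h.skew, hA, ip_zero_left]
    ring
  have z₅ : ev R l w l w = 0 := by rw [h.swap₁₂, cN₀, neg_zero]
  have z₆ : ev R l w ξ w = 0 := by rw [h.pair, h.swap₁₂, cN₁, hwl, mul_zero, neg_zero]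
  have z₇ : ev R l w l κ = 0 := by rw [h.pair, h.swap₁₂, cN₀, neg_zero]
  have zr : ev R l ξ w κ = - ev R l w ξ κ := by
    rw [h.pair l w, h.swap₁₂ ξ, cN₁, h.pair l ξ, cT, h.skew 1, h.skew 0, hAw, hBw, mulVec_smul,
      mulVec_add, mulVec_smul, mulVec_smul, hA, A01, hAl, hκl]
    simp only [ip_smul_left, ip_add_left, ip_zero_left, smul_zero, hlκ]
    ring
  -- transport to the frame `l, ξ, w, κ`
  set E : Mat := (Matrix.of ![l, ξ, w, κ])ᵀ with hE
  have hcol : ∀ i, E.col i = ![l, ξ, w, κ] i := fun _ => rfl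
  have hH : ∀ i j, (Eᵀ * g * E) i j = ip g (![l, ξ, w, κ] i) (![l, ξ, w, κ] j) := by
    intro i j
    rw [← dot_single (Eᵀ * g * E) i j, dot_pull, mulVec_single_one, mulVec_single_one, hcol, hcol]
    rfl
  have hκξ : ip g κ ξ = 0 := by rw [hc, hξκ]
  have hwκ : ip g w κ = 0 := by rw [hc, hκw]
  have hone : (Eᵀ * g * E) * nullInv (ip g ξ ξ)⁻¹ (ip g w w)⁻¹ = 1 := by
    ext i j
    rw [Matrix.mul_apply, Fin.sum_univ_four]
    simp only [hH]
    fin_cases i <;> fin_cases j <;>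
      simp [nullInv, hll, hlξ, hlw, hlκ, hξl, hξw, hξκ, hwl, hwξ, hwκ, hκl, hκξ, hκw, hκκ, hξ, hww]
  have hdet : IsUnit E.det := by
    have h1 := congrArg Matrix.det hone
    rw [det_mul, det_mul, det_mul, det_one] at h1
    exact isUnit_iff_ne_zero.2 fun h0 => by simp [h0] at h1
  have hinv : E * nullInv (ip g ξ ξ)⁻¹ (ip g w w)⁻¹ * Eᵀ = g⁻¹ := by
    rw [← Matrix.inv_eq_right_inv hone]; exact inv_pull hdet
  have hR : ∀ i j k m, pull E R i j k m = ev R (![l, ξ, w, κ] i) (![l, ξ, w, κ] j)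
      (![l, ξ, w, κ] k) (![l, ξ, w, κ] m) := fun _ _ _ _ => rfl
  have key : ∀ (i j k : Fin 4) (m : Fin 4), (i = 0 ∨ i = 1) → (j = 0 ∨ j = 1) →
      (k = 0 ∨ k = 1) → (m = 0 ∨ m = 2) →
      belForm g g⁻¹ R (![l, ξ, w, κ] i) (![l, ξ, w, κ] j) (![l, ξ, w, κ] k)
        (![l, ξ, w, κ] m) = 0 := by
    intro i j k m hi hj hk hm
    have := belForm_pull (g := g) hinv R (Pi.single i 1) (Pi.single j 1) (Pi.single k 1)
      (Pi.single m 1)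
    simp only [mulVec_single_one, hcol] at this
    rw [← this]
    refine belForm_null_frame ?_ ?_ ?_ ?_ ?_ ?_ ?_ ?_ ?_ ?_ ?_ ((hH 0 0).trans hll)
      ((hH 1 0).trans hξl) ((hH 0 2).trans hlw) ((hH 1 2).trans hξw) hi hj hk hm
    · intro a b c d; rw [hR, hR]; exact h.swap₁₂ ..
    · intro a b c d; rw [hR, hR]; exact h.swap₃₄ ..
    · intro a b c d; rw [hR, hR]; exact h.pair ..
    · rw [hR]; exact z₁
    · rw [hR]; exact z₂
    · rw [hR]; exact z₃
    · rw [hR]; exact z₄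
    · rw [hR]; exact z₅
    · rw [hR]; exact z₆
    · rw [hR]; exact z₇
    · rw [hR, hR]; exact zr
  -- the normal plane is spanned by `l` and `w`
  obtain ⟨a, b, hab⟩ : ∃ a b : ℝ, n = a • l + b • w := by
    set c := E⁻¹ *ᵥ n
    have hn : n = c 0 • l + c 1 • ξ + c 2 • w + c 3 • κ := by
      have : n = E *ᵥ c := by rw [mulVec_mulVec, Matrix.mul_nonsing_inv _ hdet, one_mulVec]
      rw [this, mulVec_eq_sum_col, Fin.sum_univ_four]
      rfl
    have p0 := hn₀
    have p1 := hn₁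
    rw [hn] at p0 p1
    simp only [ip_add_right, ip_smul_right, hll, hlξ, hlw, hlκ, hξl, hξw, hξκ] at p0 p1
    have c3 : c 3 = 0 := by linarith
    have c1 : c 1 = 0 := by
      have : c 1 * ip g ξ ξ = 0 := by linarith
      exact (mul_eq_zero.1 this).resolve_right hξ
    exact ⟨c 0, c 2, by rw [c1, c3] at hn; simpa using hn⟩
  have hfr : ∀ i : Fin 2, (![l, ξ] : Fin 2 → Vec) i = ![l, ξ, w, κ] (i.castLE (by norm_num)) := by
    intro i; fin_cases i <;> rfl
  have hcast : ∀ i : Fin 2, i.castLE (show 2 ≤ 4 by norm_num) = 0 ∨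
      i.castLE (show 2 ≤ 4 by norm_num) = 1 := by decide
  have hlin := isLinearMap_belForm₄ g g⁻¹ R (![l, ξ] i) (![l, ξ] j) (![l, ξ] k)
  rw [hab, hlin.map_add, hlin.map_smul, hlin.map_smul, hfr, hfr, hfr]
  have e1 := key _ _ _ 0 (hcast i) (hcast j) (hcast k) (Or.inl rfl)
  have e2 := key _ _ _ 2 (hcast i) (hcast j) (hcast k) (Or.inr rfl)
  simp only [Matrix.cons_val_zero, Matrix.cons_val] at e1 e2
  rw [e1, e2]
  simp

/-! ### Curvature along the orbits of an abelian group of isometries -/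

section Orbits

/-- The endomorphism `R(z, w)` of the tangent space. -/
def curvOp (G : R4 → Mat) (u : R4) (z w : Vec) : Mat := ∑ c, z c • ∑ d, w d • curv G c d u

/-- `R(x, y, z, w) = ⟨x, R(z, w) y⟩`. -/
lemma ev_riem (G : R4 → Mat) (u : R4) (x y z w : Vec) :
    ev (riem G u) x y z w = ip (G u) x (curvOp G u z w *ᵥ y) := by
  simp only [ev, ip, curvOp, slice_apply, riem_eq, mulVec, dotProduct, Fin.sum_univ_four, mul_apply,
    Matrix.add_apply, Matrix.smul_apply, smul_eq_mul]
  ring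

variable {U : Set R4} {G : R4 → Mat} {u : R4}

/-- The derivative of a function in the direction of a vector. -/
def dd (z : Vec) (f : R4 → ℝ) (u : R4) : ℝ := ∑ c, z c * pd c f u

lemma nab_mulVec_eq_sum (G : R4 → Mat) (Y : R4 → Vec) (u : R4) (z : Vec) :
    nab G Y u *ᵥ z = ∑ c, z c • (pdV c Y u + Gam G c u *ᵥ Y u) := by
  rw [mulVec_eq_sum_col]
  simp only [nab_col]

section

variable (hG : IsMetricOn U G)

include hG

/-- The Leibniz rule `∇_z (M Y) = (∇_z M) Y + M (∇_z Y)`. -/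
lemma nab_mulVec {M : R4 → Mat} {Y : R4 → Vec} (hM : SmM U M) (hY : SmV U Y) (hu : u ∈ U)
    (z : Vec) : nab G (fun v => M v *ᵥ Y v) u *ᵥ z =
      (∑ c, z c • covM G c M u) *ᵥ Y u + M u *ᵥ (nab G Y u *ᵥ z) := by
  rw [nab_mulVec_eq_sum, nab_mulVec_eq_sum, sum_mulVec, mulVec_sum, ← Finset.sum_add_distrib]
  refine Finset.sum_congr rfl fun c _ => ?_
  rw [pdV_mulVec hG.isOpen hu hM hY, smul_mulVec, mulVec_smul, ← smul_add, covM]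
  congr 1
  simp only [add_mulVec, sub_mulVec, mulVec_add, mulVec_mulVec]
  abel

/-- The metric is parallel. -/
lemma dd_ip {Y Z : R4 → Vec} (hY : SmV U Y) (hZ : SmV U Z) (hu : u ∈ U) (z : Vec) :
    dd z (fun v => ip (G v) (Y v) (Z v)) u =
      ip (G u) (nab G Y u *ᵥ z) (Z u) + ip (G u) (Y u) (nab G Z u *ᵥ z) := by
  rw [dd, nab_mulVec_eq_sum, nab_mulVec_eq_sum, ip_sum_left, ip_sum_right,
    ← Finset.sum_add_distrib]
  refine Finset.sum_congr rfl fun c _ => ?_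
  rw [ip_smul_left, ip_smul_right, ← mul_add]
  congr 1
  simp only [ip]
  rw [pd_dot hG.isOpen hu hY (hG.smooth.mulVec hZ), pdV_mulVec hG.isOpen hu hG.smooth hZ,
    hG.pdM_eq hu]
  have : (Gam G c u *ᵥ Y u) ⬝ᵥ G u *ᵥ Z u = Y u ⬝ᵥ (Gam G c u)ᵀ *ᵥ (G u *ᵥ Z u) := by
    rw [dotProduct_mulVec (Y u), vecMul_transpose]
  simp only [add_mulVec, mulVec_add, dotProduct_add, add_dotProduct, ← mulVec_mulVec, this]
  ring

/-- Kostant's formula for a Killing field: `∇_z ∇X = R(z, X)`. -/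
lemma curvOp_eq_covM {X : R4 → Vec} (hX : IsKillingOn U G X) (hu : u ∈ U) (z : Vec) :
    ∑ c, z c • covM G c (nab G X) u = curvOp G u z (X u) := by
  simp only [kostant hG hX hu, curvOp]

omit hG in
lemma IsKillingOn.ip_skew {X : R4 → Vec} (hX : IsKillingOn U G X) (hu : u ∈ U) (x y : Vec) :
    ip (G u) x (nab G X u *ᵥ y) = - ip (G u) (nab G X u *ᵥ x) y := by
  have h : (nab G X u *ᵥ x) ⬝ᵥ G u *ᵥ y = x ⬝ᵥ (nab G X u)ᵀ *ᵥ (G u *ᵥ y) := by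
    rw [dotProduct_mulVec x, vecMul_transpose]
  rw [ip, ip, h, ← add_eq_zero_iff_eq_neg, mulVec_mulVec, mulVec_mulVec, ← dotProduct_add,
    ← add_mulVec, hX.skew u hu, zero_mulVec, dotProduct_zero]

/-- Torsion-freeness: commuting fields satisfy `∇_Y X = ∇_X Y`. -/
lemma nab_comm {X Y : R4 → Vec} (hu : u ∈ U)
    (comm : ∑ e, X u e • pdV e Y u = jac X u *ᵥ Y u) :
    nab G X u *ᵥ Y u = nab G Y u *ᵥ X u := by
  rw [← jac_mulVec] at comm
  rw [nab_eq hG hu, nab_eq hG hu, add_mulVec, add_mulVec, comm]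
  congr 1
  ext a
  simp only [mulVec, dotProduct, Fin.sum_univ_four, Matrix.add_apply, Matrix.smul_apply,
    smul_eq_mul, hG.Gam_symm hu _ 1 0, hG.Gam_symm hu _ 2 0, hG.Gam_symm hu _ 3 0,
    hG.Gam_symm hu _ 2 1, hG.Gam_symm hu _ 3 1, hG.Gam_symm hu _ 3 2]
  ring

end

lemma ev_eq_sum (T : Tensor4) (x y z w : Vec) :
    ev T x y z w = ∑ a, ∑ b, ∑ c, ∑ d, x a * (y b * (z c * (w d * T a b c d))) := by
  have h₁ : IsLinearMap ℝ fun x => ev T x y z w := ⟨fun _ _ => ev_add₁ .., fun _ _ => ev_smul₁ ..⟩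
  rw [IsLinearMap.eq_sum h₁ x]
  simp only [← Finset.mul_sum]
  refine Finset.sum_congr rfl fun a _ => congrArg _ ?_
  rw [IsLinearMap.eq_sum (isLinearMap_ev₂ T (Pi.single a 1) z w) y]
  refine Finset.sum_congr rfl fun b _ => congrArg _ ?_
  rw [IsLinearMap.eq_sum (isLinearMap_ev₃ T (Pi.single a 1) (Pi.single b 1) w) z]
  refine Finset.sum_congr rfl fun c _ => congrArg _ ?_
  rw [IsLinearMap.eq_sum (isLinearMap_ev₄ T (Pi.single a 1) (Pi.single b 1) (Pi.single c 1)) w]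
  exact Finset.sum_congr rfl fun d _ => by rw [ev_single]

section

variable (hG : IsMetricOn U G)

include hG

lemma ev_riem_swap₁₂ (hu : u ∈ U) (x y z w : Vec) :
    ev (riem G u) x y z w = - ev (riem G u) y x z w := by
  rw [ev_eq_sum, ev_eq_sum, Finset.sum_comm]
  simp only [← Finset.sum_neg_distrib]
  refine Finset.sum_congr rfl fun b _ => Finset.sum_congr rfl fun a _ =>
    Finset.sum_congr rfl fun c _ => Finset.sum_congr rfl fun d _ => ?_
  rw [hG.riem_swap₁₂ hu]
  ring

omit hG in
lemma ev_riem_swap₃₄ (x y z w : Vec) :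
    ev (riem G u) x y z w = - ev (riem G u) x y w z := by
  rw [ev_eq_sum, ev_eq_sum]
  simp only [← Finset.sum_neg_distrib]
  refine Finset.sum_congr rfl fun a _ => Finset.sum_congr rfl fun b _ => ?_
  rw [Finset.sum_comm]
  refine Finset.sum_congr rfl fun d _ => Finset.sum_congr rfl fun c _ => ?_
  rw [riem_swap₃₄]
  ring

lemma ev_riem_bianchi (hu : u ∈ U) (x y z w : Vec) :
    ev (riem G u) x y z w + ev (riem G u) x z w y + ev (riem G u) x w y z = 0 := by
  have h₂ : ∀ f : Fin 4 → Fin 4 → Fin 4 → ℝ, ∑ c, ∑ d, ∑ b, f c d b = ∑ b, ∑ c, ∑ d, f c d b :=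
    fun f => (Finset.sum_congr rfl fun c _ => Finset.sum_comm).trans Finset.sum_comm
  rw [ev_eq_sum, ev_eq_sum _ x z, ev_eq_sum _ x w]
  simp only [h₂ fun c d b => x _ * (z c * (w d * (y b * riem G u _ c d b))),
    ← h₂ fun b c d => x _ * (w d * (y b * (z c * riem G u _ d b c))), ← Finset.sum_add_distrib]
  refine Finset.sum_eq_zero fun a _ => Finset.sum_eq_zero fun b _ => Finset.sum_eq_zero fun c _ =>
    Finset.sum_eq_zero fun d _ => ?_
  linear_combination x a * y b * z c * w d * hG.riem_bianchi hu a b c d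

lemma ev_riem_pair (hu : u ∈ U) (x y z w : Vec) :
    ev (riem G u) x y z w = ev (riem G u) z w x y := by
  have s1 := ev_riem_swap₁₂ hG hu
  have s3 := fun x y z w => ev_riem_swap₃₄ (G := G) (u := u) x y z w
  have b := ev_riem_bianchi hG hu
  linarith [b x y z w, b y z w x, b z w x y, b w x y z, s1 x y z w, s1 x z w y, s1 x w y z,
    s1 y z w x, s1 y w x z, s1 z w x y, s3 x y z w, s3 x z w y, s3 x w y z, s3 y z w x,
    s3 y w x z, s3 z w x y, s3 y x z w, s3 z x w y, s3 w x y z, s3 z y w x, s3 w y x z,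
    s3 w z x y, s1 y x z w, s1 w z y x]

end

lemma Sm.dd_congr {f h : R4 → ℝ} (hU : IsOpen U) (hu : u ∈ U) (e : ∀ v ∈ U, f v = h v) (z : Vec) :
    dd z f u = dd z h u := by
  simp only [dd, pd_congr hU hu e]

lemma nab_congr (hU : IsOpen U) (hu : u ∈ U) {X Y : R4 → Vec} (e : ∀ v ∈ U, X v = Y v) :
    nab G X u = nab G Y u := by
  ext a b
  simp only [nab, of_apply, e u hu, pd_congr hU hu (fun v hv => congrFun (e v hv) a) b]

/-- A vector normal to the orbit through `u` extends to a smooth normal field. With `P` the matrix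
of the `1`-forms associated with the `X i` and `C` a constant right inverse of `P u`, the field is
`det (P C) n - C adj(P C) P n`. -/
lemma exists_normal_field {ι : Type*} [Fintype ι] [DecidableEq ι] (hG : IsMetricOn U G)
    {X : ι → R4 → Vec} (hX : ∀ i, SmV U (X i)) (hu : u ∈ U)
    (li : LinearIndependent ℝ fun i => X i u) {n : Vec} (hn : ∀ j, ip (G u) (X j u) n = 0) :
    ∃ N : R4 → Vec, SmV U N ∧ N u = n ∧ ∀ v ∈ U, ∀ j, ip (G v) (X j v) (N v) = 0 := by
  set B : R4 → Matrix (Fin 4) ι ℝ := fun v => Matrix.of fun k i => X i v k with hB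
  obtain ⟨L, hL⟩ : ∃ L : Matrix ι (Fin 4) ℝ, L * B u = 1 := exists_left_inverse li
  set P : R4 → Matrix ι (Fin 4) ℝ := fun v => (B v)ᵀ * G v with hP
  set C : Matrix (Fin 4) ι ℝ := (G u)⁻¹ * Lᵀ with hC
  -- `P v` is the matrix of the `1`-forms associated with the `X i`, `C` a right inverse of `P u`
  have hPC : P u * C = 1 := by
    rw [hP, hC, Matrix.mul_assoc, ← Matrix.mul_assoc (G u),
      Matrix.mul_nonsing_inv _ (hG.isUnit_det u hu), Matrix.one_mul, ← transpose_mul, hL,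
      transpose_one]
  have hPn : ∀ v y j, (P v *ᵥ y) j = ip (G v) (X j v) y := by
    intro v y j
    rw [hP, ← mulVec_mulVec]; rfl
  have sP : ∀ j k, Sm U fun v => P v j k := by
    intro j k
    simp only [hP, Matrix.mul_apply]
    exact Sm.sum fun e _ => (hX j e).mul (hG.smooth e k)
  have sQ : ∀ i j, Sm U fun v => (P v * C) i j := by
    intro i j
    simp only [Matrix.mul_apply]
    exact Sm.sum fun e _ => (sP i e).mul contDiffOn_const
  have sadj : ∀ i j, Sm U fun v => (P v * C).adjugate i j := by
    intro i j
    simp only [Matrix.adjugate_apply]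
    refine SmM.det fun a b => ?_
    by_cases hab : a = j
    · subst hab
      simp only [Matrix.updateRow_self]
      exact contDiffOn_const
    · simp only [Matrix.updateRow_ne hab]
      exact sQ a b
  refine ⟨fun v => (P v * C).det • n - C *ᵥ ((P v * C).adjugate *ᵥ (P v *ᵥ n)), fun a => ?_, ?_,
    fun v _ j => ?_⟩
  · simp only [Pi.sub_apply, Pi.smul_apply, smul_eq_mul, mulVec, dotProduct]
    exact ((SmM.det sQ).mul contDiffOn_const).sub (Sm.sum fun i _ => contDiffOn_const.mul
      (Sm.sum fun j _ => (sadj i j).mul (Sm.sum fun k _ => (sP j k).mul contDiffOn_const)))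
  · have : P u *ᵥ n = 0 := funext fun j => (hPn u n j).trans (hn j)
    simp only [this, mulVec_zero, sub_zero, hPC, det_one, one_smul]
  · rw [← hPn, mulVec_sub, mulVec_smul, mulVec_mulVec, mulVec_mulVec, Matrix.mul_adjugate,
      smul_mulVec, one_mulVec, sub_self]
    rfl

/-- The points of an orbit of an abelian group of isometries that acts orthogonally transitively
carry orbit data. -/
lemma orbitData {ι : Type*} [Fintype ι] [DecidableEq ι] (hG : IsMetricOn U G)
    {X : ι → R4 → Vec} (hX : ∀ i, IsKillingOn U G (X i))
    (comm : ∀ i j, ∀ v ∈ U, ∑ e, X i v e • pdV e (X j) v = jac (X i) v *ᵥ X j v)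
    (ortho : ∀ v ∈ U, ∀ i n m, (∀ j, ip (G v) (X j v) n = 0) → (∀ j, ip (G v) (X j v) m = 0) →
      ip (G v) n (nab G (X i) v *ᵥ m) = 0)
    (hu : u ∈ U) (li : LinearIndependent ℝ fun i => X i u) :
    OrbitData (G u) (riem G u) (fun i => X i u) (fun i => nab G (X i) u) where
  symm := hG.symm u hu
  isUnit_det := hG.isUnit_det u hu
  swap₁₂ := ev_riem_swap₁₂ hG hu
  swap₃₄ := ev_riem_swap₃₄
  pair := ev_riem_pair hG hu
  skew i x y := (hX i).ip_skew hu x y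
  comm i j := nab_comm hG hu (comm i j u hu)
  ortho := ortho u hu
  curvT i j v w := by
    -- the derivative of `∇_{X j} X i = ∇_{X i} X j`
    have h := congrArg (fun A => A *ᵥ v) (nab_congr (G := G) hG.isOpen hu fun y hy =>
      nab_comm hG hy (comm i j y hy))
    simp only [nab_mulVec hG (hG.smooth_nab (hX _).smooth) (hX _).smooth hu,
      curvOp_eq_covM hG (hX _) hu] at h
    have h1 := congrArg (ip (G u) w) h
    rw [ip_add_right, ip_add_right, ← ev_riem, ← ev_riem] at h1
    have b := ev_riem_bianchi hG hu w v (X i u) (X j u)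
    have s := ev_riem_swap₃₄ (G := G) (u := u) w (X i u) (X j u) v
    linarith
  curvN i n m c d hn hm hc hd v := by
    have hs := ip_comm (hG.symm u hu)
    obtain ⟨N, sN, rfl, hN⟩ := exists_normal_field hG (fun i => (hX i).smooth) hu li hn
    obtain ⟨M, sM, rfl, hM⟩ := exists_normal_field hG (fun i => (hX i).smooth) hu li hm
    have sA := hG.smooth_nab (hX i).smooth
    have hz : ∀ f : R4 → ℝ, (∀ y ∈ U, f y = 0) → dd v f u = 0 := by
      intro f hf
      rw [Sm.dd_congr (h := fun _ => 0) hG.isOpen hu hf]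
      simp [dd]
    -- the derivative of `⟨N, ∇_M (X i)⟩ = 0`
    have h := hz _ fun y hy => ortho y hy i (N y) (M y) (hN y hy) (hM y hy)
    rw [dd_ip hG sN (sA.mulVec sM) hu, nab_mulVec hG sA sM hu, curvOp_eq_covM hG (hX i) hu,
      ip_add_right, ← ev_riem, hd] at h
    -- the derivative of `⟨X k, Y⟩ = 0` for a normal field `Y`
    have e : ∀ {Y : R4 → Vec}, SmV U Y → (∀ y ∈ U, ∀ j, ip (G y) (X j y) (Y y) = 0) → ∀ k,
        ip (G u) (X k u) (nab G Y u *ᵥ v) = ip (G u) v (nab G (X k) u *ᵥ Y u) := by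
      intro Y hY hXY k
      have := hz _ fun y hy => hXY y hy k
      rw [dd_ip hG (hX k).smooth hY hu] at this
      rw [(hX k).ip_skew hu]
      linarith
    have h3 : ip (G u) (N u) (nab G (X i) u *ᵥ (nab G M u *ᵥ v)) =
        - ∑ k, c k * ip (G u) v (nab G (X k) u *ᵥ M u) := by
      rw [(hX i).ip_skew hu, hc, ip_sum_left]
      simp only [ip_smul_left, e sM hM]
    have h4 : ip (G u) (nab G N u *ᵥ v) (∑ k, d k • X k u) =
        ∑ k, d k * ip (G u) v (nab G (X k) u *ᵥ N u) := by
      rw [ip_sum_right]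
      refine Finset.sum_congr rfl fun k _ => ?_
      rw [ip_smul_right, hs, e sN hN]
    rw [h3, h4] at h
    rw [ev_riem_pair hG hu, ip_sub_right, ip_sum_right, ip_sum_right]
    simp only [ip_smul_right]
    linarith

end Orbits

/-! ### Divergence of the Bel currents in a coordinate domain -/

section

variable {U V : Set R4} {G : R4 → Mat} {u : R4}

lemma IsMetricOn.mono (hG : IsMetricOn U G) (hV : IsOpen V) (h : V ⊆ U) : IsMetricOn V G where
  isOpen := hV
  smooth a b := (hG.smooth a b).mono h
  symm v hv := hG.symm v (h hv)
  isUnit_det v hv := hG.isUnit_det v (h hv)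

lemma IsKillingOn.mono {X : R4 → Vec} (hX : IsKillingOn U G X) (h : V ⊆ U) :
    IsKillingOn V G X where
  smooth a := (hX.smooth a).mono h
  skew v hv := hX.skew v (h hv)

lemma jac_add_smul {X Y : R4 → Vec} (hU : IsOpen U) (hX : SmV U X) (hY : SmV U Y) (c : ℝ)
    (hu : u ∈ U) : jac (fun v => Y v + c • X v) u = jac Y u + c • jac X u := by
  ext a b
  have h1 := (hX a).differentiableAt hU hu
  simp only [jac, of_apply, Pi.add_apply, Pi.smul_apply, smul_eq_mul, Matrix.add_apply,
    Matrix.smul_apply]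
  rw [pd_add ((hY a).differentiableAt hU hu) (h1.const_mul c), pd_mul (by fun_prop) h1, pd_const]
  ring

lemma nab_add_smul {X Y : R4 → Vec} (hG : IsMetricOn U G) (hX : SmV U X) (hY : SmV U Y) (c : ℝ)
    (hu : u ∈ U) : nab G (fun v => Y v + c • X v) u = nab G Y u + c • nab G X u := by
  rw [nab_eq hG hu, nab_eq hG hu, nab_eq hG hu, jac_add_smul hG.isOpen hX hY c hu]
  simp only [Fin.sum_univ_four, Pi.add_apply, Pi.smul_apply, smul_eq_mul]
  module

/-- Linear combinations of Killing fields with constant coefficients are Killing fields. -/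
lemma IsKillingOn.add_smul {X Y : R4 → Vec} (hG : IsMetricOn U G) (hX : IsKillingOn U G X)
    (hY : IsKillingOn U G Y) (c : ℝ) : IsKillingOn U G fun v => Y v + c • X v where
  smooth a := (hY.smooth a).add (contDiffOn_const.mul (hX.smooth a))
  skew v hv := by
    have h1 := hX.skew v hv
    have h2 := hY.skew v hv
    rw [nab_add_smul hG hX.smooth hY.smooth c hv]
    simp only [mul_add, add_mul, transpose_add, transpose_smul, mul_smul_comm, smul_mul_assoc]
    calc _ = (G v * nab G Y v + (nab G Y v)ᵀ * G v)
          + c • (G v * nab G X v + (nab G X v)ᵀ * G v) := by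
          module
      _ = 0 := by rw [h1, h2]; simp

/-- Commuting Killing vector fields generating an orthogonally transitive group: `∇_m (X i)` is
tangent to the orbits for every normal vector `m`, wherever the fields are independent. -/
structure IsOrbitFamily {ι : Type*} (U : Set R4) (G : R4 → Mat) (X : ι → R4 → Vec) : Prop where
  metric : IsMetricOn U G
  killing : ∀ i, IsKillingOn U G (X i)
  comm : ∀ i j, ∀ v ∈ U, jac (X j) v *ᵥ X i v = jac (X i) v *ᵥ X j v
  ortho : ∀ v ∈ U, LinearIndependent ℝ (fun i => X i v) → ∀ i n m, (∀ j, ip (G v) (X j v) n = 0) →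
    (∀ j, ip (G v) (X j v) m = 0) → ip (G v) n (nab G (X i) v *ᵥ m) = 0

namespace IsOrbitFamily

variable {ι : Type*} {X : ι → R4 → Vec} (hX : IsOrbitFamily U G X)

include hX

lemma mono (hV : IsOpen V) (h : V ⊆ U) : IsOrbitFamily V G X where
  metric := hX.metric.mono hV h
  killing i := (hX.killing i).mono h
  comm i j v hv := hX.comm i j v (h hv)
  ortho v hv := hX.ortho v (h hv)

lemma comm' (i j : ι) (v : R4) (hv : v ∈ U) :
    ∑ e, X i v e • pdV e (X j) v = jac (X i) v *ᵥ X j v := by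
  rw [← jac_mulVec, hX.comm i j v hv]

/-- The Bel current of the fields `X i`, `X j`, `X k`. -/
def _root_.Coord.orbitCurrent (G : R4 → Mat) (X : ι → R4 → Vec) (i j k : ι) (v : R4) : Vec :=
  belVec (G v) (riem G v) (X i v) (X j v) (X k v)

lemma smooth_orbitCurrent (i j k : ι) : SmV U (orbitCurrent G X i j k) :=
  smooth_belVec hX.metric (hX.killing i).smooth (hX.killing j).smooth (hX.killing k).smooth

variable [Fintype ι] [DecidableEq ι]

/-- If the Bel current is tangent to the orbits near a point, then it is divergence-free there. -/
lemma divergence_eq_zero_of_tangent (i j k : ι) (hu : u ∈ U)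
    (li : LinearIndependent ℝ fun i => X i u)
    (h : ∀ v ∈ U, ∀ n, (∀ j, ip (G v) (X j v) n = 0) →
      belSymmForm (G v) (G v)⁻¹ (riem G v) (X i v) (X j v) (X k v) n = 0) :
    divergence G (fun a v => orbitCurrent G X i j k v a) u = 0 := by
  have hG := hX.metric
  refine divergence_eq_zero_of_mem_span hG hu hX.killing (fun i j => hX.comm' i j u hu)
    (hX.smooth_orbitCurrent i j k) (fun e => lie_belVec hG hu (hX.killing e) (hX.killing i).smooth
      (hX.killing j).smooth (hX.killing k).smooth (hX.comm' e i u hu) (hX.comm' e j u hu)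
      (hX.comm' e k u hu)) (fun v hv => ?_) li
  refine exists_eq_sum_of_perp (hG.symm v hv) (hG.isUnit_det v hv) (fun i => X i v)
    fun n hn => ?_
  rw [ip, orbitCurrent, dot_belVec (hG.isUnit_det v hv)]
  exact h v hv n hn

omit [DecidableEq ι] in
lemma isOpen_linearIndependent : IsOpen {v ∈ U | LinearIndependent ℝ fun i => X i v} := by
  have hc : ContinuousOn (fun v i => X i v) U :=
    continuousOn_pi.2 fun i => continuousOn_pi.2 fun a => ((hX.killing i).smooth a).continuousOn
  exact hc.isOpen_inter_preimage hX.metric.isOpen isOpen_setOfPred_linearIndependent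

omit hX [DecidableEq ι] in
/-- Vectors with invertible Gram matrix are linearly independent. -/
lemma _root_.Coord.linearIndependent_of_gram [DecidableEq ι] {g : Mat} {x : ι → Vec}
    (h : IsUnit (Matrix.of fun i j => ip g (x i) (x j)).det) : LinearIndependent ℝ x := by
  refine Fintype.linearIndependent_iff.2 fun c hc => ?_
  have h1 : (Matrix.of fun i j => ip g (x i) (x j)) *ᵥ c = 0 := by
    ext i
    have := ip_zero_right g (x i)
    rw [← hc, ip_sum_right] at this
    simpa [mulVec, dotProduct, ip_smul_right, mul_comm] using this
  have h2 := Matrix.eq_zero_of_mulVec_eq_zero h.ne_zero h1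
  exact fun i => congrFun h2 i

omit [Fintype ι] [DecidableEq ι] in
lemma smooth_ip (i j : ι) : Sm U fun v => ip (G v) (X i v) (X j v) :=
  (hX.killing i).smooth.dot (hX.metric.smooth.mulVec (hX.killing j).smooth)

/-- The Bel currents are divergence-free wherever the orbits are non-degenerate. -/
lemma divergence_eq_zero_of_gram (i j k : ι) (hu : u ∈ U)
    (hW : (Matrix.of fun i j => ip (G u) (X i u) (X j u)).det ≠ 0) :
    divergence G (fun a v => orbitCurrent G X i j k v a) u = 0 := by
  set W := fun v => (Matrix.of fun i j => ip (G v) (X i v) (X j v)).det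
  have hV : IsOpen (U ∩ {v | W v ≠ 0}) :=
    (SmM.det fun i j => hX.smooth_ip i j).continuousOn.isOpen_inter_preimage hX.metric.isOpen
      isOpen_ne
  have hX' := hX.mono hV Set.inter_subset_left
  have li : ∀ v ∈ U ∩ {v | W v ≠ 0}, LinearIndependent ℝ fun i => X i v :=
    fun v hv => linearIndependent_of_gram (isUnit_iff_ne_zero.2 hv.2)
  refine hX'.divergence_eq_zero_of_tangent i j k ⟨hu, hW⟩ (li u ⟨hu, hW⟩) fun v hv n hn => ?_
  exact (orbitData hX'.metric hX'.killing hX'.comm'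
    (fun v hv => hX'.ortho v hv (li v hv)) hv (li v hv)).belSymmForm_eq_zero
    (isUnit_iff_ne_zero.2 hv.2) i j k hn

end IsOrbitFamily

lemma dd_mul {f h : R4 → ℝ} (hf : DifferentiableAt ℝ f u) (hh : DifferentiableAt ℝ h u) (z : Vec) :
    dd z (fun v => f v * h v) u = dd z f u * h u + f u * dd z h u := by
  simp only [dd, pd_mul hf hh, Finset.sum_mul, Finset.mul_sum, ← Finset.sum_add_distrib]
  exact Finset.sum_congr rfl fun c _ => by ring

lemma linearIndependent_add_smul {X : Fin 2 → R4 → Vec} {f : ℝ} {v : R4} :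
    (LinearIndependent ℝ fun i => (![fun v => X 1 v + f • X 0 v, X 0] : Fin 2 → R4 → Vec) i v) ↔
      LinearIndependent ℝ fun i => X i v := by
  have e : ∀ Y : Fin 2 → R4 → Vec, (fun i => Y i v) = ![Y 0 v, Y 1 v] := fun Y => by
    ext i; fin_cases i <;> rfl
  rw [e, e]
  exact (LinearIndependent.pair_add_smul_left_iff ..).trans LinearIndependent.pair_symm_iff

/-- The family may be replaced by another basis of the same Lie algebra, here one containing the
field `X 1 + f X 0` with constant `f`. -/
lemma IsOrbitFamily.add_smul {X : Fin 2 → R4 → Vec} (hX : IsOrbitFamily U G X) (f : ℝ) :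
    IsOrbitFamily U G ![fun v => X 1 v + f • X 0 v, X 0] where
  metric := hX.metric
  killing i := by
    fin_cases i
    · exact (hX.killing 0).add_smul hX.metric (hX.killing 1) f
    · exact hX.killing 0
  comm i j v hv := by
    have hU := hX.metric.isOpen
    have h := hX.comm 0 1 v hv
    fin_cases i <;> fin_cases j <;>
      simp [jac_add_smul hU (hX.killing 0).smooth (hX.killing 1).smooth f hv, mulVec_add,
        add_mulVec, mulVec_smul, smul_mulVec, h]
  ortho v hv li i n m hn hm := by
    rw [linearIndependent_add_smul] at li
    have hp : ∀ {n}, (∀ j, ip (G v) ((![fun v => X 1 v + f • X 0 v, X 0] : Fin 2 → R4 → Vec) j v) n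
        = 0) → ∀ j, ip (G v) (X j v) n = 0 := by
      intro n hn j
      have h0 : ip (G v) (X 0 v) n = 0 := hn 1
      have h1 : ip (G v) (X 1 v + f • X 0 v) n = 0 := hn 0
      rw [ip_add_left, ip_smul_left, h0, mul_zero, add_zero] at h1
      fin_cases j <;> assumption
    have h := fun i => hX.ortho v hv li i n m (hp hn) (hp hm)
    fin_cases i
    · change ip (G v) n (nab G (fun v => X 1 v + f • X 0 v) v *ᵥ m) = 0
      rw [nab_add_smul hX.metric (hX.killing 0).smooth (hX.killing 1).smooth f hv, add_mulVec,
        smul_mulVec, ip_add_right, ip_smul_right, h, h, mul_zero, add_zero]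
    · exact h 0

/-- The Bel currents are tangent to the orbits on an open set of degenerate orbits. -/
lemma IsOrbitFamily.belSymmForm_eq_zero_of_degenerate {X : Fin 2 → R4 → Vec}
    (hX : IsOrbitFamily U G X) (hu : u ∈ U) (li : ∀ v ∈ U, LinearIndependent ℝ fun i => X i v)
    (hξ : ip (G u) (X 0 u) (X 0 u) ≠ 0)
    (hW : ∀ v ∈ U, (Matrix.of fun i j => ip (G v) (X i v) (X j v)).det = 0) (i j k : Fin 2)
    {n : Vec} (hn : ∀ j, ip (G u) (X j u) n = 0) :
    belSymmForm (G u) (G u)⁻¹ (riem G u) (X i u) (X j u) (X k u) n = 0 := by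
  have hG := hX.metric
  have hs := fun v hv => ip_comm (hG.symm v hv)
  -- `l` is the combination of the two Killing fields, with constant coefficients, that is null and
  -- orthogonal to `X 0` at the point `u`; it need not be null elsewhere
  set f : ℝ := - ip (G u) (X 0 u) (X 1 u) / ip (G u) (X 0 u) (X 0 u) with hf
  set l : R4 → Vec := fun v => X 1 v + f • X 0 v with hl
  have hX' : IsOrbitFamily U G ![l, X 0] := hX.add_smul f
  have hfξ : f * ip (G u) (X 0 u) (X 0 u) = - ip (G u) (X 0 u) (X 1 u) := by
    rw [hf]; field_simp
  have hlξ : ip (G u) (l u) (X 0 u) = 0 := by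
    rw [hl, ip_add_left, ip_smul_left, hfξ, hs u hu]; ring
  have hW' : ∀ v ∈ U, ip (G v) (X 0 v) (X 0 v) * ip (G v) (l v) (l v) =
      ip (G v) (l v) (X 0 v) * ip (G v) (l v) (X 0 v) := by
    intro v hv
    have := hW v hv
    rw [det_fin_two] at this
    simp only [of_apply, hs v hv (X 1 v) (X 0 v)] at this
    simp only [hl, ip_add_left, ip_add_right, ip_smul_left, ip_smul_right,
      hs v hv (X 1 v) (X 0 v)]
    linear_combination this
  have hll : ip (G u) (l u) (l u) = 0 := by
    have := hW' u hu
    rw [hlξ, mul_zero] at this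
    exact (mul_eq_zero.1 this).resolve_left hξ
  have hl0 : l u ≠ 0 := by
    intro h0
    have := Fintype.linearIndependent_iff.1 (li u hu) ![f, 1] (by
      rw [Fin.sum_univ_two, ← h0, hl]; simp [add_comm]) 1
    simp at this
  -- the derivative of the vanishing Gram determinant
  have hA : nab G l u *ᵥ l u = 0 := by
    refine eq_zero_of_ip (hG.isUnit_det u hu) fun z => ?_
    have s₀₀ : DifferentiableAt ℝ (fun v => ip (G v) (X 0 v) (X 0 v)) u :=
      (hX'.smooth_ip 1 1).differentiableAt hG.isOpen hu
    have s₀₁ : DifferentiableAt ℝ (fun v => ip (G v) (l v) (X 0 v)) u :=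
      (hX'.smooth_ip 0 1).differentiableAt hG.isOpen hu
    have s₁₁ : DifferentiableAt ℝ (fun v => ip (G v) (l v) (l v)) u :=
      (hX'.smooth_ip 0 0).differentiableAt hG.isOpen hu
    have h1 := Sm.dd_congr hG.isOpen hu hW' z
    rw [dd_mul s₀₀ s₁₁, dd_mul s₀₁ s₀₁, hll, hlξ, mul_zero, zero_add, zero_mul,
      mul_zero, add_zero] at h1
    have h2 := (mul_eq_zero.1 h1).resolve_left hξ
    have hk : IsKillingOn U G l := hX'.killing 0
    rw [dd_ip hG hk.smooth hk.smooth hu, hs u hu, hk.ip_skew hu, hs u hu _ z] at h2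
    linarith
  have hd := orbitData hG hX'.killing hX'.comm'
    (fun v hv => hX'.ortho v hv (linearIndependent_add_smul.2 (li v hv))) hu
    (linearIndependent_add_smul.2 (li u hu))
  have e1 : (fun i => (![l, X 0] : Fin 2 → R4 → Vec) i u) = ![l u, X 0 u] := by
    ext i; fin_cases i <;> rfl
  rw [e1] at hd
  have hn0 : ip (G u) (l u) n = 0 := by
    rw [hl, ip_add_left, ip_smul_left, hn, hn, mul_zero, add_zero]
  have key := fun i j k => hd.belForm_eq_zero_of_null hl0 hll hlξ hξ hA i j k hn0 (hn 0)
  -- by multilinearity, pass from the basis `l`, `X 0` back to `X 0`, `X 1`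
  have hspan : ∀ i, ∃ c : Fin 2 → ℝ, X i u = ∑ e, c e • (![l u, X 0 u] : Fin 2 → Vec) e := by
    intro i
    fin_cases i
    · exact ⟨![0, 1], by simp [Fin.sum_univ_two]⟩
    · exact ⟨![1, -f], by simp [Fin.sum_univ_two, hl]⟩
  have key' : ∀ i j k, belForm (G u) (G u)⁻¹ (riem G u) (X i u) (X j u) (X k u) n = 0 := by
    intro i j k
    obtain ⟨a, ha⟩ := hspan i
    obtain ⟨b, hb⟩ := hspan j
    obtain ⟨c, hc⟩ := hspan k
    rw [ha, hb, hc]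
    refine IsLinearMap.vanish (isLinearMap_belForm₁ ..) (fun i => ?_) a
    refine IsLinearMap.vanish (isLinearMap_belForm₂ ..) (fun j => ?_) b
    exact IsLinearMap.vanish (isLinearMap_belForm₃ ..) (fun k => key i j k) c
  simp [belSymmForm, key']

lemma continuousOn_divergence (hG : IsMetricOn U G) {J : R4 → Vec} (hJ : SmV U J) :
    ContinuousOn (divergence G fun a v => J v a) U := by
  have : Sm U (divergence G fun a v => J v a) :=
    Sm.sum fun k _ => ((hJ k).pd hG.isOpen k).add
      (Sm.sum fun e _ => (hG.smooth_christoffel k k e).mul (hJ e))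
  exact this.continuousOn

/-- The Bel currents of two commuting Killing fields are divergence-free if the fields are
independent at the points of a dense set. -/
lemma IsOrbitFamily.divergence_eq_zero {X : Fin 2 → R4 → Vec}
    (hX : IsOrbitFamily U G X) (hξ : ∀ v ∈ U, ip (G v) (X 0 v) (X 0 v) ≠ 0)
    (li : ∀ V ⊆ U, IsOpen V → V.Nonempty → ∃ v ∈ V, LinearIndependent ℝ fun i => X i v)
    (i j k : Fin 2) (hu : u ∈ U) :
    divergence G (fun a v => orbitCurrent G X i j k v a) u = 0 := by
  by_contra hne
  have hG := hX.metric
  set δ := divergence G fun a v => orbitCurrent G X i j k v a with hδ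
  -- otherwise the divergence is non-zero on an open set, which contains a non-empty open set `V'`
  -- where the fields are independent; there the orbits are non-degenerate at some point or
  -- degenerate everywhere
  have hV : IsOpen (U ∩ {v | δ v ≠ 0}) :=
    (continuousOn_divergence hG (hX.smooth_orbitCurrent i j k)).isOpen_inter_preimage hG.isOpen
      isOpen_ne
  obtain ⟨w, hw, hwi⟩ := li _ Set.inter_subset_left hV ⟨u, hu, hne⟩
  have hX' := hX.mono hV Set.inter_subset_left
  set V' := {v ∈ U ∩ {v | δ v ≠ 0} | LinearIndependent ℝ fun i => X i v}
  have hX'' : IsOrbitFamily V' G X := hX'.mono hX'.isOpen_linearIndependent fun v hv => hv.1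
  by_cases hW : ∃ v ∈ V', (Matrix.of fun i j => ip (G v) (X i v) (X j v)).det ≠ 0
  · obtain ⟨v, hv, hWv⟩ := hW
    exact hv.1.2 (hX''.divergence_eq_zero_of_gram i j k hv hWv)
  · push Not at hW
    exact hw.2 (hX''.divergence_eq_zero_of_tangent i j k ⟨hw, hwi⟩ hwi fun v hv n hn =>
      hX''.belSymmForm_eq_zero_of_degenerate hv (fun v hv => hv.2) (hξ v hv.1.1) hW i j k hn)

end

/-! ### Unique continuation of Killing vector fields -/

section

variable {U : Set R4} {G : R4 → Mat} {u : R4}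

lemma abs_sum_mul_le {a b : Fin 4 → ℝ} {C s : ℝ} (ha : ∀ e, |a e| ≤ C) (hb : ∀ e, |b e| ≤ s) :
    |∑ e, a e * b e| ≤ 4 * C * s := by
  calc |∑ e, a e * b e| ≤ ∑ e, |a e * b e| := Finset.abs_sum_le_sum_abs _ _
    _ ≤ ∑ _e : Fin 4, C * s := Finset.sum_le_sum fun e _ => by
        rw [abs_mul]
        exact mul_le_mul (ha e) (hb e) (abs_nonneg _) ((abs_nonneg _).trans (ha e))
    _ = 4 * C * s := by simp; ring

/-- A Killing vector field that vanishes at a point together with its covariant derivative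
vanishes on every convex set around that point: along the segments issuing from it, the field and
its derivative solve a linear system of ordinary differential equations. -/
lemma IsKillingOn.eq_zero {X : R4 → Vec} {B : Set R4} (hG : IsMetricOn U G)
    (hX : IsKillingOn U G X) (hB : Convex ℝ B) (hBU : B ⊆ U) (hu : u ∈ B) (h0 : X u = 0)
    (h1 : nab G X u = 0) {w : R4} (hw : w ∈ B) : X w = 0 := by
  set x : Vec := fun a => (w - u) a with hx
  set γ : ℝ → R4 := lineTo u x with hγ
  have hx' : (WithLp.toLp 2 x : R4) = w - u := rfl
  have hγB : ∀ t ∈ Set.Icc (0 : ℝ) 1, γ t ∈ B := fun t ht => by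
    rw [hγ, lineTo, hx']
    exact hB.add_smul_sub_mem hu hw ht
  have hγU : ∀ t ∈ Set.Icc (0 : ℝ) 1, γ t ∈ U := fun t ht => hBU (hγB t ht)
  have hγ1 : γ 1 = w := by rw [hγ, lineTo, hx']; simp
  have hd : ∀ {f : R4 → ℝ}, Sm U f → ∀ t ∈ Set.Icc (0 : ℝ) 1,
      HasDerivAt (fun t => f (γ t)) (∑ c, x c * pd c f (γ t)) t := fun hf t ht =>
    hasDerivAt_comp_lineTo (hf.differentiableAt hG.isOpen (hγU t ht))
  have hcont : ∀ {f : R4 → ℝ}, Sm U f → ContinuousOn (fun t => f (γ t)) (Set.Icc 0 1) :=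
    fun hf t ht => (hd hf t ht).continuousAt.continuousWithinAt
  set A := nab G X with hA
  have sA : SmM U A := hG.smooth_nab hX.smooth
  set Γ : R4 → Mat := fun v => ∑ c, x c • Gam G c v with hΓ
  set R : Fin 4 → R4 → Mat := fun e v => ∑ c, x c • curv G c e v with hR
  have sΓ : SmM U Γ := SmM.sum fun c _ => SmM.smul contDiffOn_const (hG.smooth_Gam c)
  have sR : ∀ e, SmM U (R e) := fun e =>
    SmM.sum fun c _ => SmM.smul contDiffOn_const (hG.smooth_curv c e)
  -- the system: the definition of `∇X`, and Kostant's formula for the derivative of `∇X`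
  have eX : ∀ v, ∑ c, x c • pdV c X v = A v *ᵥ x - Γ v *ᵥ X v := by
    intro v
    rw [hA, nab_mulVec_eq_sum, hΓ, sum_mulVec]
    simp only [smul_add, Finset.sum_add_distrib, smul_mulVec, add_sub_cancel_right]
  have eA : ∀ v ∈ U, ∑ c, x c • pdM c A v = ∑ e, X v e • R e v - Γ v * A v + A v * Γ v := by
    intro v hv
    have h : ∀ c, pdM c A v = ∑ e, X v e • curv G c e v - Gam G c v * A v + A v * Gam G c v := by
      intro c
      rw [← kostant hG hX hv c, covM]; abel
    have hR' : ∑ e, X v e • R e v = ∑ c, x c • ∑ e, X v e • curv G c e v := by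
      simp only [hR, Finset.smul_sum]
      rw [Finset.sum_comm]
      exact Finset.sum_congr rfl fun c _ => Finset.sum_congr rfl fun e _ => smul_comm ..
    rw [hR']
    simp only [h, hΓ, smul_add, smul_sub, Finset.sum_add_distrib, Finset.sum_sub_distrib,
      Finset.sum_mul, Finset.mul_sum, smul_mul_assoc, mul_smul_comm]
  -- the coefficients of the system are bounded on the segment
  obtain ⟨C, hC⟩ : ∃ C : ℝ, ∀ t ∈ Set.Icc (0 : ℝ) 1, (∀ a, |x a| ≤ C) ∧
      (∀ a b, |Γ (γ t) a b| ≤ C) ∧ ∀ e a b, |R e (γ t) a b| ≤ C := by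
    obtain ⟨C, hC⟩ := isCompact_Icc.exists_bound_of_continuousOn
      (f := fun t => (x, (fun a b => Γ (γ t) a b : Fin 4 → Fin 4 → ℝ),
        (fun e a b => R e (γ t) a b : Fin 4 → Fin 4 → Fin 4 → ℝ))) (s := Set.Icc (0 : ℝ) 1)
      (continuousOn_const.prodMk ((continuousOn_pi.2 fun a => continuousOn_pi.2 fun b =>
        hcont (sΓ a b)).prodMk (continuousOn_pi.2 fun e => continuousOn_pi.2 fun a =>
          continuousOn_pi.2 fun b => hcont (sR e a b))))
    refine ⟨C, fun t ht => ?_⟩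
    have h := hC t ht
    rw [norm_prod_le_iff, norm_prod_le_iff] at h
    obtain ⟨h1, h2, h3⟩ := h
    exact ⟨fun a => (norm_le_pi_norm x a).trans h1,
      fun a b => ((norm_le_pi_norm (fun b => Γ (γ t) a b) b).trans (norm_le_pi_norm
        (fun a b => Γ (γ t) a b : Fin 4 → Fin 4 → ℝ) a)).trans h2,
      fun e a b => (((norm_le_pi_norm (fun b => R e (γ t) a b) b).trans (norm_le_pi_norm
        (fun a b => R e (γ t) a b : Fin 4 → Fin 4 → ℝ) a)).trans (norm_le_pi_norm
          (fun e a b => R e (γ t) a b : Fin 4 → Fin 4 → Fin 4 → ℝ) e)).trans h3⟩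
  set f : ℝ → (Fin 4 → ℝ) × (Fin 4 → Fin 4 → ℝ) := fun t => (X (γ t), fun a b => A (γ t) a b)
  set f' : ℝ → (Fin 4 → ℝ) × (Fin 4 → Fin 4 → ℝ) := fun t =>
    (A (γ t) *ᵥ x - Γ (γ t) *ᵥ X (γ t),
      fun a b => (∑ e, X (γ t) e • R e (γ t) - Γ (γ t) * A (γ t) + A (γ t) * Γ (γ t)) a b)
  have hf : ∀ t ∈ Set.Icc (0 : ℝ) 1, HasDerivAt f (f' t) t := by
    intro t ht
    refine HasDerivAt.prodMk (hasDerivAt_pi.2 fun a => ?_)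
      (hasDerivAt_pi.2 fun a => hasDerivAt_pi.2 fun b => ?_)
    · rw [← eX]
      have := hd (hX.smooth a) t ht
      simpa [pdV] using this
    · rw [← eA _ (hγU t ht)]
      have := hd (sA a b) t ht
      simpa [pdM, Matrix.sum_apply] using this
  -- Gronwall's inequality applies with the sup norm of the pair of `X` and `∇X`
  have hbound : ∀ t ∈ Set.Ico (0 : ℝ) 1, ‖f' t‖ ≤ 12 * C * ‖f t‖ := by
    intro t ht
    obtain ⟨c1, c2, c3⟩ := hC t (Set.Ico_subset_Icc_self ht)
    have C0 : 0 ≤ C := (abs_nonneg _).trans (c1 0)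
    have s0 := norm_nonneg (f t)
    have b1 : ∀ a, |X (γ t) a| ≤ ‖f t‖ := fun a =>
      (norm_le_pi_norm (f t).1 a).trans (norm_fst_le (f t))
    have b2 : ∀ a b, |A (γ t) a b| ≤ ‖f t‖ := fun a b =>
      ((norm_le_pi_norm ((f t).2 a) b).trans (norm_le_pi_norm (f t).2 a)).trans (norm_snd_le (f t))
    have hCs : 0 ≤ C * ‖f t‖ := mul_nonneg C0 s0
    have hK : 0 ≤ 12 * C * ‖f t‖ := by linarith
    refine norm_prod_le_iff.2 ⟨(pi_norm_le_iff_of_nonneg hK).2 fun a => ?_,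
      (pi_norm_le_iff_of_nonneg hK).2 fun a => (pi_norm_le_iff_of_nonneg hK).2 fun b => ?_⟩
    · have e1 : |(A (γ t) *ᵥ x) a| ≤ 4 * C * ‖f t‖ := by
        rw [mulVec, dotProduct_comm]
        exact abs_sum_mul_le c1 (fun e => b2 a e)
      have e2 : |(Γ (γ t) *ᵥ X (γ t)) a| ≤ 4 * C * ‖f t‖ :=
        abs_sum_mul_le (fun e => c2 a e) b1
      have := (abs_sub ((A (γ t) *ᵥ x) a) ((Γ (γ t) *ᵥ X (γ t)) a))
      calc ‖(f' t).1 a‖ = |(A (γ t) *ᵥ x) a - (Γ (γ t) *ᵥ X (γ t)) a| := rfl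
        _ ≤ _ := by linarith
    · have e1 : |∑ e, R e (γ t) a b * X (γ t) e| ≤ 4 * C * ‖f t‖ :=
        abs_sum_mul_le (fun e => c3 e a b) b1
      have e2 : |∑ e, Γ (γ t) a e * A (γ t) e b| ≤ 4 * C * ‖f t‖ :=
        abs_sum_mul_le (fun e => c2 a e) (fun e => b2 e b)
      have e3 : |∑ e, Γ (γ t) e b * A (γ t) a e| ≤ 4 * C * ‖f t‖ :=
        abs_sum_mul_le (fun e => c2 e b) (fun e => b2 a e)
      calc ‖(f' t).2 a b‖ = |∑ e, R e (γ t) a b * X (γ t) e - ∑ e, Γ (γ t) a e * A (γ t) e b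
            + ∑ e, Γ (γ t) e b * A (γ t) a e| := by
            simp only [f', Real.norm_eq_abs, Matrix.add_apply, Matrix.sub_apply, Matrix.sum_apply,
              Matrix.smul_apply, smul_eq_mul, Matrix.mul_apply, mul_comm]
        _ ≤ 12 * C * ‖f t‖ := by
            rw [abs_le] at *
            constructor <;> linarith
  have := eq_zero_of_abs_deriv_le_mul_abs_self_of_eq_zero_right (f := f) (f' := f')
    (fun t ht => (hf t ht).continuousAt.continuousWithinAt)
    (fun t ht => (hf t (Set.Ico_subset_Icc_self ht)).hasDerivWithinAt)
    (by
      simp only [f, hγ, lineTo_zero, h0, h1]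
      rfl) hbound 1 (by simp)
  have h2 := congrArg Prod.fst this
  simp only [f, hγ1] at h2
  exact h2

/-- If two Killing fields are dependent on an open set, then a combination of them with constant
coefficients vanishes to first order at a given point. -/
lemma exists_nab_eq_zero {X Y : R4 → Vec} (hG : IsMetricOn U G) (hX : IsKillingOn U G X)
    (hY : IsKillingOn U G Y) (hu : u ∈ U) (hξ : ip (G u) (X u) (X u) ≠ 0)
    (h : ∀ v ∈ U, ∃ c : ℝ, Y v = c • X v) :
    ∃ c : ℝ, Y u + c • X u = 0 ∧ nab G (fun v => Y v + c • X v) u = 0 := by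
  obtain ⟨c, hc⟩ := h u hu
  have h0 : Y u + (-c) • X u = 0 := by rw [hc]; module
  refine ⟨-c, h0, ?_⟩
  set Z : R4 → Vec := fun v => Y v + (-c) • X v with hZ
  have kZ : IsKillingOn U G Z := hX.add_smul hG hY (-c)
  have hs := ip_comm (hG.symm u hu)
  -- `Z` is a multiple of `X` at every point; differentiated at `u`, this relation passes to `∇Z`
  have hdep : ∀ y : Vec, ∀ v ∈ U, ip (G v) y (Z v) * ip (G v) (X v) (X v) =
      ip (G v) (X v) (Z v) * ip (G v) y (X v) := by
    intro y v hv
    obtain ⟨d, hd⟩ := h v hv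
    have : Z v = (d - c) • X v := by rw [hZ]; beta_reduce; rw [hd]; module
    rw [this, ip_smul_right, ip_smul_right]; ring
  set A := nab G Z u with hA
  have s : ∀ {Y Z : R4 → Vec}, SmV U Y → SmV U Z →
      DifferentiableAt ℝ (fun v => ip (G v) (Y v) (Z v)) u := fun hY hZ =>
    Sm.differentiableAt (hY.dot (hG.smooth.mulVec hZ)) hG.isOpen hu
  -- `∇Z` takes its values in the line spanned by `X`
  have key : ∀ y z, ip (G u) y (A *ᵥ z) * ip (G u) (X u) (X u) =
      ip (G u) (X u) (A *ᵥ z) * ip (G u) y (X u) := by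
    intro y z
    have sy : SmV U fun _ : R4 => y := fun _ => contDiffOn_const
    have h1 := Sm.dd_congr hG.isOpen hu (hdep y) z
    have hZ0 : Z u = 0 := h0
    rw [dd_mul (s sy kZ.smooth) (s hX.smooth hX.smooth),
      dd_mul (s hX.smooth kZ.smooth) (s sy hX.smooth), dd_ip hG sy kZ.smooth hu,
      dd_ip hG hX.smooth kZ.smooth hu] at h1
    simp only [hZ0, ip_zero_right, zero_add, zero_mul, add_zero] at h1
    exact h1
  have hAX : A *ᵥ X u = 0 := by
    refine eq_zero_of_ip (hG.isUnit_det u hu) fun y => ?_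
    have h2 := key y (X u)
    have h3 : ip (G u) (X u) (A *ᵥ X u) = 0 := by
      have := kZ.ip_skew hu (X u) (X u)
      rw [hs (nab G Z u *ᵥ X u)] at this
      linarith
    rw [h3, zero_mul] at h2
    exact (mul_eq_zero.1 h2).resolve_right hξ
  -- `⟨X, ∇_z Z⟩ = - ⟨∇_X Z, z⟩ = 0`, hence `∇_z Z = 0`
  have hAz : ∀ z, A *ᵥ z = 0 := by
    intro z
    refine eq_zero_of_ip (hG.isUnit_det u hu) fun y => ?_
    have h2 := key y z
    rw [kZ.ip_skew hu (X u), hAX, ip_zero_left, neg_zero, zero_mul] at h2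
    exact (mul_eq_zero.1 h2).resolve_right hξ
  ext a b
  have := congrFun (hAz (Pi.single b 1)) a
  rwa [mulVec_single_one] at this

end

/-! ### The integrability conditions -/

section

open Equiv

/-- If `α ∧ F = 0` with `α ≠ 0`, the `2`-form `F` vanishes on the kernel of `α`. -/
lemma eq_zero_of_wedge {α : Vec} {F : Mat} (hF : ∀ a b, F a b = - F b a)
    (h : ∀ i : Fin 3 → Fin 4, ∑ σ : Perm (Fin 3),
      ((Perm.sign σ : ℤ) : ℝ) * (α (i (σ 0)) * F (i (σ 1)) (i (σ 2))) = 0)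
    {a : Fin 4} (ha : α a ≠ 0) {n m : Vec} (hn : n ⬝ᵥ α = 0) (hm : m ⬝ᵥ α = 0) :
    n ⬝ᵥ F *ᵥ m = 0 := by
  have hu : (Finset.univ : Finset (Perm (Fin 3))) =
      {1, swap 0 1, swap 0 2, swap 1 2, swap 0 1 * swap 1 2, swap 1 2 * swap 0 1} := by decide
  -- the six permutations give the cyclic sum twice
  have key : ∀ b c, α a * F b c + α b * F c a + α c * F a b = 0 := by
    intro b c
    have := h ![a, b, c]
    rw [hu] at this
    repeat rw [Finset.sum_insert (by decide)] at this
    rw [Finset.sum_singleton] at this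
    simp [swap_apply_def, Perm.sign_mul] at this
    rw [hF a c, hF b a, hF c b] at this
    linarith
  have e : α a * (n ⬝ᵥ F *ᵥ m) + (n ⬝ᵥ α) * ∑ c, m c * F c a + (m ⬝ᵥ α) * ∑ b, n b * F a b =
      ∑ b, ∑ c, n b * m c * (α a * F b c + α b * F c a + α c * F a b) := by
    simp only [dotProduct, mulVec, Fin.sum_univ_four]
    ring
  rw [hn, hm] at e
  simp only [key, mul_zero, Finset.sum_const_zero, zero_mul, add_zero] at e
  exact (mul_eq_zero.1 e).resolve_left ha

/-- If `α ∧ β ∧ F = 0` with `α ∧ β ≠ 0`, the `2`-form `F` vanishes on the common kernel of `α`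
and `β`. -/
lemma eq_zero_of_wedge_wedge {α β : Vec} {F : Mat} (hF : ∀ a b, F a b = - F b a)
    (h : ∀ i : Fin 4 → Fin 4, ∑ σ : Perm (Fin 4),
      ((Perm.sign σ : ℤ) : ℝ) * (α (i (σ 0)) * β (i (σ 1)) * F (i (σ 2)) (i (σ 3))) = 0)
    {a b : Fin 4} (hab : α a * β b - α b * β a ≠ 0) {n m : Vec} (hnα : n ⬝ᵥ α = 0)
    (hmα : m ⬝ᵥ α = 0) (hnβ : n ⬝ᵥ β = 0) (hmβ : m ⬝ᵥ β = 0) : n ⬝ᵥ F *ᵥ m = 0 := by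
  -- contract `α ∧ β ∧ F` with `n` and `m` in its last two arguments, the first two indices being
  -- `a` and `b`
  set i : Fin 4 → Fin 4 → Fin 4 → Fin 4 := fun c d => ![a, b, c, d] with hi
  set T : Perm (Fin 4) → ℝ := fun σ => ∑ c, ∑ d, n c * m d *
    (α (i c d (σ 0)) * β (i c d (σ 1)) * F (i c d (σ 2)) (i c d (σ 3))) with hT
  have hsum : ∑ σ : Perm (Fin 4), ((Perm.sign σ : ℤ) : ℝ) * T σ = 0 := by
    simp only [hT, Finset.mul_sum]
    rw [Finset.sum_comm]
    refine Finset.sum_eq_zero fun c _ => ?_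
    rw [Finset.sum_comm]
    refine Finset.sum_eq_zero fun d _ => ?_
    have := congrArg (fun r => n c * m d * r) (h (i c d))
    simp only [Finset.mul_sum, mul_zero] at this
    rw [← this]
    exact Finset.sum_congr rfl fun σ _ => by ring
  have i2 : ∀ k, k ≠ 2 → ∀ c d, i c d k = i 0 d k := by
    intro k hk c d; fin_cases k <;> first | rfl | exact absurd rfl hk
  have i3 : ∀ k, k ≠ 3 → ∀ c d, i c d k = i c 0 k := by
    intro k hk c d; fin_cases k <;> first | rfl | exact absurd rfl hk
  -- a permutation contributes only if it maps `{0, 1}` to itself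
  have hz : ∀ σ : Perm (Fin 4), T σ ≠ 0 → σ 0 < 2 ∧ σ 1 < 2 := by
    intro σ hσ
    have hne : ∀ j k, j ≠ k → σ j ≠ σ k := fun j k hjk e => hjk (σ.injective e)
    have h2 : ∀ k, ¬ k < (2 : Fin 4) → k = 2 ∨ k = 3 := by decide
    by_contra hcon
    rw [not_and_or] at hcon
    refine hσ ?_
    have comm := Finset.sum_comm (s := (Finset.univ : Finset (Fin 4)))
      (t := (Finset.univ : Finset (Fin 4))) (f := fun c d => n c * m d *
      (α (i c d (σ 0)) * β (i c d (σ 1)) * F (i c d (σ 2)) (i c d (σ 3))))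
    have d2 : ∀ k, σ k = 2 → ∀ j, j ≠ k → ∀ c d, i c d (σ j) = i 0 d (σ j) :=
      fun k hk j hj c d => i2 _ (fun e => hne j k hj (e.trans hk.symm)) c d
    have d3 : ∀ k, σ k = 3 → ∀ j, j ≠ k → ∀ c d, i c d (σ j) = i c 0 (σ j) :=
      fun k hk j hj c d => i3 _ (fun e => hne j k hj (e.trans hk.symm)) c d
    rcases hcon with hc | hc <;> rcases h2 _ hc with h2 | h3
    · simp only [hT]
      rw [comm]
      refine Finset.sum_eq_zero fun d _ => ?_
      have : ∀ c, n c * m d * (α (i c d (σ 0)) * β (i c d (σ 1)) * F (i c d (σ 2)) (i c d (σ 3)))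
          = n c * α c * (m d * β (i 0 d (σ 1)) * F (i 0 d (σ 2)) (i 0 d (σ 3))) := by
        intro c
        rw [d2 0 h2 1 (by decide), d2 0 h2 2 (by decide), d2 0 h2 3 (by decide), h2]
        change n c * m d * (α c * _ * _) = _
        ring
      simp only [this, ← Finset.sum_mul]
      rw [show ∑ c, n c * α c = 0 from hnα, zero_mul]
    · refine Finset.sum_eq_zero fun c _ => ?_
      have : ∀ d, n c * m d * (α (i c d (σ 0)) * β (i c d (σ 1)) * F (i c d (σ 2)) (i c d (σ 3)))
          = m d * α d * (n c * β (i c 0 (σ 1)) * F (i c 0 (σ 2)) (i c 0 (σ 3))) := by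
        intro d
        rw [d3 0 h3 1 (by decide), d3 0 h3 2 (by decide), d3 0 h3 3 (by decide), h3]
        change n c * m d * (α d * _ * _) = _
        ring
      simp only [this, ← Finset.sum_mul]
      rw [show ∑ c, m c * α c = 0 from hmα, zero_mul]
    · simp only [hT]
      rw [comm]
      refine Finset.sum_eq_zero fun d _ => ?_
      have : ∀ c, n c * m d * (α (i c d (σ 0)) * β (i c d (σ 1)) * F (i c d (σ 2)) (i c d (σ 3)))
          = n c * β c * (m d * α (i 0 d (σ 0)) * F (i 0 d (σ 2)) (i 0 d (σ 3))) := by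
        intro c
        rw [d2 1 h2 0 (by decide), d2 1 h2 2 (by decide), d2 1 h2 3 (by decide), h2]
        change n c * m d * (_ * β c * _) = _
        ring
      simp only [this, ← Finset.sum_mul]
      rw [show ∑ c, n c * β c = 0 from hnβ, zero_mul]
    · refine Finset.sum_eq_zero fun c _ => ?_
      have : ∀ d, n c * m d * (α (i c d (σ 0)) * β (i c d (σ 1)) * F (i c d (σ 2)) (i c d (σ 3)))
          = m d * β d * (n c * α (i c 0 (σ 0)) * F (i c 0 (σ 2)) (i c 0 (σ 3))) := by
        intro d
        rw [d3 1 h3 0 (by decide), d3 1 h3 2 (by decide), d3 1 h3 3 (by decide), h3]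
        change n c * m d * (_ * β d * _) = _
        ring
      simp only [this, ← Finset.sum_mul]
      rw [show ∑ c, m c * β c = 0 from hmβ, zero_mul]
  have hfil : (Finset.univ.filter fun σ : Perm (Fin 4) => σ 0 < 2 ∧ σ 1 < 2) =
      {1, swap 0 1, swap 2 3, swap 0 1 * swap 2 3} := by decide
  rw [← Finset.sum_filter_of_ne (p := fun σ : Perm (Fin 4) => σ 0 < 2 ∧ σ 1 < 2)
    (fun σ _ hσ => hz σ (right_ne_zero_of_mul hσ)), hfil] at hsum
  repeat rw [Finset.sum_insert (by decide)] at hsum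
  rw [Finset.sum_singleton] at hsum
  have s1 : Perm.sign (swap (0 : Fin 4) 1) = -1 := by decide
  have s2 : Perm.sign (swap (2 : Fin 4) 3) = -1 := by decide
  have s3 : Perm.sign (swap (0 : Fin 4) 1 * swap 2 3) = 1 := by decide
  have t : n ⬝ᵥ F *ᵥ m = ∑ c, ∑ d, n c * m d * F c d := by
    simp only [dotProduct, mulVec, Finset.mul_sum]
    exact Finset.sum_congr rfl fun c _ => Finset.sum_congr rfl fun d _ => by ring
  have t1 : T 1 = α a * β b * (n ⬝ᵥ F *ᵥ m) := by
    rw [t, Finset.mul_sum]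
    refine Finset.sum_congr rfl fun c _ => ?_
    rw [Finset.mul_sum]
    refine Finset.sum_congr rfl fun d _ => ?_
    change n c * m d * (α a * β b * F c d) = _
    ring
  have t2 : T (swap 0 1) = α b * β a * (n ⬝ᵥ F *ᵥ m) := by
    rw [t, Finset.mul_sum]
    refine Finset.sum_congr rfl fun c _ => ?_
    rw [Finset.mul_sum]
    refine Finset.sum_congr rfl fun d _ => ?_
    change n c * m d * (α b * β a * F c d) = _
    ring
  have t3 : T (swap 2 3) = - (α a * β b * (n ⬝ᵥ F *ᵥ m)) := by
    rw [t, Finset.mul_sum, ← Finset.sum_neg_distrib]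
    refine Finset.sum_congr rfl fun c _ => ?_
    rw [Finset.mul_sum, ← Finset.sum_neg_distrib]
    refine Finset.sum_congr rfl fun d _ => ?_
    change n c * m d * (α a * β b * F d c) = _
    rw [hF d c]
    ring
  have t4 : T (swap 0 1 * swap 2 3) = - (α b * β a * (n ⬝ᵥ F *ᵥ m)) := by
    rw [t, Finset.mul_sum, ← Finset.sum_neg_distrib]
    refine Finset.sum_congr rfl fun c _ => ?_
    rw [Finset.mul_sum, ← Finset.sum_neg_distrib]
    refine Finset.sum_congr rfl fun d _ => ?_
    change n c * m d * (α b * β a * F d c) = _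
    rw [hF d c]
    ring
  rw [t1, t2, t3, t4, s1, s2, s3, Perm.sign_one] at hsum
  push_cast at hsum
  have : (α a * β b - α b * β a) * (n ⬝ᵥ F *ᵥ m) = 0 := by linarith
  exact (mul_eq_zero.1 this).resolve_left hab

end

section

variable {U : Set R4} {G : R4 → Mat} {u : R4}

/-- The exterior derivative of the `1`-form of a Killing field is `-2 ∇_b X_a`. -/
lemma extDer_lower (hG : IsMetricOn U G) {X : R4 → Vec} (hX : IsKillingOn U G X) (hu : u ∈ U)
    (a b : Fin 4) :
    extDer (lower G fun i v => X v i) a b u = - 2 * (G u * nab G X u) a b := by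
  set c := lower G fun i v => X v i
  have h1 := covDeriv_lower hG hX.smooth hu a b
  have h2 := covDeriv_lower hG hX.smooth hu b a
  have h3 : ((nab G X u)ᵀ * G u) a b = (G u * nab G X u) b a := by
    conv_lhs => rw [← hG.symm u hu]
    rw [← transpose_mul]; rfl
  have h4 := congrFun (congrFun (hX.skew u hu) a) b
  rw [Matrix.add_apply, h3, Matrix.zero_apply] at h4
  have h5 : ∑ e, christoffel G e b a u * c e u = ∑ e, christoffel G e a b u * c e u :=
    Finset.sum_congr rfl fun e _ => by rw [hG.christoffel_symm hu]
  rw [covDeriv] at h1 h2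
  rw [extDer]
  linarith

lemma ip_nab_eq (G : R4 → Mat) (X : R4 → Vec) (n m : Vec) :
    ip (G u) n (nab G X u *ᵥ m) = n ⬝ᵥ (G u * nab G X u) *ᵥ m := by
  rw [ip, mulVec_mulVec]

/-- The `2`-form `dX` of a Killing field, up to a factor. -/
lemma skew_mul_nab (hG : IsMetricOn U G) {X : R4 → Vec} (hX : IsKillingOn U G X) (hu : u ∈ U)
    (a b : Fin 4) : (G u * nab G X u) a b = - (G u * nab G X u) b a := by
  have h3 : ((nab G X u)ᵀ * G u) a b = (G u * nab G X u) b a := by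
    conv_lhs => rw [← hG.symm u hu]
    rw [← transpose_mul]; rfl
  have h4 := congrFun (congrFun (hX.skew u hu) a) b
  rw [Matrix.add_apply, h3, Matrix.zero_apply] at h4
  linarith

/-- Hypersurface orthogonality `X ∧ dX = 0` means that `∇X` maps the hyperplane orthogonal to `X`
into the line spanned by `X`. -/
lemma ip_nab_eq_zero_of_wedge (hG : IsMetricOn U G) {X : R4 → Vec} (hX : IsKillingOn U G X)
    (hu : u ∈ U) (hne : ip (G u) (X u) (X u) ≠ 0)
    (h : WedgeExtDerZero (lower G fun i v => X v i) u) {n m : Vec}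
    (hn : ip (G u) (X u) n = 0) (hm : ip (G u) (X u) m = 0) :
    ip (G u) n (nab G X u *ᵥ m) = 0 := by
  have hs := ip_comm (hG.symm u hu)
  have hα : G u *ᵥ X u ≠ 0 := fun h0 => hne (by rw [ip, h0, dotProduct_zero])
  obtain ⟨a, ha⟩ := Function.ne_iff.1 hα
  rw [ip_nab_eq]
  refine eq_zero_of_wedge (skew_mul_nab hG hX hu) (fun i => ?_) ha ((hs _ _).trans hn)
    ((hs _ _).trans hm)
  have h1 := h i
  simp only [extDer_lower hG hX hu] at h1
  have : ∑ σ : Equiv.Perm (Fin 3), ((Equiv.Perm.sign σ : ℤ) : ℝ) *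
      ((G u *ᵥ X u) (i (σ 0)) * (G u * nab G X u) (i (σ 1)) (i (σ 2))) =
      (-1 / 2) * ∑ σ : Equiv.Perm (Fin 3), ((Equiv.Perm.sign σ : ℤ) : ℝ) *
        (lower G (fun i v => X v i) (i (σ 0)) u *
          (-2 * (G u * nab G X u) (i (σ 1)) (i (σ 2)))) := by
    rw [Finset.mul_sum]
    refine Finset.sum_congr rfl fun σ _ => ?_
    rw [show lower G (fun i v => X v i) (i (σ 0)) u = (G u *ᵥ X u) (i (σ 0)) from rfl]
    ring
  rw [this, h1, mul_zero]

/-- Orthogonal transitivity `X ∧ Y ∧ dZ = 0` means that `∇Z` maps the plane orthogonal to `X` and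
`Y` into the plane spanned by them. -/
lemma ip_nab_eq_zero_of_wedge_wedge (hG : IsMetricOn U G) {X Y Z : R4 → Vec}
    (hZ : IsKillingOn U G Z) (hu : u ∈ U) (hne : LinearIndependent ℝ ![X u, Y u])
    (h : WedgeWedgeExtDerZero (lower G fun i v => X v i) (lower G fun i v => Y v i)
      (lower G fun i v => Z v i) u) {n m : Vec}
    (hnX : ip (G u) (X u) n = 0) (hmX : ip (G u) (X u) m = 0)
    (hnY : ip (G u) (Y u) n = 0) (hmY : ip (G u) (Y u) m = 0) :
    ip (G u) n (nab G Z u *ᵥ m) = 0 := by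
  have hs := ip_comm (hG.symm u hu)
  have hX0 : G u *ᵥ X u ≠ 0 := by
    intro h0
    have : X u = 0 := eq_zero_of_ip (hG.isUnit_det u hu) fun y => by
      rw [ip, h0, dotProduct_zero]
    exact hne.ne_zero 0 this
  obtain ⟨a, ha⟩ := Function.ne_iff.1 hX0
  rw [Pi.zero_apply] at ha
  obtain ⟨b, hb⟩ : ∃ b, (G u *ᵥ X u) a * (G u *ᵥ Y u) b - (G u *ᵥ X u) b * (G u *ᵥ Y u) a ≠ 0 := by
    by_contra! hcon
    have : (- (G u *ᵥ Y u) a) • X u + (G u *ᵥ X u) a • Y u = 0 := by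
      refine eq_zero_of_ip (hG.isUnit_det u hu) fun y => ?_
      have : G u *ᵥ ((- (G u *ᵥ Y u) a) • X u + (G u *ᵥ X u) a • Y u) = 0 := by
        ext b
        rw [mulVec_add, mulVec_smul, mulVec_smul]
        simp only [Pi.add_apply, Pi.smul_apply, smul_eq_mul, Pi.zero_apply]
        linarith [hcon b]
      rw [ip, this, dotProduct_zero]
    exact ha (LinearIndependent.pair_iff.1 hne _ _ this).2
  rw [ip_nab_eq]
  refine eq_zero_of_wedge_wedge (skew_mul_nab hG hZ hu) (fun i => ?_) hb ((hs _ _).trans hnX)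
    ((hs _ _).trans hmX) ((hs _ _).trans hnY) ((hs _ _).trans hmY)
  have h1 := h i
  simp only [extDer_lower hG hZ hu] at h1
  have : ∑ σ : Equiv.Perm (Fin 4), ((Equiv.Perm.sign σ : ℤ) : ℝ) *
      ((G u *ᵥ X u) (i (σ 0)) * (G u *ᵥ Y u) (i (σ 1)) * (G u * nab G Z u) (i (σ 2)) (i (σ 3))) =
      (-1 / 2) * ∑ σ : Equiv.Perm (Fin 4), ((Equiv.Perm.sign σ : ℤ) : ℝ) *
        (lower G (fun i v => X v i) (i (σ 0)) u * lower G (fun i v => Y v i) (i (σ 1)) u *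
          (-2 * (G u * nab G Z u) (i (σ 2)) (i (σ 3)))) := by
    rw [Finset.mul_sum]
    refine Finset.sum_congr rfl fun σ _ => ?_
    rw [show lower G (fun i v => X v i) (i (σ 0)) u = (G u *ᵥ X u) (i (σ 0)) from rfl,
      show lower G (fun i v => Y v i) (i (σ 1)) u = (G u *ᵥ Y u) (i (σ 1)) from rfl]
    ring
  rw [this, h1, mul_zero]

end

/-! ### The Bel currents in coordinates -/

section

variable {U : Set R4} {G : R4 → Mat} {u : R4}

/-- For a single field the Gram determinant is `⟨X, X⟩`, so that the orbits of a non-null field are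
non-degenerate everywhere. -/
lemma divergence_belCurrent_eq_zero (hG : IsMetricOn U G) {X : Fin 4 → R4 → ℝ}
    (hX : IsKillingOn U G (vec X)) (hne : ∀ v ∈ U, ip (G v) (vec X v) (vec X v) ≠ 0)
    (h : ∀ v ∈ U, WedgeExtDerZero (lower G X) v) (hu : u ∈ U) :
    divergence G (belCurrent G X X X) u = 0 := by
  have hfam : IsOrbitFamily U G fun _ : Fin 1 => vec X :=
    { metric := hG
      killing := fun _ => hX
      comm := fun _ _ _ _ => rfl
      ortho := fun v hv _ _ n m hn hm =>
        ip_nab_eq_zero_of_wedge hG hX hv (hne v hv) (h v hv) (hn 0) (hm 0) }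
  have := hfam.divergence_eq_zero_of_gram 0 0 0 hu (by
    rw [det_fin_one]; exact hne u hu)
  rw [← this]
  congr 1
  funext k v
  exact belCurrent_eq_belVec ..

/-- Two commuting fields form an orbit family. Their orbits may be degenerate, and the fields
dependent, on sets of points. -/
lemma divergence_belCurrent_eq_zero_of_two (hG : IsMetricOn U G) {X : Fin 2 → Fin 4 → R4 → ℝ}
    (hX : ∀ i, IsKillingOn U G (vec (X i)))
    (comm : ∀ v ∈ U, jac (vec (X 1)) v *ᵥ vec (X 0) v = jac (vec (X 0)) v *ᵥ vec (X 1) v)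
    (hne : ∀ v ∈ U, ip (G v) (vec (X 0) v) (vec (X 0) v) ≠ 0)
    (h : ∀ v ∈ U, ∀ i,
      WedgeWedgeExtDerZero (lower G (X 0)) (lower G (X 1)) (lower G (X i)) v)
    (li : ∀ V ⊆ U, IsOpen V → V.Nonempty → ∃ v ∈ V, LinearIndependent ℝ fun i => vec (X i) v)
    (i j k : Fin 2) (hu : u ∈ U) :
    divergence G (belCurrent G (X i) (X j) (X k)) u = 0 := by
  have hfam : IsOrbitFamily U G fun i => vec (X i) :=
    { metric := hG
      killing := hX
      comm := fun i j v hv => by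
        have := comm v hv
        fin_cases i <;> fin_cases j <;> first | rfl | exact this | exact this.symm
      ortho := fun v hv li i n m hn hm => by
        have e : (fun i => vec (X i) v) = ![vec (X 0) v, vec (X 1) v] := by
          ext i; fin_cases i <;> rfl
        rw [e] at li
        exact ip_nab_eq_zero_of_wedge_wedge hG (hX i) hv li (h v hv i) (hn 0) (hm 0) (hn 1)
          (hm 1) }
  have := hfam.divergence_eq_zero hne li i j k hu
  rw [← this]
  congr 1
  funext k v
  exact belCurrent_eq_belVec ..

end

end Coord

/-! ### Vector fields and metrics in a chart -/

lemma map_eq_sum_single {F : Type*} [AddCommGroup F] [Module ℝ F] [TopologicalSpace F]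
    (L : EuclideanSpace ℝ (Fin 4) →L[ℝ] F) (w : EuclideanSpace ℝ (Fin 4)) :
    L w = ∑ i, w i • L (EuclideanSpace.single i (1 : ℝ)) := by
  have h : w = ∑ i, w i • EuclideanSpace.single i (1 : ℝ) := by
    ext i
    simp [Pi.single_apply]
  conv_lhs => rw [h, map_sum]
  simp only [map_smul]

lemma map_add_smul {E F : Type*} [AddCommGroup E] [Module ℝ E] [TopologicalSpace E]
    [AddCommGroup F] [Module ℝ F] [TopologicalSpace F] (L : E →L[ℝ] F) (x y : E) (c : ℝ) :
    L (y + c • x) = L y + c • L x := by simp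

/-- A bilinear form on linear combinations of four vectors, through its Gram matrix. -/
lemma bilin_sum {F : Type*} [AddCommGroup F] [Module ℝ F] [TopologicalSpace F]
    (L : F →L[ℝ] F →L[ℝ] ℝ) (x y : Fin 4 → ℝ) (b : Fin 4 → F) :
    L (∑ i, x i • b i) (∑ i, y i • b i) =
      Coord.ip (Matrix.of fun i j => L (b i) (b j)) x y := by
  simp only [map_sum, map_smul, sum_apply, smul_apply, smul_eq_mul, Coord.ip, Matrix.mulVec,
    dotProduct, Matrix.of_apply, Finset.mul_sum]
  rw [Finset.sum_comm]
  exact Finset.sum_congr rfl fun i _ => Finset.sum_congr rfl fun j _ => by ring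

section Chart

open Coord Matrix

variable {M : Type*} [TopologicalSpace M] [ChartedSpace (EuclideanSpace ℝ (Fin 4)) M]
  {e : OpenPartialHomeomorph M (EuclideanSpace ℝ (Fin 4))}
  (he : e ∈ IsManifold.maximalAtlas (𝓡 4) ∞ M) {u : EuclideanSpace ℝ (Fin 4)}

include he

lemma mdifferentiable_of_mem_maximalAtlas : e.MDifferentiable (𝓡 4) (𝓡 4) :=
  ⟨(contMDiffOn_of_mem_maximalAtlas he).mdifferentiableOn (by simp),
    (contMDiffOn_symm_of_mem_maximalAtlas he).mdifferentiableOn (by simp)⟩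

lemma mfderiv_comp_mfderiv_symm (hu : u ∈ e.target) (v : EuclideanSpace ℝ (Fin 4)) :
    mfderiv (𝓡 4) (𝓡 4) e (e.symm u) (mfderiv (𝓡 4) (𝓡 4) e.symm u v) = v := by
  have := (mdifferentiable_of_mem_maximalAtlas he).comp_symm_deriv hu
  exact congrArg (fun L => L v) this

lemma mfderiv_symm_comp_mfderiv (hu : u ∈ e.target) (v : TangentSpace (𝓡 4) (e.symm u)) :
    mfderiv (𝓡 4) (𝓡 4) e.symm u (mfderiv (𝓡 4) (𝓡 4) e (e.symm u) v) = v := by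
  have := (mdifferentiable_of_mem_maximalAtlas he).symm_comp_deriv (e.map_target hu)
  rw [e.right_inv hu] at this
  exact congrArg (fun L => L v) this

/-- The coordinate vectors of a chart span the tangent spaces. -/
lemma exists_eq_sum_coordVec (hu : u ∈ e.target) (y : TangentSpace (𝓡 4) (e.symm u)) :
    ∃ d : Fin 4 → ℝ, y = ∑ i, d i • coordVec e i u := by
  rw [← mfderiv_symm_comp_mfderiv he hu y]
  exact ⟨_, map_eq_sum_single (mfderiv (𝓡 4) (𝓡 4) e.symm u) _⟩

/-- A vector field is the combination of the coordinate vectors by its components. -/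
lemma eq_sum_coordVec (X : ∀ p : M, TangentSpace (𝓡 4) p) (hu : u ∈ e.target) :
    X (e.symm u) = ∑ i, vecComp e X i u • coordVec e i u := by
  rw [← mfderiv_symm_comp_mfderiv he hu (X (e.symm u))]
  exact map_eq_sum_single (mfderiv (𝓡 4) (𝓡 4) e.symm u) _

omit he in
lemma vecComp_add_smul (X Y : ∀ p : M, TangentSpace (𝓡 4) p) (c : ℝ) (i : Fin 4) :
    vecComp e (Y + c • X) i u = vecComp e Y i u + c * vecComp e X i u := by
  have := map_add_smul (mfderiv (𝓡 4) (𝓡 4) e (e.symm u)) (X (e.symm u)) (Y (e.symm u)) c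
  exact congrArg (fun w : EuclideanSpace ℝ (Fin 4) => w i) this

lemma isInvertible_mfderiv_symm (hu : u ∈ e.target) :
    (mfderiv (𝓡 4) (𝓡 4) e.symm u).IsInvertible :=
  ⟨(mdifferentiable_of_mem_maximalAtlas he).symm.mfderiv hu, rfl⟩

/-- The pullback of a vector field along the inverse chart is its image under the differential of
the chart. -/
lemma mpullback_symm_eq (X : ∀ p : M, TangentSpace (𝓡 4) p) (hu : u ∈ e.target) :
    VectorField.mpullback (𝓡 4) (𝓡 4) e.symm X u =
      mfderiv (𝓡 4) (𝓡 4) e (e.symm u) (X (e.symm u)) := by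
  rw [VectorField.mpullback_apply]
  have h := mfderiv_symm_comp_mfderiv he hu (X (e.symm u))
  conv_lhs => rw [← h]
  exact (isInvertible_mfderiv_symm he hu).inverse_apply_self _

variable [IsManifold (𝓡 4) ∞ M]

omit [IsManifold (𝓡 4) ∞ M] he in
/-- A vector field read in the chart `e`, as a map of coordinate space. -/
def chartField (e : OpenPartialHomeomorph M (EuclideanSpace ℝ (Fin 4)))
    (X : ∀ p : M, TangentSpace (𝓡 4) p) : EuclideanSpace ℝ (Fin 4) → EuclideanSpace ℝ (Fin 4) :=
  VectorField.mpullback (𝓡 4) (𝓡 4) e.symm X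

/-- A smooth vector field is smooth when read in a chart. -/
lemma contDiffOn_chartField {X : ∀ p : M, TangentSpace (𝓡 4) p} (hX : IsSmoothField X) :
    ContDiffOn ℝ ∞ (chartField e X) e.target := by
  have h1 : ContMDiffOn (𝓡 4) (𝓡 4).tangent ∞ (fun v : EuclideanSpace ℝ (Fin 4) =>
      (⟨v, VectorField.mpullback (𝓡 4) (𝓡 4) e.symm X v⟩ :
        TangentBundle (𝓡 4) (EuclideanSpace ℝ (Fin 4)))) e.target := fun v hv =>
    (ContMDiffAt.mpullback_vectorField_preimage (n := ∞) (hX _)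
      ((contMDiffOn_symm_of_mem_maximalAtlas he).contMDiffAt (e.open_target.mem_nhds hv))
      (isInvertible_mfderiv_symm he hv) (by simp)).contMDiffWithinAt
  exact contMDiffOn_vectorSpace_iff_contDiffOn.1 h1

omit [IsManifold (𝓡 4) ∞ M] in
lemma vecComp_eq_chartField (X : ∀ p : M, TangentSpace (𝓡 4) p) (hu : u ∈ e.target)
    (a : Fin 4) : vecComp e X a u = chartField e X u a := by
  have h := mpullback_symm_eq he X hu
  exact (congrArg (fun w : EuclideanSpace ℝ (Fin 4) => w a) h).symm

omit [IsManifold (𝓡 4) ∞ M] in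
lemma toLp_vecComp (X : ∀ p : M, TangentSpace (𝓡 4) p) (hu : u ∈ e.target) :
    WithLp.toLp 2 (vec (vecComp e X) u) = chartField e X u := by
  ext a
  exact vecComp_eq_chartField he X hu a

lemma smooth_vecComp {X : ∀ p : M, TangentSpace (𝓡 4) p} (hX : IsSmoothField X) :
    SmV e.target (vec (vecComp e X)) := fun a =>
  (contDiffOn_euclidean.1 (contDiffOn_chartField he hX) a).congr fun _ hv =>
    vecComp_eq_chartField he X hv a

/-- The Jacobian of the components is the derivative of the field read in the chart. -/
lemma jac_vecComp {X : ∀ p : M, TangentSpace (𝓡 4) p} (hX : IsSmoothField X) (hu : u ∈ e.target)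
    (z : Vec) (a : Fin 4) : (jac (vec (vecComp e X)) u *ᵥ z) a =
      fderiv ℝ (chartField e X) u (WithLp.toLp 2 z) a := by
  have h := ((contDiffOn_chartField he hX).contDiffAt
    (e.open_target.mem_nhds hu)).differentiableAt (by simp)
  have h1 : fderiv ℝ (fun v => vecComp e X a v) u (WithLp.toLp 2 z) =
      (jac (vec (vecComp e X)) u *ᵥ z) a := by
    rw [fderiv_toLp]
    exact Finset.sum_congr rfl fun b _ => mul_comm _ _
  rw [← h1]
  have h2 : (fun v => vecComp e X a v) =ᶠ[𝓝 u] fun v => chartField e X v a :=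
    Filter.eventually_of_mem (e.open_target.mem_nhds hu) fun v hv => vecComp_eq_chartField he X hv a
  rw [h2.fderiv_eq]
  have h3 := ((EuclideanSpace.proj (𝕜 := ℝ) a).hasFDerivAt.comp u h.hasFDerivAt).fderiv
  exact congrArg (fun L => L (WithLp.toLp 2 z)) h3

/-- In a chart, commuting vector fields have commuting components. -/
lemma jac_comm {X Y : ∀ p : M, TangentSpace (𝓡 4) p} (hX : IsSmoothField X)
    (hY : IsSmoothField Y) (h : ∀ p : M, VectorField.mlieBracket (𝓡 4) X Y p = 0)
    (hu : u ∈ e.target) : jac (vec (vecComp e Y)) u *ᵥ vec (vecComp e X) u =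
      jac (vec (vecComp e X)) u *ᵥ vec (vecComp e Y) u := by
  have hm : minSmoothness ℝ 2 ≤ ∞ := by
    rw [minSmoothness_of_isRCLikeNormedField]
    exact WithTop.coe_le_coe.2 le_top
  have : IsManifold (𝓡 4) (minSmoothness ℝ 2) M := IsManifold.of_le hm
  have h1 := VectorField.mpullback_mlieBracket (n := ∞) (f := e.symm) (x₀ := u)
    ((hX (e.symm u)).mdifferentiableAt (by simp)) ((hY (e.symm u)).mdifferentiableAt (by simp))
    ((contMDiffOn_symm_of_mem_maximalAtlas he).contMDiffAt (e.open_target.mem_nhds hu)) hm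
  rw [VectorField.mpullback_apply, h, map_zero, ← VectorField.mlieBracketWithin_univ,
    VectorField.mlieBracketWithin_eq_lieBracketWithin] at h1
  have h3 : VectorField.lieBracketWithin ℝ (chartField e X) (chartField e Y) Set.univ u = 0 :=
    h1.symm
  rw [VectorField.lieBracketWithin_univ, VectorField.lieBracket, sub_eq_zero] at h3
  ext a
  rw [jac_vecComp he hX hu, jac_vecComp he hY hu, toLp_vecComp he X hu, toLp_vecComp he Y hu, h3]

namespace LorentzMetric

variable (g : LorentzMetric M)

omit he in
lemma comp_apply_symm (i j : Fin 4) : g.comp e u i j = g.comp e u j i := g.symm _ _ _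

/-- The metric is computed from the components of the vectors in a chart. -/
lemma val_eq_ip (X Y : ∀ p : M, TangentSpace (𝓡 4) p) (hu : u ∈ e.target) :
    g.val (e.symm u) (X (e.symm u)) (Y (e.symm u)) =
      ip (g.comp e u) (vec (vecComp e X) u) (vec (vecComp e Y) u) := by
  rw [eq_sum_coordVec he X hu, eq_sum_coordVec he Y hu]
  exact bilin_sum (g.val (e.symm u)) _ _ _

/-- The matrix of the components of the metric is invertible, because a Lorentzian scalar product
is non-degenerate and the coordinate vectors form a basis. -/
lemma isUnit_det_comp (hu : u ∈ e.target) : IsUnit (g.comp e u).det := by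
  rw [isUnit_iff_ne_zero]
  intro h0
  obtain ⟨c, hc, hcz⟩ := Matrix.exists_mulVec_eq_zero_iff.2 h0
  -- the vector with components `c` is orthogonal to every vector
  set w : TangentSpace (𝓡 4) (e.symm u) := ∑ i, c i • coordVec e i u with hw
  have hwv : ∀ y, g.val (e.symm u) y w = 0 := by
    intro y
    obtain ⟨d, hd⟩ := exists_eq_sum_coordVec he hu y
    rw [hd, hw]
    refine (bilin_sum (g.val (e.symm u)) _ _ _).trans ?_
    have : (Matrix.of fun i j => g.val (e.symm u) (coordVec e i u) (coordVec e j u)) *ᵥ c = 0 := hcz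
    rw [ip, this, dotProduct_zero]
  -- a vector orthogonal to an orthonormal basis is zero
  obtain ⟨b, hb⟩ := g.lorentzian (e.symm u)
  have hw0 : w = 0 := by
    have h2 : ∀ j, b.repr w j = 0 := by
      intro j
      have h3 := hwv (b j)
      rw [← b.sum_repr w] at h3
      simp only [map_sum, map_smul, hb, smul_eq_mul, mul_ite, mul_zero, Finset.sum_ite_eq,
        Finset.mem_univ, if_true] at h3
      by_cases hj : j = 0
      · simpa [hj] using h3
      · simpa [hj] using h3
    rw [← b.sum_repr w]
    simp [h2]
  have h4 : mfderiv (𝓡 4) (𝓡 4) e.symm u (WithLp.toLp 2 c : EuclideanSpace ℝ (Fin 4)) = w :=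
    map_eq_sum_single (mfderiv (𝓡 4) (𝓡 4) e.symm u) (WithLp.toLp 2 c)
  have h5 := mfderiv_comp_mfderiv_symm he hu (WithLp.toLp 2 c)
  rw [h4, hw0, map_zero] at h5
  refine hc (funext fun i => ?_)
  exact (congrArg (fun v : EuclideanSpace ℝ (Fin 4) => v i) h5).symm

/-- The components of the metric in a chart are smooth, being the values of a smooth section of
bilinear forms on the smooth coordinate vector fields. -/
lemma smooth_comp : SmM e.target (g.comp e) := by
  have hb : ContMDiffOn (𝓡 4) (𝓡 4) ∞ e.symm e.target := contMDiffOn_symm_of_mem_maximalAtlas he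
  -- the coordinate vector fields are the images of constant fields under the tangent map
  have hc : ∀ i, ContMDiffOn (𝓡 4) (𝓡 4).tangent ∞ (fun v : EuclideanSpace ℝ (Fin 4) =>
      (⟨e.symm v, coordVec e i v⟩ : TangentBundle (𝓡 4) M)) e.target := by
    intro i
    have h1 := hb.contMDiffOn_tangentMapWithin (m := ∞) (by simp) e.open_target.uniqueMDiffOn
    have h2 : ContMDiffOn (𝓡 4) (𝓡 4).tangent ∞ (fun v : EuclideanSpace ℝ (Fin 4) =>
        (⟨v, (EuclideanSpace.single i (1 : ℝ) : EuclideanSpace ℝ (Fin 4))⟩ :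
          TangentBundle (𝓡 4) (EuclideanSpace ℝ (Fin 4)))) e.target :=
      contMDiffOn_vectorSpace_iff_contDiffOn.2 contDiffOn_const
    refine (h1.comp h2 fun v hv => hv).congr fun v hv => ?_
    simp only [Function.comp, tangentMapWithin, mfderivWithin_of_isOpen e.open_target hv]
    rfl
  intro i j
  have h3 := ContMDiffOn.clm_bundle_apply₂ (F₁ := EuclideanSpace ℝ (Fin 4))
    (F₂ := EuclideanSpace ℝ (Fin 4)) (F₃ := ℝ) (E₁ := (TangentSpace (𝓡 4) : M → Type _))
    (E₂ := (TangentSpace (𝓡 4) : M → Type _)) (E₃ := Bundle.Trivial M ℝ) (b := e.symm)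
    (ψ := fun v => g.val (e.symm v)) (v := fun v => coordVec e i v)
    (w := fun v => coordVec e j v) (g.contMDiff.comp_contMDiffOn hb) (hc i) (hc j)
  intro v hv
  have h4 := h3 v hv
  rw [Bundle.contMDiffWithinAt_totalSpace] at h4
  exact h4.2.contDiffWithinAt

lemma isMetricOn_comp : IsMetricOn e.target (g.comp e) where
  isOpen := e.open_target
  smooth := g.smooth_comp he
  symm v _ := by ext i j; exact g.comp_apply_symm j i
  isUnit_det v hv := g.isUnit_det_comp he hv

variable {g}

/-- The coordinate expression of a Killing field is a Killing field. -/
lemma IsKilling.isKillingOn {X : ∀ p : M, TangentSpace (𝓡 4) p} (hX : g.IsKilling X) :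
    IsKillingOn e.target (g.comp e) (Coord.vec (vecComp e X)) where
  smooth := smooth_vecComp he hX.1
  skew v hv := by
    have hG := g.isMetricOn_comp he
    ext a b
    have h := hX.2 e he v hv a b
    have h1 := covDeriv_lower hG (smooth_vecComp he hX.1) hv
    have h2 : ((nab (g.comp e) (Coord.vec (vecComp e X)) v)ᵀ * g.comp e v) a b =
        (g.comp e v * nab (g.comp e) (Coord.vec (vecComp e X)) v) b a := by
      conv_lhs => rw [← hG.symm v hv]
      rw [← transpose_mul]; rfl
    rw [Matrix.add_apply, h2, ← h1, ← h1]
    exact h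

end LorentzMetric

end Chart

/-! ### Dependent Killing vector fields -/

section Dependence

open Coord Matrix

variable {M : Type*} [TopologicalSpace M] [ChartedSpace (EuclideanSpace ℝ (Fin 4)) M]
  {e : OpenPartialHomeomorph M (EuclideanSpace ℝ (Fin 4))} {u : EuclideanSpace ℝ (Fin 4)}

lemma vecComp_eq_zero {Z : ∀ p : M, TangentSpace (𝓡 4) p} (h : Z (e.symm u) = 0) :
    Coord.vec (vecComp e Z) u = 0 := by
  ext i
  have h1 : mfderiv (𝓡 4) (𝓡 4) e (e.symm u) (Z (e.symm u)) = 0 := by rw [h, map_zero]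
  exact congrArg (fun w : EuclideanSpace ℝ (Fin 4) => w i) h1

variable [IsManifold (𝓡 4) ∞ M] {g : LorentzMetric M}

namespace LorentzMetric

/-- A vector field which is Killing in every chart, and vanishes to first order at a point, vanishes
on every convex coordinate domain around this point. -/
lemma eventually_eq_zero (he : e ∈ IsManifold.maximalAtlas (𝓡 4) ∞ M)
    {Z : ∀ p : M, TangentSpace (𝓡 4) p}
    (hZ : IsKillingOn e.target (g.comp e) (Coord.vec (vecComp e Z)))
    {B : Set (EuclideanSpace ℝ (Fin 4))} (hB : IsOpen B) (hBc : Convex ℝ B) (hBe : B ⊆ e.target)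
    (hu : u ∈ B) (h0 : Coord.vec (vecComp e Z) u = 0)
    (h1 : nab (g.comp e) (Coord.vec (vecComp e Z)) u = 0) {p : M} (hp : p ∈ e.source)
    (hpB : e p ∈ B) : ∀ᶠ q in 𝓝 p, Z q = 0 := by
  have hO : IsOpen (e.source ∩ e ⁻¹' B) := e.isOpen_inter_preimage hB
  refine Filter.eventually_of_mem (hO.mem_nhds ⟨hp, hpB⟩) fun q hq => ?_
  have h2 := hZ.eq_zero (g.isMetricOn_comp he) hBc hBe hu h0 h1 hq.2
  have h3 := eq_sum_coordVec he Z (hBe hq.2)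
  have h4 : ∀ i, vecComp e Z i (e q) = 0 := fun i => congrFun h2 i
  simp only [h4, zero_smul, Finset.sum_const_zero] at h3
  rwa [e.left_inv hq.1] at h3

/-- On a connected spacetime, a vector field which is Killing in every chart and vanishes to first
order at a point vanishes identically. -/
lemma eq_zero_of_killing [ConnectedSpace M] {Z : ∀ p : M, TangentSpace (𝓡 4) p}
    (hZ : ∀ e ∈ IsManifold.maximalAtlas (𝓡 4) ∞ M,
      IsKillingOn e.target (g.comp e) (Coord.vec (vecComp e Z)))
    (he : e ∈ IsManifold.maximalAtlas (𝓡 4) ∞ M) (hu : u ∈ e.target)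
    (h0 : Coord.vec (vecComp e Z) u = 0)
    (h1 : nab (g.comp e) (Coord.vec (vecComp e Z)) u = 0) (p : M) : Z p = 0 := by
  -- the set of the points near which `Z` vanishes is open by definition, and closed by unique
  -- continuation in coordinate balls
  set S : Set M := {p | ∀ᶠ q in 𝓝 p, Z q = 0} with hS
  have hne : S.Nonempty := by
    obtain ⟨r, hr, hre⟩ := Metric.isOpen_iff.1 e.open_target u hu
    refine ⟨e.symm u, eventually_eq_zero he (hZ e he) Metric.isOpen_ball (convex_ball u r) hre
      (Metric.mem_ball_self hr) h0 h1 (e.map_target hu) ?_⟩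
    rw [e.right_inv hu]
    exact Metric.mem_ball_self hr
  have hop : IsOpen S := isOpen_setOfPred_eventually_nhds
  have hcl : IsClosed S := by
    refine isClosed_of_closure_subset fun p hp => ?_
    set c := chartAt (EuclideanSpace ℝ (Fin 4)) p
    have hc : c ∈ IsManifold.maximalAtlas (𝓡 4) ∞ M := IsManifold.chart_mem_maximalAtlas p
    have hpc : p ∈ c.source := mem_chart_source _ p
    obtain ⟨r, hr, hre⟩ := Metric.isOpen_iff.1 c.open_target (c p) (c.map_source hpc)
    have hO : IsOpen (c.source ∩ c ⁻¹' Metric.ball (c p) r) :=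
      c.isOpen_inter_preimage Metric.isOpen_ball
    obtain ⟨q, ⟨hqc, hqB⟩, hqS⟩ := mem_closure_iff.1 hp _ hO ⟨hpc, Metric.mem_ball_self hr⟩
    have hqt := c.map_source hqc
    have h2 : ∀ᶠ v in 𝓝 (c q), Z (c.symm v) = 0 := by
      have := c.symm.continuousAt (x := c q) hqt
      rw [ContinuousAt, c.left_inv hqc] at this
      exact this.eventually hqS
    obtain ⟨W, hW, hWo, hqW⟩ := eventually_nhds_iff.1 h2
    have h3 : ∀ v ∈ W, Coord.vec (vecComp c Z) v = (fun _ => 0 : R4 → Vec) v :=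
      fun v hv => vecComp_eq_zero (hW v hv)
    refine eventually_eq_zero hc (hZ c hc) Metric.isOpen_ball (convex_ball _ r) hre hqB
      (h3 _ hqW) ?_ hpc (Metric.mem_ball_self hr)
    rw [nab_congr hWo hqW h3]
    ext a b
    simp [nab]
  have : p ∈ S := by
    have hclopen : IsClopen S := ⟨hcl, hop⟩
    rw [hclopen.eq_univ hne]
    trivial
  exact this.self_of_nhds

/-- A non-null field has non-zero norm in coordinates. -/
lemma vec_ne_zero {X : ∀ p : M, TangentSpace (𝓡 4) p} (hX : g.NonNull X)
    (he : e ∈ IsManifold.maximalAtlas (𝓡 4) ∞ M) (hu : u ∈ e.target) :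
    ip (g.comp e u) (Coord.vec (vecComp e X) u) (Coord.vec (vecComp e X) u) ≠ 0 := by
  rw [← g.val_eq_ip he X X hu]
  exact hX _

/-- Killing vector fields that are linearly independent over `ℝ` are independent at the points of
a dense set. -/
lemma exists_linearIndependent [ConnectedSpace M] {ξ η : ∀ p : M, TangentSpace (𝓡 4) p}
    (hξ : g.IsKilling ξ) (hη : g.IsKilling η) (hn : g.NonNull ξ)
    (li : LinearIndependent ℝ ![ξ, η]) (he : e ∈ IsManifold.maximalAtlas (𝓡 4) ∞ M)
    {V : Set R4} (hV : V ⊆ e.target) (hVo : IsOpen V) (hVne : V.Nonempty) :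
    ∃ v ∈ V, LinearIndependent ℝ ![Coord.vec (vecComp e ξ) v, Coord.vec (vecComp e η) v] := by
  by_contra! hcon
  obtain ⟨u, hu⟩ := hVne
  have hdep : ∀ v ∈ V, ∃ c : ℝ, Coord.vec (vecComp e η) v = c • Coord.vec (vecComp e ξ) v := by
    intro v hv
    have hne : Coord.vec (vecComp e ξ) v ≠ 0 := fun h0 =>
      vec_ne_zero hn he (hV hv) (by rw [h0, ip_zero_left])
    have := hcon v hv
    rw [LinearIndependent.pair_iff' hne] at this
    push Not at this
    obtain ⟨c, hc⟩ := this
    exact ⟨c, hc.symm⟩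
  have hG := g.isMetricOn_comp he
  obtain ⟨c, h0, h1⟩ := exists_nab_eq_zero (hG.mono hVo hV) ((hξ.isKillingOn he).mono hV)
    ((hη.isKillingOn he).mono hV) hu (vec_ne_zero hn he (hV hu)) hdep
  have hvec : ∀ e : OpenPartialHomeomorph M (EuclideanSpace ℝ (Fin 4)),
      Coord.vec (vecComp e (η + c • ξ)) =
        fun v => Coord.vec (vecComp e η) v + c • Coord.vec (vecComp e ξ) v := by
    intro e
    funext v i
    exact vecComp_add_smul ξ η c i
  -- a constant combination of the fields vanishes to first order at `u`, hence everywhere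
  have hz : η + c • ξ = 0 := by
    funext p
    refine eq_zero_of_killing (g := g) (e := e) (u := u) (fun e' he' => ?_) he (hV hu) ?_ ?_ p
    · rw [hvec]
      exact (hξ.isKillingOn he').add_smul (g.isMetricOn_comp he') (hη.isKillingOn he') c
    · rw [hvec]
      exact h0
    · rw [hvec]
      exact h1
  have := (LinearIndependent.pair_iff.1 li c 1 (by rw [one_smul, add_comm]; exact hz)).2
  exact one_ne_zero this

end LorentzMetric

end Dependence

end

theorem mainTheorem2 {M : Type*} [TopologicalSpace M] [ConnectedSpace M]
    [ChartedSpace (EuclideanSpace ℝ (Fin 4)) M] [IsManifold (𝓡 4) ∞ M] (g : LorentzMetric M) :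
    (∀ ξ : (∀ p : M, TangentSpace (𝓡 4) p),
      g.IsKilling ξ → g.NonNull ξ → g.IsIntegrable ξ → g.BelCurrentDivergenceFree ξ ξ ξ) ∧
    (∀ ξ η : (∀ p : M, TangentSpace (𝓡 4) p),
      g.IsKilling ξ → g.IsKilling η → g.NonNull ξ → g.NonNull η →
      LinearIndependent ℝ ![ξ, η] →
      (∀ p : M, VectorField.mlieBracket (𝓡 4) ξ η p = 0) →
      g.OrthogonallyTransitive ξ η →
      ∀ L P N : Fin 2,
        g.BelCurrentDivergenceFree (![ξ, η] L) (![ξ, η] P) (![ξ, η] N)) := by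
  constructor
  · intro ξ hξ hn hi e he u hu
    exact Coord.divergence_belCurrent_eq_zero (g.isMetricOn_comp he) (hξ.isKillingOn he)
      (fun v hv => LorentzMetric.vec_ne_zero hn he hv) (hi e he) hu
  · intro ξ η hξ hη hn _ li hc ho L P N e he u hu
    refine Coord.divergence_belCurrent_eq_zero_of_two (g.isMetricOn_comp he)
      (X := fun i => vecComp e (![ξ, η] i)) (fun i => ?_)
      (fun v hv => jac_comm he hξ.1 hη.1 hc hv) (fun v hv => LorentzMetric.vec_ne_zero hn he hv)
      (fun v hv i => ?_) (fun V hV hVo hVne => ?_) L P N hu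
    · fin_cases i
      · exact hξ.isKillingOn he
      · exact hη.isKillingOn he
    · fin_cases i
      · exact (ho e he v hv).1
      · exact (ho e he v hv).2
    · obtain ⟨v, hv, h⟩ :=
        LorentzMetric.exists_linearIndependent hξ hη hn li he hV hVo hVne
      refine ⟨v, hv, ?_⟩
      convert h using 1
      ext i
      fin_cases i <;> rfl
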